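/- Let $\Phi=(V_0,R,V_0^\vee,R^\vee)$ be a finite real root system, not necessarily crystallographic, with $R$ spanning $V_0$ and $R^\vee$ spanning $V_0^\vee$, with perfect pairing $(\cdot,\cdot):V_0\times V_0^\vee\to\mathbb R$, and reduced (two linearly dependent distinct roots are opposite). Let $W$ be its Weyl group, acting on $V_0$ and on $V_0^\vee$, with reflections $s_\alpha$ ($\alpha\in R$); on $V_0^\vee$, $s_\alpha(\omega)=\omega-(\alpha,\omega)\alpha^\vee$. Fix positive roots $R^+\subset R$ with simple roots $\Pi$, a $W$-invariant inner product $\langle\cdot,\cdot\rangle$ on $V_0^\vee$, extended complex-bilinearly to $V^\vee=V_0^\vee\otimes_{\mathbb R}\mathbb C$, and a $W$-invariant function $c:R\to\mathbb R$, $\alpha\mapsto c_\alpha$. Let $\mathbb H=\mathbb H(\Phi,c)$ be the graded affine Hecke algebra: the unital associative $\mathbb C$-algebra generated by symbols $t_w$ ($w\in W$) and $t_f$ ($f\in S(V^\vee)$), subject to the relations that $w\mapsto t_w$ extends to an algebra map on $\mathbb C[W]$, that $f\mapsto t_f$ (written $f\mapsto f$) is an algebra map on $S(V^\vee)$, and $$\omega\,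 t_{s_\alpha}-t_{s_\alpha}s_\alpha(\omega)=c_\alpha(\alpha,\omega)\qquad(\alpha\in\Pi,\ \omega\in V^\vee).$$ Let $C(V^\vee)$ be the complex Clifford algebra generated by $V^\vee$ with relations $\omega\omega'+\omega'\omega=-2\langle\omega,\omega'\rangle$, let $\epsilon$ be its automorphism with $\epsilon(\omega)=-\omega$ and ${}^t$ its anti-automorphism with $\omega^t=-\omega$ ($\omega\in V^\vee$). Let $\mathsf{Pin}(V^\vee)=\{a\in C(V^\vee): a^t=a^{-1},\ \epsilon(a)V^\vee a^{-1}\subset V^\vee\}$, with $p(a)(\omega)=\epsilon(a)\omega a^{-1}$, and let $\widetilde W=p^{-1}(W)\subset\mathsf{Pin}(V^\vee)$, a central extension of $W$ by $\{\pm1\}$. Let $\rho:\mathbb C[\widetilde W]\to\mathbb H\otimes C(V^\vee)$ be the algebra map with $\rho(\widetilde w)=t_{p(\widetilde w)}\otimes\widetilde w$. Call $\zeta\in\mathbb C[\widetilde W]$ genuine if $[-1]\,\zeta=-\zeta$, where $[-1]\in\mathbb C[\widetilde W]$ is the basis element given by the group element $-1\in\widetilde W$. For $\omega\in V^\vee$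 put $$\widetilde\omega=\omega-\tfrac12\sum_{\beta\in R^+}c_\beta(\beta,\omega)t_{s_\beta}\in\mathbb H,\qquad \mathcal D=\sum_i\widetilde\omega_i\otimes\omega^i\in\mathbb H\otimes C(V^\vee),$$ where $\{\omega_i\}$, $\{\omega^i\}$ are dual bases of $V^\vee$, i.e. $\langle\omega_i,\omega^j\rangle=\delta_{ij}$ (the element $\mathcal D$ does not depend on them). **Theorem.** For every $z$ in the center $Z(\mathbb H)$ there are elements $a,b\in\mathbb H\otimes C(V^\vee)$ and a unique genuine element $\zeta(z)$ in the center of $\mathbb C[\widetilde W]$ such that $$z\otimes1=\rho(\zeta(z))+\mathcal D a+b\mathcal D .$$ Moreover one can take $b=a$. Without the restriction to genuine elements, uniqueness holds for the image under $\rho$: if $\zeta'$ is any element of the center of $\mathbb C[\widetilde W]$ and $z\otimes1=\rho(\zeta')+\mathcal D a'+b'\mathcal D$ for some $a',b'\in\mathbb H\otimes C(V^\vee)$, then $\rho(\zeta')=\rho(\zeta(z))$. -/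

import Mathlib

open scoped TensorProduct NNReal

noncomputable section

namespace HeckeDirac

section Setup

variable {ι V N : Type*} [Fintype ι] [AddCommGroup V] [Module ℝ V]
  [NormedAddCommGroup N] [InnerProductSpace ℝ N]

/-- A simple system `Π` of a real root system, not necessarily crystallographic (so the coefficients
of a root in terms of simple roots are real, not integral). Simple systems correspond bijectively
to choices of positive roots: `Π` determines the positive roots through `SimpleSystem.IsPos`. -/
structure SimpleSystem (P : RootPairing ι ℝ V N) where
  /-- The (indices of the) simple roots. -/
  simple : Set ι
  linearIndepOn_root : LinearIndepOn ℝ P.root simple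
  mem_cone_or_neg_mem_cone : ∀ i,
    P.root i ∈ Submodule.span ℝ≥0 (P.root '' simple) ∨
      -P.root i ∈ Submodule.span ℝ≥0 (P.root '' simple)

/-- Positive roots: nonnegative combinations of simple roots. -/
def SimpleSystem.IsPos {P : RootPairing ι ℝ V N} (S : SimpleSystem P) (i : ι) : Prop :=
  P.root i ∈ Submodule.span ℝ≥0 (P.root '' S.simple)

/-- The Weyl group `W`, in its faithful action on `V₀^∨`, where `s_α` acts by
`v' ↦ v' - (α, v') α^∨`. -/
def weylGroup (P : RootPairing ι ℝ V N) : Subgroup (N ≃ₗ[ℝ] N) :=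
  Subgroup.closure (Set.range P.coreflection)

/-- The reflection `s_α` as an element of `W`. -/
def weylRefl (P : RootPairing ι ℝ V N) (i : ι) : weylGroup P :=
  ⟨P.coreflection i, Subgroup.subset_closure ⟨i, rfl⟩⟩

/-- The complex-linear action of `W` on `V^∨ = ℂ ⊗ V₀^∨`. -/
def act (P : RootPairing ι ℝ V N) (w : weylGroup P) : (ℂ ⊗[ℝ] N) →ₗ[ℂ] (ℂ ⊗[ℝ] N) :=
  ((w : N ≃ₗ[ℝ] N) : N →ₗ[ℝ] N).baseChange ℂ

/-- The functional `ω ↦ (α, ω)` on `V^∨ = ℂ ⊗ V₀^∨`. -/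
def rootFun (P : RootPairing ι ℝ V N) (i : ι) : (ℂ ⊗[ℝ] N) →ₗ[ℂ] ℂ :=
  LinearMap.liftBaseChange ℂ (Complex.ofRealCLM.toLinearMap ∘ₗ P.root' i)

/-! ### The graded affine Hecke algebra -/

/-- Generators `t_w` (`w ∈ W`) and `t_f` (`f ∈ S(V^∨)`). -/
abbrev Gen (P : RootPairing ι ℝ V N) : Type _ :=
  weylGroup P ⊕ SymmetricAlgebra ℂ (ℂ ⊗[ℝ] N)

/-- The generator `t_w` in the free algebra. -/
abbrev genW (P : RootPairing ι ℝ V N) (w : weylGroup P) : FreeAlgebra ℂ (Gen P) :=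
  FreeAlgebra.ι ℂ (Sum.inl w)

/-- The generator `t_f` in the free algebra. -/
abbrev genS (P : RootPairing ι ℝ V N) (f : SymmetricAlgebra ℂ (ℂ ⊗[ℝ] N)) :
    FreeAlgebra ℂ (Gen P) :=
  FreeAlgebra.ι ℂ (Sum.inr f)

/-- The defining relations of the graded affine Hecke algebra: `w ↦ t_w` extends to an algebra map
on `ℂ[W]`, `f ↦ t_f` is an algebra map on `S(V^∨)`, and
`ω t_{s_α} - t_{s_α} s_α(ω) = c_α (α, ω)` for `α` simple and `ω ∈ V^∨`. -/
inductive HeckeRel (P : RootPairing ι ℝ V N) (S : SimpleSystem P) (c : ι → ℝ) :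
    FreeAlgebra ℂ (Gen P) → FreeAlgebra ℂ (Gen P) → Prop
  | one_W : HeckeRel P S c (genW P 1) 1
  | mul_W (w w' : weylGroup P) : HeckeRel P S c (genW P (w * w')) (genW P w * genW P w')
  | algebraMap_S (r : ℂ) : HeckeRel P S c (genS P (algebraMap ℂ _ r)) (algebraMap ℂ _ r)
  | add_S (f g : SymmetricAlgebra ℂ (ℂ ⊗[ℝ] N)) :
      HeckeRel P S c (genS P (f + g)) (genS P f + genS P g)
  | mul_S (f g : SymmetricAlgebra ℂ (ℂ ⊗[ℝ] N)) :
      HeckeRel P S c (genS P (f * g)) (genS P f * genS P g)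
  | cross (i : ι) (hi : i ∈ S.simple) (v : ℂ ⊗[ℝ] N) :
      HeckeRel P S c
        (genS P (SymmetricAlgebra.ι ℂ _ v) * genW P (weylRefl P i)
          - genW P (weylRefl P i) * genS P (SymmetricAlgebra.ι ℂ _ (act P (weylRefl P i) v)))
        (algebraMap ℂ _ ((c i : ℂ) * rootFun P i v))

/-- The graded affine Hecke algebra `H = H(Φ, c)`. -/
abbrev Hecke (P : RootPairing ι ℝ V N) (S : SimpleSystem P) (c : ι → ℝ) : Type _ :=
  RingQuot (HeckeRel P S c)

/-- The element `t_w` of `H`, multiplicatively in `w`. -/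
def tW (P : RootPairing ι ℝ V N) (S : SimpleSystem P) (c : ι → ℝ) :
    weylGroup P →* Hecke P S c where
  toFun w := RingQuot.mkAlgHom ℂ (HeckeRel P S c) (genW P w)
  map_one' := by
    rw [RingQuot.mkAlgHom_rel ℂ (HeckeRel.one_W (P := P) (S := S) (c := c)), map_one]
  map_mul' w w' := by
    rw [RingQuot.mkAlgHom_rel ℂ (HeckeRel.mul_W (P := P) (S := S) (c := c) w w'), map_mul]

/-- The element `ω` of `H`, for `ω ∈ V^∨`. -/
def tV (P : RootPairing ι ℝ V N) (S : SimpleSystem P) (c : ι → ℝ) (v : ℂ ⊗[ℝ] N) : Hecke P S c :=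
  RingQuot.mkAlgHom ℂ (HeckeRel P S c) (genS P (SymmetricAlgebra.ι ℂ _ v))

open Classical in
/-- The element `ω̃ = ω - (1/2) ∑_{β > 0} c_β (β, ω) t_{s_β}` of `H`. -/
def tildeV (P : RootPairing ι ℝ V N) (S : SimpleSystem P) (c : ι → ℝ) (v : ℂ ⊗[ℝ] N) :
    Hecke P S c :=
  tV P S c v -
    (1 / 2 : ℂ) • ∑ β : ι with S.IsPos β, ((c β : ℂ) * rootFun P β v) • tW P S c (weylRefl P β)

/-! ### The Clifford algebra and the spin cover of the Weyl group -/

/-- The complex-bilinear extension to `V^∨` of the inner product of `V₀^∨`. -/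
def complexForm (N : Type*) [NormedAddCommGroup N] [InnerProductSpace ℝ N] :
    LinearMap.BilinForm ℂ (ℂ ⊗[ℝ] N) :=
  LinearMap.BilinForm.baseChange ℂ (innerₗ N)

/-- The quadratic form `ω ↦ -⟨ω, ω⟩` on `V^∨`. -/
def negForm (N : Type*) [NormedAddCommGroup N] [InnerProductSpace ℝ N] :
    QuadraticForm ℂ (ℂ ⊗[ℝ] N) :=
  LinearMap.BilinMap.toQuadraticMap (-complexForm N)

/-- The Clifford algebra `C(V^∨)`, with `ω ω' + ω' ω = -2 ⟨ω, ω'⟩`. -/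
abbrev Cliff (N : Type*) [NormedAddCommGroup N] [InnerProductSpace ℝ N] : Type _ :=
  CliffordAlgebra (negForm N)

/-- The spin cover `W̃`, that is, the preimage of `W` under `p : Pin(V^∨) → O(V^∨)`,
`p(a)(ω) = ε(a) ω a⁻¹`. Its elements are the pairs `(a, w)` with `a` in the Clifford algebra,
`w ∈ W`, `a^t = a⁻¹` and `ε(a) ω = w(ω) a` for all `ω ∈ V^∨`; here `w` is determined by `a`.
The antiautomorphism `a ↦ a^t` (with `ω^t = -ω`) is Mathlib's `star`, and the condition
`a^t = a⁻¹` is membership in Mathlib's `unitary`. -/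
def spinCover (P : RootPairing ι ℝ V N) : Subgroup (unitary (Cliff N) × weylGroup P) where
  carrier := {x | ∀ v : ℂ ⊗[ℝ] N,
    CliffordAlgebra.involute (x.1 : Cliff N) * CliffordAlgebra.ι (negForm N) v =
      CliffordAlgebra.ι (negForm N) (act P x.2 v) * (x.1 : Cliff N)}
  one_mem' := by
    intro v
    have h : act P 1 v = v := by
      change (LinearMap.id : N →ₗ[ℝ] N).baseChange ℂ v = v
      simp
    simp [h]
  mul_mem' := by
    intro x y hx hy v
    have h : act P (x.2 * y.2) v = act P x.2 (act P y.2 v) := by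
      change (((x.2 : N ≃ₗ[ℝ] N) : N →ₗ[ℝ] N) ∘ₗ
        ((y.2 : N ≃ₗ[ℝ] N) : N →ₗ[ℝ] N)).baseChange ℂ v = _
      rw [LinearMap.baseChange_comp]
      rfl
    change CliffordAlgebra.involute ((x.1 : Cliff N) * (y.1 : Cliff N)) * _ =
      CliffordAlgebra.ι (negForm N) (act P (x.2 * y.2) v) * ((x.1 : Cliff N) * (y.1 : Cliff N))
    rw [map_mul, mul_assoc, hy v, ← mul_assoc, hx, h, mul_assoc]
  inv_mem' := by
    intro x hx v
    have h : act P x.2 (act P x.2⁻¹ v) = v := by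
      change (((x.2 : N ≃ₗ[ℝ] N) : N →ₗ[ℝ] N).baseChange ℂ ∘ₗ
        (((x.2⁻¹ : weylGroup P) : N ≃ₗ[ℝ] N) : N →ₗ[ℝ] N).baseChange ℂ) v = v
      rw [← LinearMap.baseChange_comp]
      have h' : (((x.2 : N ≃ₗ[ℝ] N) : N →ₗ[ℝ] N) ∘ₗ
          (((x.2⁻¹ : weylGroup P) : N ≃ₗ[ℝ] N) : N →ₗ[ℝ] N)) = LinearMap.id := by
        ext u
        exact (x.2 : N ≃ₗ[ℝ] N).apply_symm_apply u
      rw [h']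
      simp
    have hinv : ((x⁻¹).1 : Cliff N) = star (x.1 : Cliff N) := rfl
    have h1 : star (x.1 : Cliff N) * (x.1 : Cliff N) = 1 := Unitary.coe_star_mul_self x.1
    have h2 : (x.1 : Cliff N) * star (x.1 : Cliff N) = 1 := Unitary.coe_mul_star_self x.1
    have key := hx (act P x.2⁻¹ v)
    rw [h] at key
    have h3 : CliffordAlgebra.involute (star (x.1 : Cliff N)) *
        CliffordAlgebra.involute (x.1 : Cliff N) = 1 := by
      rw [← map_mul, h1, map_one]
    change CliffordAlgebra.involute ((x⁻¹).1 : Cliff N) * _ =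
      CliffordAlgebra.ι (negForm N) (act P x.2⁻¹ v) * ((x⁻¹).1 : Cliff N)
    rw [hinv]
    calc CliffordAlgebra.involute (star (x.1 : Cliff N)) * CliffordAlgebra.ι (negForm N) v
        = CliffordAlgebra.involute (star (x.1 : Cliff N)) *
            (CliffordAlgebra.ι (negForm N) v * (x.1 : Cliff N)) * star (x.1 : Cliff N) := by
          rw [mul_assoc, mul_assoc, h2, mul_one]
      _ = _ := by
          rw [← key, ← mul_assoc, h3, one_mul]

/-- The element `-1` of `W̃ ⊂ Pin(V^∨)`. -/
def minusOne (P : RootPairing ι ℝ V N) : spinCover P :=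
  ⟨(⟨-1, by simp [Unitary.mem_iff]⟩, 1), by
    intro v
    have h : act P 1 v = v := by
      change (LinearMap.id : N →ₗ[ℝ] N).baseChange ℂ v = v
      simp
    simp [h]⟩

/-- The group algebra `ℂ[W̃]`. -/
abbrev SpinAlg (P : RootPairing ι ℝ V N) : Type _ := MonoidAlgebra ℂ (spinCover P)

/-- An element `ζ` of `ℂ[W̃]` is genuine if the group element `-1 ∈ W̃` acts on it as the
scalar `-1`. -/
def IsGenuine (P : RootPairing ι ℝ V N) (ζ : SpinAlg P) : Prop :=
  MonoidAlgebra.of ℂ (spinCover P) (minusOne P) * ζ = -ζ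

/-- The diagonal map `ρ : ℂ[W̃] → H ⊗ C(V^∨)`, the linear extension of `w̃ ↦ t_{p(w̃)} ⊗ w̃`. -/
def rho (P : RootPairing ι ℝ V N) (S : SimpleSystem P) (c : ι → ℝ) :
    SpinAlg P →ₐ[ℂ] Hecke P S c ⊗[ℂ] Cliff N :=
  MonoidAlgebra.lift ℂ (Hecke P S c ⊗[ℂ] Cliff N) (spinCover P)
    { toFun := fun x => tW P S c x.1.2 ⊗ₜ[ℂ] (x.1.1 : Cliff N)
      map_one' := by simp [Algebra.TensorProduct.one_def]
      map_mul' := fun x y => by simp [Algebra.TensorProduct.tmul_mul_tmul] }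

/-- The Dirac element `D = ∑ ω̃_i ⊗ ω^i` of `H ⊗ C(V^∨)` formed with bases `{ω_i}`, `{ω^i}`
of `V^∨`, to be applied to dual ones. -/
def dirac (P : RootPairing ι ℝ V N) (S : SimpleSystem P) (c : ι → ℝ) {κ : Type*} [Fintype κ]
    (b b' : Module.Basis κ ℂ (ℂ ⊗[ℝ] N)) : Hecke P S c ⊗[ℂ] Cliff N :=
  ∑ i, tildeV P S c (b i) ⊗ₜ[ℂ] CliffordAlgebra.ι (negForm N) (b' i)

end Setup

end HeckeDirac

end

/-!
# Dirac cohomology and the center of a graded affine Hecke algebra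

Write `A = H ⊗ C(V^∨)`, let `ε` be the parity automorphism of `A`, `D` the Dirac element, and
`d(x) = D x - ε(x) D`. The theorem is a statement about the cohomology of `d` on the invariants of the
finite group `W̃`, which acts through `ρ`.

*The differential.* The elements `ω̃` satisfy `t_w ω̃ = (wω)~ t_w` (`tW_mul_tildeV`), because a
simple reflection permutes the positive roots other than its own. Hence `D ρ(x) = ε(ρ(x)) D`
(`dirac_mul_spinHom`). With `q = ∑ ω_i²` and `T` the combination of the lifts of the reflections
which is the degree zero part of `-D`, one gets `D² = -q ⊗ 1 - T²` (`dirac_mul_self`), where `q` is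
central in `H` (`casimir_comm`). So `D²` commutes with the elements that are invariant or
`ε`-twisted invariant under `W̃`, and `d² = 0` on them.

*Exactness.* By the Poincaré–Birkhoff–Witt theorem (`pbwEquiv`), `A` is a free module over
`S(V^∨) ⊗ C(V^∨)` on lifts to `W̃` of the elements of `W`, and for the filtration by polynomial degree `d`
is, up to lower degree, the supercommutator with `∑ e_i ⊗ e_i` on each coefficient
(`dirac_diff_mem`). Identifying `C(V^∨)` with the exterior algebra, this is the Koszul
differential, whose cohomology is the scalars (`kosz_exact`, `kosz_exact_zero`; the proof uses the
homotopy `koszHtpy` and the invertibility of the number operator plus a positive scalar). Averaging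
primitives over `W̃` and descending on the degree, every invariant `x` with `d x = 0` is `r + d y`
with `r` in the span of `ρ(W̃)` and `y` a twisted invariant (`DiracDatum.exists_sub_d_mem`).

*Existence.* The element `z ⊗ 1` is even and central, so `d(z ⊗ 1) = 0`. Taking the odd part of the
primitive gives `d a = D a + a D` (`DiracDatum.exists_odd_sub_d_mem`), and replacing an element of
`ℂ[W̃]` by its genuine part does not change its image under `ρ`. On genuine elements `ρ` is
injective (`eq_zero_of_isGenuine`), so `ζ` is central because `ρ(ζ)` commutes with `ρ(W̃)`.

*Uniqueness.* Let `r = ρ(ζ)`, with `ζ` central, be of the form `D a + b D`. The volume element `v`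
of the Clifford algebra turns the anticommutator with `D` into `d`. Together with the fact that `D`
is not a zero divisor (`eq_zero_of_mul_dirac`: `q` is transcendental over `ℂ`, while `T²` lies in a
finite-dimensional algebra) this rewrites `r` as a differential, and an invariant differential of
degree zero vanishes (`DiracDatum.d_eq_zero`, `DiracDatum.eq_zero_of_eq_add`).
-/

noncomputable section

namespace HeckeDirac

set_option linter.unusedSectionVars false

/-! ### Positive roots and simple reflections -/

section Roots

variable {ι V N : Type*} [AddCommGroup V] [Module ℝ V]
  [NormedAddCommGroup N] [InnerProductSpace ℝ N] {P : RootPairing ι ℝ V N}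

/-- A linear functional with prescribed values on the simple roots. -/
theorem SimpleSystem.exists_functional (S : SimpleSystem P) (g : ι → ℝ) :
    ∃ φ : Module.Dual ℝ V, ∀ i ∈ S.simple, φ (P.root i) = g i := by
  classical
  have hli : LinearIndependent ℝ (fun i : S.simple => P.root i) := S.linearIndepOn_root
  let b := Module.Basis.span hli
  obtain ⟨q, hq⟩ := (Submodule.span ℝ (Set.range fun i : S.simple => P.root i)).exists_isCompl
  refine ⟨(b.constr ℝ (fun i : S.simple => g i)) ∘ₗ
    Submodule.projectionOnto _ q hq, fun i hi => ?_⟩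
  have h1 : Submodule.projectionOnto _ q hq (P.root i) = b ⟨i, hi⟩ := by
    have : P.root i = ((b ⟨i, hi⟩ : _) : V) := by
      simp [b, Module.Basis.span_apply]
    rw [this, Submodule.projectionOnto_apply_left]
  simp [h1]

/-- A vector of `N` on which every simple root takes the value `1`; it is regular and lies in the
open fundamental chamber. -/
theorem SimpleSystem.exists_regular (S : SimpleSystem P) :
    ∃ v : N, ∀ i ∈ S.simple, P.root' i v = 1 := by
  obtain ⟨φ, hφ⟩ := S.exists_functional (fun _ => 1)
  obtain ⟨v, hv⟩ := (LinearMap.IsPerfPair.bijective_right P.toLinearMap).2 φ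
  refine ⟨v, fun i hi => ?_⟩
  rw [← hφ i hi, ← hv]
  rfl

/-- A point of the open fundamental chamber, normalized so that simple roots have value `1`. -/
def SimpleSystem.rhoVec (S : SimpleSystem P) : N := S.exists_regular.choose

theorem SimpleSystem.root'_rhoVec (S : SimpleSystem P) {i : ι} (hi : i ∈ S.simple) :
    P.root' i S.rhoVec = 1 := S.exists_regular.choose_spec i hi

/-- On the cone spanned by the simple roots, a functional that is nonnegative on simple roots is
nonnegative. -/
theorem SimpleSystem.cone_nonneg (S : SimpleSystem P) (φ : Module.Dual ℝ V)
    (hφ : ∀ i ∈ S.simple, 0 ≤ φ (P.root i)) {x : V}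
    (hx : x ∈ Submodule.span ℝ≥0 (P.root '' S.simple)) : 0 ≤ φ x := by
  induction hx using Submodule.span_induction with
  | mem x hx => obtain ⟨i, hi, rfl⟩ := hx; exact hφ i hi
  | zero => simp
  | add x y _ _ h1 h2 => rw [map_add]; exact add_nonneg h1 h2
  | smul r x _ h =>
    rw [NNReal.smul_def, map_smul, smul_eq_mul]
    exact mul_nonneg r.2 h

/-- A functional vanishing on the simple root `α` and positive on the other simple roots vanishes,
within the cone of positive combinations, only on the ray through `α`. -/
theorem SimpleSystem.cone_face (S : SimpleSystem P) (a : ι) (φ : Module.Dual ℝ V)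
    (hφ : ∀ i ∈ S.simple, i ≠ a → 0 < φ (P.root i)) (ha : φ (P.root a) = 0) {x : V}
    (hx : x ∈ Submodule.span ℝ≥0 (P.root '' S.simple)) :
    φ x = 0 → ∃ t : ℝ, x = t • P.root a := by
  have hφ' : ∀ i ∈ S.simple, 0 ≤ φ (P.root i) := by
    intro i hi
    by_cases h : i = a
    · rw [h, ha]
    · exact (hφ i hi h).le
  induction hx using Submodule.span_induction with
  | mem x hx =>
    obtain ⟨i, hi, rfl⟩ := hx
    intro h
    have : i = a := by
      by_contra hne
      exact (hφ i hi hne).ne' h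
    exact ⟨1, by rw [this, one_smul]⟩
  | zero => exact fun _ => ⟨0, by simp⟩
  | add x y hx hy h1 h2 =>
    intro h
    rw [map_add] at h
    have p1 := S.cone_nonneg φ hφ' hx
    have p2 := S.cone_nonneg φ hφ' hy
    obtain ⟨t, ht⟩ := h1 (by linarith)
    obtain ⟨u, hu⟩ := h2 (by linarith)
    exact ⟨t + u, by rw [ht, hu, add_smul]⟩
  | smul r x _ h1 =>
    intro h
    rw [NNReal.smul_def, map_smul, smul_eq_mul, mul_eq_zero] at h
    rcases h with h | h
    · exact ⟨0, by rw [NNReal.smul_def, h]; simp⟩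
    · obtain ⟨t, ht⟩ := h1 h
      exact ⟨r * t, by rw [NNReal.smul_def, ht, smul_smul]⟩

theorem SimpleSystem.root'_nonneg_of_isPos (S : SimpleSystem P) {i : ι} (hi : S.IsPos i) :
    0 ≤ P.root' i S.rhoVec := by
  refine S.cone_nonneg (P.toLinearMap.flip S.rhoVec) (fun j hj => ?_) hi
  have := S.root'_rhoVec hj
  change 0 ≤ P.root' j S.rhoVec
  rw [this]; exact zero_le_one

theorem SimpleSystem.root'_pos_of_isPos (S : SimpleSystem P) {i : ι} (hi : S.IsPos i) :
    0 < P.root' i S.rhoVec := by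
  refine lt_of_le_of_ne (S.root'_nonneg_of_isPos hi) (fun h => ?_)
  -- A functional that is positive on all simple roots vanishes on the cone only at zero.
  have key : ∀ x ∈ Submodule.span ℝ≥0 (P.root '' S.simple),
      P.toLinearMap.flip S.rhoVec x = 0 → x = 0 := by
    intro x hx
    have h0 : ∀ j ∈ S.simple, 0 ≤ (P.toLinearMap.flip S.rhoVec) (P.root j) := fun j hj => by
      change 0 ≤ P.root' j S.rhoVec
      rw [S.root'_rhoVec hj]; exact zero_le_one
    induction hx using Submodule.span_induction with
    | mem x hx =>
      obtain ⟨j, hj, rfl⟩ := hx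
      intro h
      change P.root' j S.rhoVec = 0 at h
      rw [S.root'_rhoVec hj] at h
      exact absurd h one_ne_zero
    | zero => simp
    | add x y hx hy h1 h2 =>
      intro h
      rw [map_add] at h
      have p1 := S.cone_nonneg _ h0 hx
      have p2 := S.cone_nonneg _ h0 hy
      rw [h1 (by linarith), h2 (by linarith), add_zero]
    | smul r x _ h1 =>
      intro h
      rw [NNReal.smul_def, map_smul, smul_eq_mul, mul_eq_zero] at h
      rcases h with h | h
      · rw [NNReal.smul_def, h, zero_smul]
      · rw [h1 h, smul_zero]
  exact P.ne_zero i (key _ hi h.symm)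

theorem SimpleSystem.isPos_iff (S : SimpleSystem P) (i : ι) :
    S.IsPos i ↔ 0 < P.root' i S.rhoVec := by
  refine ⟨S.root'_pos_of_isPos, fun h => ?_⟩
  rcases S.mem_cone_or_neg_mem_cone i with h1 | h1
  · exact h1
  · have h2 : S.IsPos (P.reflectionPerm i i) := by
      change P.root (P.reflectionPerm i i) ∈ _
      rwa [P.root_reflectionPerm, P.reflection_apply_self]
    have h3 := S.root'_pos_of_isPos h2
    rw [RootPairing.root', P.root_reflectionPerm, P.reflection_apply_self, map_neg,
      LinearMap.neg_apply] at h3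
    change 0 < P.toLinearMap (P.root i) S.rhoVec at h
    linarith

theorem SimpleSystem.root'_rhoVec_ne_zero (S : SimpleSystem P) (i : ι) :
    P.root' i S.rhoVec ≠ 0 := by
  rcases S.mem_cone_or_neg_mem_cone i with h1 | h1
  · exact (S.root'_pos_of_isPos h1).ne'
  · have h2 : S.IsPos (P.reflectionPerm i i) := by
      change P.root (P.reflectionPerm i i) ∈ _
      rwa [P.root_reflectionPerm, P.reflection_apply_self]
    have h3 := S.root'_pos_of_isPos h2
    rw [RootPairing.root', P.root_reflectionPerm, P.reflection_apply_self, map_neg,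
      LinearMap.neg_apply] at h3
    change P.toLinearMap (P.root i) S.rhoVec ≠ 0
    linarith [h3.ne']

theorem SimpleSystem.isPos_of_mem (S : SimpleSystem P) {i : ι} (hi : i ∈ S.simple) : S.IsPos i :=
  Submodule.subset_span ⟨i, hi, rfl⟩

theorem root'_reflectionPerm_apply (i j : ι) (v : N) :
    P.root' (P.reflectionPerm i j) v = P.root' j (P.coreflection i v) := by
  simp only [RootPairing.root', P.root_reflectionPerm, P.reflection_apply, P.coreflection_apply,
    map_sub, map_smul, LinearMap.sub_apply, LinearMap.smul_apply, smul_eq_mul,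
    LinearMap.flip_apply]
  ring

theorem root'_reflectionPerm_self (i : ι) (v : N) :
    P.root' (P.reflectionPerm i i) v = -P.root' i v := by
  simp [RootPairing.root', P.root_reflectionPerm, P.reflection_apply_self]

theorem SimpleSystem.isPos_reflectionPerm_self_iff (S : SimpleSystem P) (i : ι) :
    S.IsPos (P.reflectionPerm i i) ↔ ¬ S.IsPos i := by
  rw [S.isPos_iff, S.isPos_iff, root'_reflectionPerm_self]
  have := S.root'_rhoVec_ne_zero i
  constructor
  · intro h; linarith
  · intro h
    have := lt_of_le_of_ne (not_lt.mp h) this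
    linarith

/-- A simple reflection permutes the positive roots other than its own root. -/
theorem SimpleSystem.isPos_reflectionPerm (S : SimpleSystem P) [P.IsReduced] {a i : ι}
    (ha : a ∈ S.simple) (hi : S.IsPos i) (hne : i ≠ a) : S.IsPos (P.reflectionPerm a i) := by
  classical
  rcases S.mem_cone_or_neg_mem_cone (P.reflectionPerm a i) with h | h
  · exact h
  exfalso
  -- Both `β` and `-s_α β` lie in the cone, while their sum is a multiple of `α`.
  obtain ⟨φ, hφ⟩ := S.exists_functional (fun j => if j = a then 0 else 1)
  have hφa : φ (P.root a) = 0 := by simp [hφ a ha]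
  have hφ1 : ∀ j ∈ S.simple, j ≠ a → 0 < φ (P.root j) := fun j hj hja => by
    rw [hφ j hj, if_neg hja]; exact zero_lt_one
  have hφ0 : ∀ j ∈ S.simple, 0 ≤ φ (P.root j) := fun j hj => by
    rw [hφ j hj]; split_ifs <;> norm_num
  have p1 := S.cone_nonneg φ hφ0 hi
  have p2 := S.cone_nonneg φ hφ0 h
  have p3 : φ (-P.root (P.reflectionPerm a i)) = -φ (P.root i) := by
    rw [P.root_reflectionPerm, P.reflection_apply, map_neg, map_sub, map_smul, hφa, smul_zero,
      sub_zero]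
  obtain ⟨t, ht⟩ := S.cone_face a φ hφ1 hφa hi (by linarith)
  have hdep : ¬ LinearIndependent ℝ ![P.root i, P.root a] := by
    rw [LinearIndependent.pair_iff]
    intro hl
    have := (hl 1 (-t) (by rw [ht]; module)).1
    exact one_ne_zero this
  rcases RootPairing.IsReduced.eq_or_eq_neg i a hdep with h1 | h1
  · exact hne (P.root.injective h1)
  · have h2 := S.root'_pos_of_isPos hi
    have h3 := S.root'_rhoVec ha
    simp only [RootPairing.root', h1, map_neg, LinearMap.neg_apply] at h2 h3
    linarith

/-- Invariance of the inner product expresses a root through its coroot. -/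
theorem root'_mul_inner_coroot
    (hinv : ∀ (i : ι) (x y : N),
      inner ℝ (P.coreflection i x) (P.coreflection i y) = inner ℝ x y) (i : ι) (v : N) :
    P.root' i v * inner ℝ (P.coroot i) (P.coroot i) = 2 * inner ℝ (P.coroot i) v := by
  have h := hinv i (P.coroot i) v
  rw [P.coreflection_apply_self, P.coreflection_apply, inner_sub_right, inner_neg_left,
    inner_neg_left, inner_smul_right] at h
  linarith

theorem inner_coroot_self_pos (i : ι) : 0 < (inner ℝ (P.coroot i) (P.coroot i) : ℝ) := by
  rw [real_inner_self_eq_norm_sq]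
  have := P.ne_zero' i
  positivity

theorem pairing_pos_comm
    (hinv : ∀ (i : ι) (x y : N),
      inner ℝ (P.coreflection i x) (P.coreflection i y) = inner ℝ x y) {i j : ι}
    (h : 0 < P.root' i (P.coroot j)) : 0 < P.root' j (P.coroot i) := by
  have h1 := root'_mul_inner_coroot hinv i (P.coroot j)
  have h2 := root'_mul_inner_coroot hinv j (P.coroot i)
  have h3 := inner_coroot_self_pos (P := P) i
  have h4 := inner_coroot_self_pos (P := P) j
  rw [real_inner_comm (P.coroot i) (P.coroot j)] at h2
  have h5 : 0 < P.root' j (P.coroot i) * inner ℝ (P.coroot j) (P.coroot j) := by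
    rw [h2, ← h1]; positivity
  exact (pos_iff_pos_of_mul_pos h5).mpr h4

theorem coreflection_reflectionPerm (i j : ι) :
    P.coreflection (P.reflectionPerm i j)
      = P.coreflection i * P.coreflection j * P.coreflection i :=
  P.flip.reflection_reflectionPerm

/-- The simple reflections generate the Weyl group. -/
theorem SimpleSystem.closure_simple [Finite ι] (S : SimpleSystem P) [P.IsReduced]
    (hinv : ∀ (i : ι) (x y : N),
      inner ℝ (P.coreflection i x) (P.coreflection i y) = inner ℝ x y) :
    Subgroup.closure (P.coreflection '' S.simple) = weylGroup P := by
  apply le_antisymm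
  · exact Subgroup.closure_mono (Set.image_subset_range _ _)
  rw [weylGroup, Subgroup.closure_le]
  -- Induction on the height of a positive root.
  have key : ∀ n : ℕ, ∀ i, S.IsPos i → {j | P.root' j S.rhoVec < P.root' i S.rhoVec}.ncard ≤ n →
      P.coreflection i ∈ Subgroup.closure (P.coreflection '' S.simple) := by
    intro n
    induction n with
    | zero =>
      intro i hi hc
      exfalso
      rw [Nat.le_zero, Set.ncard_eq_zero] at hc
      have : P.reflectionPerm i i ∈ {j | P.root' j S.rhoVec < P.root' i S.rhoVec} := by
        have := S.root'_pos_of_isPos hi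
        rw [Set.mem_ofPred_eq, root'_reflectionPerm_self]
        linarith
      rw [hc] at this
      exact this
    | succ n ih =>
      intro i hi hc
      by_cases his : i ∈ S.simple
      · exact Subgroup.subset_closure ⟨i, his, rfl⟩
      obtain ⟨a, ha, hpos⟩ : ∃ a ∈ S.simple, 0 < P.root' a (P.coroot i) := by
        by_contra! hcon
        have := S.cone_nonneg (-(P.toLinearMap.flip (P.coroot i)))
          (fun j hj => by
            have := hcon j hj
            change 0 ≤ -(P.root' j (P.coroot i))
            linarith) hi
        change 0 ≤ -(P.toLinearMap (P.root i) (P.coroot i)) at this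
        rw [P.root_coroot_two] at this
        norm_num at this
      have hpos' := pairing_pos_comm hinv hpos
      have hne : i ≠ a := fun h => his (h ▸ ha)
      have hj := S.isPos_reflectionPerm ha hi hne
      have hlt : P.root' (P.reflectionPerm a i) S.rhoVec < P.root' i S.rhoVec := by
        rw [root'_reflectionPerm_apply, P.coreflection_apply, S.root'_rhoVec ha, one_smul, map_sub]
        linarith
      have hm := ih _ hj (by
        have : {j | P.root' j S.rhoVec < P.root' (P.reflectionPerm a i) S.rhoVec}
            ⊂ {j | P.root' j S.rhoVec < P.root' i S.rhoVec} := by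
          refine ⟨fun j hj => lt_trans hj hlt, fun hsub => ?_⟩
          have := hsub (a := P.reflectionPerm a i) hlt
          rw [Set.mem_ofPred_eq] at this
          exact lt_irrefl _ this
        have := Set.ncard_lt_ncard this (Set.toFinite _)
        omega)
      rw [coreflection_reflectionPerm] at hm
      have hs : P.coreflection a ∈ Subgroup.closure (P.coreflection '' S.simple) :=
        Subgroup.subset_closure ⟨a, ha, rfl⟩
      have := Subgroup.mul_mem _ (Subgroup.mul_mem _ hs hm) hs
      have h2 : P.coreflection a * P.coreflection a = 1 := by
        have := P.coreflection_sq a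
        rwa [sq] at this
      have h3 : P.coreflection a * (P.coreflection a * P.coreflection i * P.coreflection a)
          * P.coreflection a = P.coreflection i := by
        simp only [mul_assoc]
        rw [h2, mul_one, ← mul_assoc, h2, one_mul]
      rwa [h3] at this
  rintro _ ⟨i, rfl⟩
  by_cases hi : S.IsPos i
  · exact key _ i hi le_rfl
  · have h1 := key _ _ ((S.isPos_reflectionPerm_self_iff i).mpr hi) le_rfl
    rw [coreflection_reflectionPerm] at h1
    have h2 : P.coreflection i * P.coreflection i = 1 := by
      have := P.coreflection_sq i
      rwa [sq] at this
    rwa [h2, one_mul] at h1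

theorem weylRefl_mul_self (i : ι) : weylRefl P i * weylRefl P i = 1 := by
  apply Subtype.ext
  have := P.coreflection_sq i
  rwa [sq] at this

theorem weylRefl_inv (i : ι) : (weylRefl P i)⁻¹ = weylRefl P i :=
  inv_eq_of_mul_eq_one_left (weylRefl_mul_self i)

theorem weylRefl_reflectionPerm (i j : ι) :
    weylRefl P (P.reflectionPerm i j) = weylRefl P i * weylRefl P j * weylRefl P i :=
  Subtype.ext (coreflection_reflectionPerm i j)

theorem weylRefl_reflectionPerm_self (i : ι) :
    weylRefl P (P.reflectionPerm i i) = weylRefl P i := by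
  rw [weylRefl_reflectionPerm, weylRefl_mul_self, one_mul]

/-- Induction on elements of the Weyl group by left multiplication by simple reflections. -/
theorem SimpleSystem.weyl_induction [Finite ι] (S : SimpleSystem P) [P.IsReduced]
    (hinv : ∀ (i : ι) (x y : N),
      inner ℝ (P.coreflection i x) (P.coreflection i y) = inner ℝ x y)
    {p : weylGroup P → Prop} (one : p 1)
    (mul : ∀ a ∈ S.simple, ∀ w, p w → p (weylRefl P a * w)) (w : weylGroup P) : p w := by
  obtain ⟨w, hw⟩ := w
  have hw' : w ∈ Subgroup.closure (P.coreflection '' S.simple) := by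
    rwa [S.closure_simple hinv]
  suffices h : ∃ h : w ∈ weylGroup P, p ⟨w, h⟩ from h.2
  induction hw' using Subgroup.closure_induction_left with
  | one => exact ⟨_, one⟩
  | mul_left x hx y _ ih =>
    obtain ⟨a, ha, rfl⟩ := hx
    have hy : y ∈ weylGroup P := by rwa [← S.closure_simple hinv]
    obtain ⟨h, hp⟩ := ih hy
    exact ⟨_, mul a ha _ hp⟩
  | inv_mul_cancel x hx y _ ih =>
    obtain ⟨a, ha, rfl⟩ := hx
    have hy : y ∈ weylGroup P := by rwa [← S.closure_simple hinv]
    obtain ⟨h, hp⟩ := ih hy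
    exact ⟨_, mul a ha _ hp⟩

instance weylGroup_finite [Finite ι] [P.IsRootSystem] : Finite (weylGroup P) := by
  have hmaps : ∀ w ∈ weylGroup P, ∀ i, w (P.coroot i) ∈ Set.range P.coroot := by
    intro w hw
    induction hw using Subgroup.closure_induction with
    | mem x hx =>
      obtain ⟨j, rfl⟩ := hx
      exact fun i => P.mapsTo_coreflection_coroot j ⟨i, rfl⟩
    | one => exact fun i => ⟨i, rfl⟩
    | mul x y _ _ hx hy =>
      intro i
      obtain ⟨j, hj⟩ := hy i
      rw [LinearEquiv.mul_apply, ← hj]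
      exact hx j
    | inv x _ hx =>
      intro i
      -- `x` permutes the finite set of coroots, so it is also onto it.
      choose f hf using hx
      have hinj : Function.Injective f := fun j k hjk => by
        apply P.coroot.injective
        apply x.injective
        rw [← hf, ← hf, hjk]
      obtain ⟨j, hj⟩ := (Finite.surjective_of_injective hinj) i
      refine ⟨j, ?_⟩
      rw [← hj, hf]
      exact (x.symm_apply_apply _).symm
  let F : weylGroup P → (ι → Set.range P.coroot) := fun w i => ⟨_, hmaps w.1 w.2 i⟩
  have : Finite (Set.range P.coroot) := Set.finite_range _
  apply Finite.of_injective F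
  intro w w' h
  apply Subtype.ext
  apply LinearEquiv.toLinearMap_injective
  apply LinearMap.ext_on (RootPairing.IsRootSystem.span_coroot_eq_top (P := P))
  rintro _ ⟨i, rfl⟩
  exact congrArg Subtype.val (congrFun h i)

end Roots

/-! ### The symmetric algebra: induction and the degree filtration -/

section Sym

variable {K : Type*} [AddCommGroup K] [Module ℂ K]

/-- A linear map from `K` to a possibly noncommutative algebra with pairwise commuting values
extends to the symmetric algebra. -/
theorem exists_sym_lift {A : Type*} [Ring A] [Algebra ℂ A] (f : K →ₗ[ℂ] A)
    (hf : ∀ x y, f x * f y = f y * f x) :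
    ∃ F : SymmetricAlgebra ℂ K →ₐ[ℂ] A, ∀ x, F (SymmetricAlgebra.ι ℂ K x) = f x := by
  have : IsMulCommutative (Algebra.adjoin ℂ (Set.range f)) :=
    Algebra.isMulCommutative_adjoin ℂ (by
      rintro _ ⟨x, rfl⟩ _ ⟨y, rfl⟩
      exact hf x y)
  let _ : CommRing (Algebra.adjoin ℂ (Set.range f)) :=
    { (inferInstance : Ring (Algebra.adjoin ℂ (Set.range f))) with
      mul_comm := this.is_comm.comm }
  let g : K →ₗ[ℂ] Algebra.adjoin ℂ (Set.range f) :=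
    { toFun := fun x => ⟨f x, Algebra.subset_adjoin ⟨x, rfl⟩⟩
      map_add' := fun x y => Subtype.ext (map_add f x y)
      map_smul' := fun r x => Subtype.ext (map_smul f r x) }
  refine ⟨(Algebra.adjoin ℂ (Set.range f)).val.comp (SymmetricAlgebra.lift g), fun x => ?_⟩
  rw [AlgHom.comp_apply, SymmetricAlgebra.lift_ι_apply]
  rfl

variable (K) in
/-- Elements of the symmetric algebra of degree less than `n`. -/
def symLT : ℕ → Submodule ℂ (SymmetricAlgebra ℂ K)
  | 0 => ⊥
  | n + 1 => Submodule.span ℂ {1} ⊔ LinearMap.range (SymmetricAlgebra.ι ℂ K) * symLT n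

theorem one_mem_symLT (n : ℕ) : (1 : SymmetricAlgebra ℂ K) ∈ symLT K (n + 1) :=
  Submodule.mem_sup_left (Submodule.subset_span rfl)

theorem ι_mul_mem_symLT {n : ℕ} (v : K) {f : SymmetricAlgebra ℂ K} (hf : f ∈ symLT K n) :
    SymmetricAlgebra.ι ℂ K v * f ∈ symLT K (n + 1) :=
  Submodule.mem_sup_right (Submodule.mul_mem_mul ⟨v, rfl⟩ hf)

/-- Induction for elements of degree at most `n`. -/
theorem symLT_succ_induction {n : ℕ} {p : SymmetricAlgebra ℂ K → Prop} (one : p 1)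
    (add : ∀ f g, p f → p g → p (f + g)) (smul : ∀ (r : ℂ) f, p f → p (r • f))
    (ι_mul : ∀ v, ∀ f ∈ symLT K n, p (SymmetricAlgebra.ι ℂ K v * f))
    {f : SymmetricAlgebra ℂ K} (hf : f ∈ symLT K (n + 1)) : p f := by
  obtain ⟨a, ha, b, hb, rfl⟩ := Submodule.mem_sup.mp hf
  refine add _ _ ?_ ?_
  · obtain ⟨r, rfl⟩ := Submodule.mem_span_singleton.mp ha
    exact smul r 1 one
  · induction hb using Submodule.mul_induction_on' with
    | mem_mul_mem m hm g hg => obtain ⟨v, rfl⟩ := hm; exact ι_mul v g hg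
    | add x hx y hy h1 h2 =>
      exact add _ _ (h1 (Submodule.add_mem _ (Submodule.mem_sup_left ha)
        (Submodule.mem_sup_right hx))) (h2 (Submodule.add_mem _ (Submodule.mem_sup_left ha)
        (Submodule.mem_sup_right hy)))

theorem symLT_le_succ (n : ℕ) : symLT K n ≤ symLT K (n + 1) := by
  induction n with
  | zero => exact bot_le
  | succ n ih =>
    intro f hf
    exact symLT_succ_induction (p := fun f => f ∈ symLT K (n + 1 + 1)) (one_mem_symLT _)
      (fun _ _ => Submodule.add_mem _) (fun r _ => Submodule.smul_mem _ r)
      (fun v f hf => ι_mul_mem_symLT v (ih hf)) hf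

theorem symLT_mono : Monotone (symLT K) := monotone_nat_of_le_succ symLT_le_succ

theorem mem_symLT_one {f : SymmetricAlgebra ℂ K} (hf : f ∈ symLT K 1) :
    ∃ r : ℂ, f = r • 1 := by
  refine symLT_succ_induction (p := fun f => ∃ r : ℂ, f = r • 1) ⟨1, (one_smul _ _).symm⟩
    ?_ ?_ ?_ hf
  · rintro _ _ ⟨r, rfl⟩ ⟨s, rfl⟩
    exact ⟨r + s, (add_smul _ _ _).symm⟩
  · rintro r _ ⟨s, rfl⟩
    exact ⟨r * s, smul_smul _ _ _⟩
  · intro v f hf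
    obtain rfl : f = 0 := hf
    exact ⟨0, by simp⟩

end Sym

/-! ### The Weyl group action on `V^∨` -/

section Act

variable {ι V N : Type*} [AddCommGroup V] [Module ℝ V]
  [NormedAddCommGroup N] [InnerProductSpace ℝ N] (P : RootPairing ι ℝ V N)

theorem act_mul (w w' : weylGroup P) (v : ℂ ⊗[ℝ] N) :
    act P (w * w') v = act P w (act P w' v) := by
  change (((w : N ≃ₗ[ℝ] N) : N →ₗ[ℝ] N) ∘ₗ
        ((w' : N ≃ₗ[ℝ] N) : N →ₗ[ℝ] N)).baseChange ℂ v = _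
  rw [LinearMap.baseChange_comp]
  rfl

theorem act_one (v : ℂ ⊗[ℝ] N) : act P 1 v = v := by
  change (LinearMap.id : N →ₗ[ℝ] N).baseChange ℂ v = v
  simp

theorem act_tmul (w : weylGroup P) (r : ℂ) (x : N) :
    act P w (r ⊗ₜ x) = r ⊗ₜ ((w : N ≃ₗ[ℝ] N) x) := rfl

theorem act_inv_act (w : weylGroup P) (v : ℂ ⊗[ℝ] N) : act P w⁻¹ (act P w v) = v := by
  rw [← act_mul, inv_mul_cancel, act_one]

theorem act_act_inv (w : weylGroup P) (v : ℂ ⊗[ℝ] N) : act P w (act P w⁻¹ v) = v := by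
  rw [← act_mul, mul_inv_cancel, act_one]

theorem rootFun_tmul (i : ι) (r : ℂ) (x : N) :
    rootFun P i (r ⊗ₜ x) = r * (P.root' i x : ℂ) := by
  simp [rootFun]

theorem act_weylRefl (i : ι) (v : ℂ ⊗[ℝ] N) :
    act P (weylRefl P i) v = v - rootFun P i v • ((1 : ℂ) ⊗ₜ[ℝ] P.coroot i) := by
  induction v using TensorProduct.induction_on with
  | zero => simp
  | tmul r x =>
    rw [act_tmul, rootFun_tmul]
    change r ⊗ₜ (P.coreflection i x) = _
    rw [P.coreflection_apply, TensorProduct.tmul_sub, TensorProduct.tmul_smul,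
      TensorProduct.smul_tmul',
      TensorProduct.smul_tmul']
    congr 2
    simp [mul_comm]
  | add x y hx hy => rw [map_add, map_add, hx, hy, add_smul]; abel

theorem rootFun_reflectionPerm (i j : ι) (v : ℂ ⊗[ℝ] N) :
    rootFun P (P.reflectionPerm i j) v = rootFun P j (act P (weylRefl P i) v) := by
  induction v using TensorProduct.induction_on with
  | zero => simp
  | tmul r x =>
    rw [act_tmul, rootFun_tmul, rootFun_tmul, root'_reflectionPerm_apply]
    rfl
  | add x y hx hy => rw [map_add, map_add, map_add, hx, hy]

theorem rootFun_coroot_self (i : ι) : rootFun P i ((1 : ℂ) ⊗ₜ[ℝ] P.coroot i) = 2 := by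
  rw [rootFun_tmul]
  simp

theorem rootFun_act_self (i : ι) (v : ℂ ⊗[ℝ] N) :
    rootFun P i (act P (weylRefl P i) v) = -rootFun P i v := by
  rw [act_weylRefl, map_sub, map_smul, rootFun_coroot_self, smul_eq_mul]
  ring

theorem rootFun_reflectionPerm_self (i : ι) (v : ℂ ⊗[ℝ] N) :
    rootFun P (P.reflectionPerm i i) v = -rootFun P i v := by
  rw [rootFun_reflectionPerm, rootFun_act_self]

end Act

/-! ### The Poincaré–Birkhoff–Witt theorem for the graded Hecke algebra -/

section PBW

variable {ι V N : Type*} [Fintype ι] [AddCommGroup V] [Module ℝ V]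
  [NormedAddCommGroup N] [InnerProductSpace ℝ N]
  (P : RootPairing ι ℝ V N) (S : SimpleSystem P) (c : ι → ℝ)

variable (N) in
/-- The symmetric algebra `S(V^∨)`. -/
abbrev Sym : Type _ := SymmetricAlgebra ℂ (ℂ ⊗[ℝ] N)

/-- The algebra map `S(V^∨) → H`. -/
def tS : Sym N →ₐ[ℂ] Hecke P S c where
  toFun f := RingQuot.mkAlgHom ℂ (HeckeRel P S c) (genS P f)
  map_one' := by
    have := RingQuot.mkAlgHom_rel ℂ (HeckeRel.algebraMap_S (P := P) (S := S) (c := c) 1)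
    rwa [map_one, map_one, map_one] at this
  map_mul' f g := by
    rw [RingQuot.mkAlgHom_rel ℂ (HeckeRel.mul_S (P := P) (S := S) (c := c) f g), map_mul]
  map_zero' := by
    have := RingQuot.mkAlgHom_rel ℂ (HeckeRel.algebraMap_S (P := P) (S := S) (c := c) 0)
    rwa [map_zero, map_zero, map_zero] at this
  map_add' f g := by
    rw [RingQuot.mkAlgHom_rel ℂ (HeckeRel.add_S (P := P) (S := S) (c := c) f g), map_add]
  commutes' r := by
    rw [RingQuot.mkAlgHom_rel ℂ (HeckeRel.algebraMap_S (P := P) (S := S) (c := c) r),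
      AlgHom.commutes]

theorem tS_ι (v : ℂ ⊗[ℝ] N) : tS P S c (SymmetricAlgebra.ι ℂ _ v) = tV P S c v := rfl

theorem tV_add (v w : ℂ ⊗[ℝ] N) : tV P S c (v + w) = tV P S c v + tV P S c w := by
  rw [← tS_ι, map_add, map_add, tS_ι, tS_ι]

theorem tV_smul (r : ℂ) (v : ℂ ⊗[ℝ] N) : tV P S c (r • v) = r • tV P S c v := by
  rw [← tS_ι, map_smul, map_smul, tS_ι]

variable {P} {S} in
/-- The cross relation `ω t_s = t_s s(ω) + c_α (α, ω)`. -/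
theorem tV_mul_tW_simple {i : ι} (hi : i ∈ S.simple) (v : ℂ ⊗[ℝ] N) :
    tV P S c v * tW P S c (weylRefl P i) =
      tW P S c (weylRefl P i) * tV P S c (act P (weylRefl P i) v) +
        ((c i : ℂ) * rootFun P i v) • (1 : Hecke P S c) := by
  have h := RingQuot.mkAlgHom_rel ℂ (HeckeRel.cross (P := P) (S := S) (c := c) i hi v)
  rw [map_sub, map_mul, map_mul, AlgHom.commutes, Algebra.algebraMap_eq_smul_one] at h
  rw [← h]
  exact (add_sub_cancel _ _).symm

/-- Left translation by `w` on functions on the Weyl group. -/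
def opW : weylGroup P →* Module.End ℂ (weylGroup P → Sym N) where
  toFun w := LinearMap.funLeft ℂ (Sym N) (fun u => w⁻¹ * u)
  map_one' := by ext f u; simp [LinearMap.funLeft_apply]
  map_mul' w w' := by
    ext f u
    simp [LinearMap.funLeft_apply, mul_assoc]

theorem opW_apply (w : weylGroup P) (f : weylGroup P → Sym N) (u : weylGroup P) :
    opW P w f u = f (w⁻¹ * u) := rfl

open Classical in
/-- The Dunkl-type operator by which `ω ∈ V^∨` acts on the regular module of the Hecke algebra,
realized on functions `W → S(V^∨)`, the function `f` standing for `∑_w t_w f(w)`. -/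
def opV : (ℂ ⊗[ℝ] N) →ₗ[ℂ] Module.End ℂ (weylGroup P → Sym N) :=
  LinearMap.mk₂ ℂ (fun v f u => SymmetricAlgebra.ι ℂ _ (act P u⁻¹ v) * f u +
      ∑ β : ι with S.IsPos β ∧ 0 < P.root' β ((u : N ≃ₗ[ℝ] N) S.rhoVec),
        ((c β : ℂ) * rootFun P β v) • f (weylRefl P β * u))
    (by
      intro v w f; funext u
      simp only [map_add, add_mul, mul_add, add_smul, Finset.sum_add_distrib, Pi.add_apply]
      abel)
    (by
      intro r v f; funext u
      simp only [map_smul, smul_mul_assoc, Pi.smul_apply, smul_add, Finset.smul_sum, smul_smul,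
        smul_eq_mul]
      congr 1
      refine Finset.sum_congr rfl fun β _ => ?_
      congr 1; ring)
    (by
      intro v f g; funext u
      simp only [mul_add, smul_add, Finset.sum_add_distrib, Pi.add_apply]
      abel)
    (by
      intro r v f; funext u
      simp only [mul_smul_comm, Pi.smul_apply, smul_add, Finset.smul_sum]
      congr 1
      refine Finset.sum_congr rfl fun β _ => ?_
      rw [smul_comm])

open Classical in
theorem opV_apply (v : ℂ ⊗[ℝ] N) (f : weylGroup P → Sym N) (u : weylGroup P) :
    opV P S c v f u = SymmetricAlgebra.ι ℂ _ (act P u⁻¹ v) * f u +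
      ∑ β : ι with S.IsPos β ∧ 0 < P.root' β ((u : N ≃ₗ[ℝ] N) S.rhoVec),
        ((c β : ℂ) * rootFun P β v) • f (weylRefl P β * u) := rfl

theorem root'_weyl_ne_zero (i : ι) (u : weylGroup P) :
    P.root' i ((u : N ≃ₗ[ℝ] N) S.rhoVec) ≠ 0 := by
  obtain ⟨u, hu⟩ := u
  change P.root' i (u S.rhoVec) ≠ 0
  induction hu using Subgroup.closure_induction_left generalizing i with
  | one => exact S.root'_rhoVec_ne_zero i
  | mul_left x hx y _ ih =>
    obtain ⟨a, rfl⟩ := hx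
    rw [LinearEquiv.mul_apply, ← root'_reflectionPerm_apply]
    exact ih _
  | inv_mul_cancel x hx y _ ih =>
    obtain ⟨a, rfl⟩ := hx
    rw [P.coreflection_inv, LinearEquiv.mul_apply, ← root'_reflectionPerm_apply]
    exact ih _

variable {P} {S} {c} in
open Classical in
/-- The Dunkl-type operators satisfy the cross relation. -/
theorem opV_mul_opW [P.IsReduced] (hc : ∀ i j : ι, c (P.reflectionPerm i j) = c j) {a : ι}
    (ha : a ∈ S.simple) (v : ℂ ⊗[ℝ] N) :
    opV P S c v * opW P (weylRefl P a) =
      opW P (weylRefl P a) * opV P S c (act P (weylRefl P a) v) +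
        ((c a : ℂ) * rootFun P a v) • 1 := by
  refine LinearMap.ext fun f => funext fun u => ?_
  rw [LinearMap.add_apply, Module.End.mul_apply, Module.End.mul_apply, LinearMap.smul_apply,
    Module.End.one_apply, Pi.add_apply, Pi.smul_apply, opV_apply, opW_apply, opW_apply, opV_apply,
    weylRefl_inv, mul_inv_rev, weylRefl_inv, act_mul, ← act_mul P (weylRefl P a) (weylRefl P a),
    weylRefl_mul_self, act_one, add_assoc]
  congr 1
  -- Reindex the second sum by `β ↦ s_α β`; the index sets then differ in `±α` only.
  set g : ι → Sym N := fun β => ((c β : ℂ) * rootFun P β v) • f (weylRefl P a * (weylRefl P β * u))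
    with hg
  have hre : ∑ β : ι with S.IsPos β ∧
        0 < P.root' β (((weylRefl P a * u : weylGroup P) : N ≃ₗ[ℝ] N) S.rhoVec),
        ((c β : ℂ) * rootFun P β (act P (weylRefl P a) v)) • f (weylRefl P β * (weylRefl P a * u))
      = ∑ β : ι with S.IsPos (P.reflectionPerm a β) ∧
        0 < P.root' β ((u : N ≃ₗ[ℝ] N) S.rhoVec), g β := by
    refine Finset.sum_nbij' (P.reflectionPerm a) (P.reflectionPerm a) ?_ ?_ ?_ ?_ ?_
    · intro β hβ
      simp only [Finset.mem_filter, Finset.mem_univ, true_and] at hβ ⊢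
      rw [P.reflectionPerm_self, root'_reflectionPerm_apply]
      exact hβ
    · intro β hβ
      simp only [Finset.mem_filter, Finset.mem_univ, true_and] at hβ ⊢
      refine ⟨hβ.1, ?_⟩
      have h2 := hβ.2
      rw [← P.reflectionPerm_self a β, root'_reflectionPerm_apply] at h2
      exact h2
    · intro β _; exact P.reflectionPerm_self a β
    · intro β _; exact P.reflectionPerm_self a β
    · intro β _
      rw [hg]
      simp only
      rw [hc, rootFun_reflectionPerm, weylRefl_reflectionPerm]
      congr 2
      simp only [← mul_assoc]
      rw [weylRefl_mul_self, one_mul]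
  have hlhs : ∀ β, ((c β : ℂ) * rootFun P β v) • opW P (weylRefl P a) f (weylRefl P β * u)
      = g β := fun β => by rw [opW_apply, weylRefl_inv]
  rw [hre]
  simp only [hlhs]
  have hga : g a = ((c a : ℂ) * rootFun P a v) • f u := by
    rw [hg]
    simp only
    rw [← mul_assoc, weylRefl_mul_self, one_mul]
  have hgn : g (P.reflectionPerm a a) = -(((c a : ℂ) * rootFun P a v) • f u) := by
    rw [← hga, hg]
    simp only
    rw [hc, rootFun_reflectionPerm_self, weylRefl_reflectionPerm_self, mul_neg, neg_smul]
  have hpa := S.isPos_of_mem ha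
  have hna : ¬ S.IsPos (P.reflectionPerm a a) := by
    rw [S.isPos_reflectionPerm_self_iff]; exact not_not.mpr hpa
  have hpm : ∀ β, β ≠ a → β ≠ P.reflectionPerm a a →
      (S.IsPos β ↔ S.IsPos (P.reflectionPerm a β)) := by
    intro β h1 h2
    refine ⟨fun h => S.isPos_reflectionPerm ha h h1, fun h => ?_⟩
    rw [← P.reflectionPerm_self a β]
    refine S.isPos_reflectionPerm ha h fun h3 => h2 ?_
    rw [← P.reflectionPerm_self a β, h3]
  rcases lt_or_gt_of_ne (root'_weyl_ne_zero P S a u) with hu | hu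
  · have hset : (Finset.univ.filter fun β : ι => S.IsPos (P.reflectionPerm a β) ∧
          0 < P.root' β ((u : N ≃ₗ[ℝ] N) S.rhoVec)) =
        insert (P.reflectionPerm a a) (Finset.univ.filter fun β : ι => S.IsPos β ∧
          0 < P.root' β ((u : N ≃ₗ[ℝ] N) S.rhoVec)) := by
      ext β
      simp only [Finset.mem_filter, Finset.mem_univ, true_and, Finset.mem_insert]
      by_cases h1 : β = a
      · subst h1
        simp only [hu.not_gt, and_false, or_false, false_iff]
        intro h; rw [← h] at hna; exact hna hpa
      by_cases h2 : β = P.reflectionPerm a a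
      · subst h2
        simp only [P.reflectionPerm_self, hpa, true_and, true_or, iff_true]
        rw [root'_reflectionPerm_self]; linarith
      simp only [h2, false_or, hpm β h1 h2]
    rw [hset, Finset.sum_insert (by simp [hna]), hgn]
    abel
  · have hset : (Finset.univ.filter fun β : ι => S.IsPos β ∧
          0 < P.root' β ((u : N ≃ₗ[ℝ] N) S.rhoVec)) =
        insert a (Finset.univ.filter fun β : ι => S.IsPos (P.reflectionPerm a β) ∧
          0 < P.root' β ((u : N ≃ₗ[ℝ] N) S.rhoVec)) := by
      ext β
      simp only [Finset.mem_filter, Finset.mem_univ, true_and, Finset.mem_insert]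
      by_cases h1 : β = a
      · subst h1
        simp [hpa, hu]
      by_cases h2 : β = P.reflectionPerm a a
      · subst h2
        simp only [h1, false_or, P.reflectionPerm_self, hpa, true_and, hna, false_and, false_iff]
        rw [root'_reflectionPerm_self]; linarith
      simp only [h1, false_or, hpm β h1 h2]
    rw [hset, Finset.sum_insert (by simp [hna]), hga]
    abel

theorem opV_single_one [DecidableEq (weylGroup P)] (v : ℂ ⊗[ℝ] N) (g : Sym N) :
    opV P S c v (Pi.single 1 g) = Pi.single 1 (SymmetricAlgebra.ι ℂ _ v * g) := by
  classical
  funext u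
  rw [opV_apply]
  have hsum : ∑ β : ι with S.IsPos β ∧ 0 < P.root' β ((u : N ≃ₗ[ℝ] N) S.rhoVec),
        ((c β : ℂ) * rootFun P β v) • (Pi.single 1 g : weylGroup P → Sym N) (weylRefl P β * u)
      = 0 := by
    refine Finset.sum_eq_zero fun β hβ => ?_
    have hne : weylRefl P β * u ≠ 1 := by
      intro h
      have hu : u = weylRefl P β := by
        rw [← weylRefl_inv]; exact eq_inv_of_mul_eq_one_right h
      simp only [Finset.mem_filter, Finset.mem_univ, true_and] at hβ
      have h1 := S.root'_pos_of_isPos hβ.1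
      have h2 := hβ.2
      rw [hu] at h2
      change 0 < P.root' β (P.coreflection β S.rhoVec) at h2
      rw [← root'_reflectionPerm_apply, root'_reflectionPerm_self] at h2
      linarith
    rw [Pi.single_eq_of_ne hne, smul_zero]
  rw [hsum, add_zero]
  by_cases h : u = 1
  · subst h
    rw [Pi.single_eq_same, Pi.single_eq_same, inv_one, act_one]
  · rw [Pi.single_eq_of_ne h, Pi.single_eq_of_ne h, mul_zero]

theorem opW_single [DecidableEq (weylGroup P)] (w u : weylGroup P) (g : Sym N) :
    opW P w (Pi.single u g) = Pi.single (w * u) g := by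
  funext x
  rw [opW_apply]
  by_cases h : x = w * u
  · subst h
    rw [inv_mul_cancel_left, Pi.single_eq_same, Pi.single_eq_same]
  · rw [Pi.single_eq_of_ne h, Pi.single_eq_of_ne]
    intro h'
    exact h (by rw [← h', mul_inv_cancel_left])

end PBW

section PBWInv

variable {ι V N : Type*} [Fintype ι] [AddCommGroup V] [Module ℝ V]
  [NormedAddCommGroup N] [InnerProductSpace ℝ N]
  {P : RootPairing ι ℝ V N} {S : SimpleSystem P} {c : ι → ℝ}

variable [P.IsRootSystem] [P.IsReduced]
  (hinv : ∀ (i : ι) (x y : N),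
      inner ℝ (P.coreflection i x) (P.coreflection i y) = inner ℝ x y)
  (hc : ∀ i j : ι, c (P.reflectionPerm i j) = c j)

instance weylGroup_fintype : Fintype (weylGroup P) := Fintype.ofFinite _

/-- The Dunkl-type operators commute: their commutators intertwine the simple reflections up to
the action on the two arguments, and vanish on functions supported at `1`. -/
theorem opV_comm (S : SimpleSystem P) (hinv : ∀ (i : ι) (x y : N),
      inner ℝ (P.coreflection i x) (P.coreflection i y) = inner ℝ x y)
    (hc : ∀ i j : ι, c (P.reflectionPerm i j) = c j) (v v' : ℂ ⊗[ℝ] N) :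
    opV P S c v * opV P S c v' = opV P S c v' * opV P S c v := by
  classical
  have key : ∀ (w : weylGroup P) (g : Sym N) (v v' : ℂ ⊗[ℝ] N),
      (opV P S c v * opV P S c v' - opV P S c v' * opV P S c v) (Pi.single w g) = 0 := by
    intro w g
    induction w using S.weyl_induction hinv with
    | one =>
      intro v v'
      rw [LinearMap.sub_apply, Module.End.mul_apply, Module.End.mul_apply, opV_single_one,
        opV_single_one, opV_single_one, opV_single_one, mul_left_comm, sub_self]
    | mul a ha w ih =>
      intro v v'
      have hcomm : (opV P S c v * opV P S c v' - opV P S c v' * opV P S c v) *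
            opW P (weylRefl P a) =
          opW P (weylRefl P a) *
            (opV P S c (act P (weylRefl P a) v) * opV P S c (act P (weylRefl P a) v') -
              opV P S c (act P (weylRefl P a) v') * opV P S c (act P (weylRefl P a) v)) := by
        rw [sub_mul, mul_assoc, mul_assoc, opV_mul_opW hc ha, opV_mul_opW hc ha, mul_add, mul_add,
          ← mul_assoc, ← mul_assoc, opV_mul_opW hc ha, opV_mul_opW hc ha, add_mul, add_mul]
        simp only [act_weylRefl P a, map_sub, map_smul, mul_sub, sub_mul, smul_mul_assoc,
          mul_smul_comm, mul_one, one_mul, smul_sub, mul_assoc]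
        module
      rw [← opW_single, ← Module.End.mul_apply, hcomm, Module.End.mul_apply, ih, map_zero]
  rw [← sub_eq_zero]
  refine LinearMap.pi_ext fun w g => ?_
  rw [key, LinearMap.zero_apply]

end PBWInv

section PBWBasis

variable {ι V N : Type*} [Fintype ι] [AddCommGroup V] [Module ℝ V]
  [NormedAddCommGroup N] [InnerProductSpace ℝ N]
  {P : RootPairing ι ℝ V N} (S : SimpleSystem P) (c : ι → ℝ)

variable [P.IsRootSystem] [P.IsReduced]

/-- The regular module of the Hecke algebra, realized on functions `W → S(V^∨)`. -/
theorem exists_regular_rep (hinv : ∀ (i : ι) (x y : N),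
      inner ℝ (P.coreflection i x) (P.coreflection i y) = inner ℝ x y)
    (hc : ∀ i j : ι, c (P.reflectionPerm i j) = c j) [DecidableEq (weylGroup P)] :
    ∃ π : Hecke P S c →ₐ[ℂ] Module.End ℂ (weylGroup P → Sym N),
      ∀ w g, π (tW P S c w * tS P S c g) (Pi.single 1 1) = Pi.single w g := by
  obtain ⟨F, hF⟩ := exists_sym_lift (opV P S c) (opV_comm S hinv hc)
  let φ : FreeAlgebra ℂ (Gen P) →ₐ[ℂ] Module.End ℂ (weylGroup P → Sym N) :=
    FreeAlgebra.lift ℂ (Sum.elim (fun w => opW P w) (fun g => F g))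
  have hφW : ∀ w, φ (genW P w) = opW P w := fun w => FreeAlgebra.lift_ι_apply _ _
  have hφS : ∀ g, φ (genS P g) = F g := fun g => FreeAlgebra.lift_ι_apply _ _
  have hφ : ∀ ⦃x y⦄, HeckeRel P S c x y → φ x = φ y := by
    intro x y h
    induction h with
    | one_W => rw [hφW, map_one, map_one]
    | mul_W w w' => rw [map_mul, hφW, hφW, hφW, map_mul]
    | algebraMap_S r => rw [hφS, AlgHom.commutes, AlgHom.commutes]
    | add_S f g => rw [map_add, hφS, hφS, hφS, map_add]
    | mul_S f g => rw [map_mul, hφS, hφS, hφS, map_mul]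
    | cross i hi v =>
      rw [map_sub, map_mul, map_mul, hφS, hφS, hφW, AlgHom.commutes, hF, hF,
        opV_mul_opW hc hi, add_sub_cancel_left, Algebra.algebraMap_eq_smul_one]
  let π := RingQuot.liftAlgHom ℂ ⟨φ, hφ⟩
  have hπ : ∀ x, π (RingQuot.mkAlgHom ℂ (HeckeRel P S c) x) = φ x :=
    RingQuot.liftAlgHom_mkAlgHom_apply ℂ φ hφ
  refine ⟨π, fun w g => ?_⟩
  have hg : ∀ h, F g (Pi.single 1 h) = Pi.single 1 (g * h) := by
    induction g using SymmetricAlgebra.induction with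
    | algebraMap r =>
      intro h
      rw [AlgHom.commutes, Module.algebraMap_end_apply, ← Algebra.smul_def, Pi.single_smul]
    | ι v => intro h; rw [hF, opV_single_one]
    | mul a b ha hb =>
      intro h; rw [map_mul, Module.End.mul_apply, hb, ha, mul_assoc]
    | add a b ha hb =>
      intro h; rw [map_add, LinearMap.add_apply, hb, ha, add_mul, Pi.single_add]
  have h1 : π (tW P S c w) = opW P w := (hπ _).trans (hφW w)
  have h2 : π (tS P S c g) = F g := (hπ _).trans (hφS g)
  rw [map_mul, h1, h2, Module.End.mul_apply, hg, opW_single, mul_one, mul_one]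

/-- The cross relation for an arbitrary `w`, with an unspecified error term of degree zero. -/
theorem tV_mul_tW (hinv : ∀ (i : ι) (x y : N),
      inner ℝ (P.coreflection i x) (P.coreflection i y) = inner ℝ x y)
    (w : weylGroup P) (v : ℂ ⊗[ℝ] N) :
    ∃ k ∈ Submodule.span ℂ (Set.range (tW P S c)),
      tV P S c v * tW P S c w = tW P S c w * tV P S c (act P w⁻¹ v) + k := by
  induction w using S.weyl_induction hinv generalizing v with
  | one => exact ⟨0, zero_mem _, by rw [map_one, one_mul, mul_one, inv_one, act_one, add_zero]⟩
  | mul a ha w ih =>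
    obtain ⟨k, hk, hk'⟩ := ih (act P (weylRefl P a) v)
    refine ⟨tW P S c (weylRefl P a) * k + ((c a : ℂ) * rootFun P a v) • tW P S c w,
      Submodule.add_mem _ ?_ (Submodule.smul_mem _ _ (Submodule.subset_span ⟨w, rfl⟩)), ?_⟩
    · clear hk'
      induction hk using Submodule.span_induction with
      | mem x hx =>
        obtain ⟨u, rfl⟩ := hx
        rw [← map_mul]
        exact Submodule.subset_span ⟨_, rfl⟩
      | zero => rw [mul_zero]; exact zero_mem _
      | add x y _ _ hx hy => rw [mul_add]; exact Submodule.add_mem _ hx hy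
      | smul r x _ hx => rw [mul_smul_comm]; exact Submodule.smul_mem _ r hx
    · rw [map_mul, ← mul_assoc, tV_mul_tW_simple c ha, add_mul, mul_assoc, hk', mul_add,
        smul_mul_assoc, one_mul, mul_assoc, mul_inv_rev, weylRefl_inv, act_mul, add_assoc]

/-- Elements of the Hecke algebra of degree less than `n` in `S(V^∨)`. -/
def heckeLT (n : ℕ) : Submodule ℂ (Hecke P S c) :=
  Submodule.span ℂ {h | ∃ w, ∃ g ∈ symLT (ℂ ⊗[ℝ] N) n, h = tW P S c w * tS P S c g}

variable {S} {c}

theorem tW_mul_tS_mem (w : weylGroup P) {g : Sym N} {n : ℕ} (hg : g ∈ symLT (ℂ ⊗[ℝ] N) n) :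
    tW P S c w * tS P S c g ∈ heckeLT S c n := Submodule.subset_span ⟨w, g, hg, rfl⟩

theorem heckeLT_mono : Monotone (heckeLT S c) := fun n m h => by
  refine Submodule.span_mono ?_
  rintro _ ⟨w, g, hg, rfl⟩
  exact ⟨w, g, symLT_mono h hg, rfl⟩

theorem tW_mul_mem_heckeLT (w : weylGroup P) {n : ℕ} {h : Hecke P S c} (hh : h ∈ heckeLT S c n) :
    tW P S c w * h ∈ heckeLT S c n := by
  induction hh using Submodule.span_induction with
  | mem x hx =>
    obtain ⟨u, g, hg, rfl⟩ := hx
    rw [← mul_assoc, ← map_mul]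
    exact tW_mul_tS_mem _ hg
  | zero => rw [mul_zero]; exact zero_mem _
  | add x y _ _ hx hy => rw [mul_add]; exact Submodule.add_mem _ hx hy
  | smul r x _ hx => rw [mul_smul_comm]; exact Submodule.smul_mem _ r hx

theorem tV_mul_mem_heckeLT (hinv : ∀ (i : ι) (x y : N),
      inner ℝ (P.coreflection i x) (P.coreflection i y) = inner ℝ x y) (v : ℂ ⊗[ℝ] N) {n : ℕ}
    {h : Hecke P S c} (hh : h ∈ heckeLT S c n) : tV P S c v * h ∈ heckeLT S c (n + 1) := by
  induction hh using Submodule.span_induction with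
  | mem x hx =>
    obtain ⟨u, g, hg, rfl⟩ := hx
    obtain ⟨k, hk, hk'⟩ := tV_mul_tW S c hinv u v
    rw [← mul_assoc, hk', add_mul, mul_assoc, ← tS_ι, ← map_mul]
    refine Submodule.add_mem _ (tW_mul_tS_mem _ (ι_mul_mem_symLT _ hg)) ?_
    clear hk'
    induction hk using Submodule.span_induction with
    | mem x hx => obtain ⟨y, rfl⟩ := hx; exact tW_mul_tS_mem _ (symLT_le_succ _ hg)
    | zero => rw [zero_mul]; exact zero_mem _
    | add x y _ _ hx hy => rw [add_mul]; exact Submodule.add_mem _ hx hy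
    | smul r x _ hx => rw [smul_mul_assoc]; exact Submodule.smul_mem _ r hx
  | zero => rw [mul_zero]; exact zero_mem _
  | add x y _ _ hx hy => rw [mul_add]; exact Submodule.add_mem _ hx hy
  | smul r x _ hx => rw [mul_smul_comm]; exact Submodule.smul_mem _ r hx

theorem tS_mul_tW_mem_heckeLT (hinv : ∀ (i : ι) (x y : N),
      inner ℝ (P.coreflection i x) (P.coreflection i y) = inner ℝ x y) (w : weylGroup P) {n : ℕ}
    {g : Sym N} (hg : g ∈ symLT (ℂ ⊗[ℝ] N) n) : tS P S c g * tW P S c w ∈ heckeLT S c n := by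
  induction n generalizing g with
  | zero =>
    obtain rfl : g = 0 := hg
    rw [map_zero, zero_mul]; exact zero_mem _
  | succ n ih =>
    refine symLT_succ_induction (p := fun g => tS P S c g * tW P S c w ∈ heckeLT S c (n + 1))
      ?_ ?_ ?_ ?_ hg
    · have := tW_mul_tS_mem (S := S) (c := c) w (one_mem_symLT (K := ℂ ⊗[ℝ] N) n)
      rw [map_one, mul_one] at this
      rw [map_one, one_mul]
      exact this
    · intro f g hf hg
      rw [map_add, add_mul]; exact Submodule.add_mem _ hf hg
    · intro r f hf
      rw [map_smul, smul_mul_assoc]; exact Submodule.smul_mem _ r hf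
    · intro v f hf
      rw [map_mul, mul_assoc, tS_ι]
      exact tV_mul_mem_heckeLT hinv v (ih hf)

theorem mul_tW_mem_heckeLT (hinv : ∀ (i : ι) (x y : N),
      inner ℝ (P.coreflection i x) (P.coreflection i y) = inner ℝ x y) (w : weylGroup P) {n : ℕ}
    {h : Hecke P S c} (hh : h ∈ heckeLT S c n) : h * tW P S c w ∈ heckeLT S c n := by
  induction hh using Submodule.span_induction with
  | mem x hx =>
    obtain ⟨u, g, hg, rfl⟩ := hx
    rw [mul_assoc]
    exact tW_mul_mem_heckeLT _ (tS_mul_tW_mem_heckeLT hinv w hg)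
  | zero => rw [zero_mul]; exact zero_mem _
  | add x y _ _ hx hy => rw [add_mul]; exact Submodule.add_mem _ hx hy
  | smul r x _ hx => rw [smul_mul_assoc]; exact Submodule.smul_mem _ r hx

theorem exists_mem_heckeLT (hinv : ∀ (i : ι) (x y : N),
      inner ℝ (P.coreflection i x) (P.coreflection i y) = inner ℝ x y) (h : Hecke P S c) :
    ∃ n, h ∈ heckeLT S c n := by
  obtain ⟨x, rfl⟩ := RingQuot.mkAlgHom_surjective ℂ (HeckeRel P S c) h
  -- Multiplication by any element sends elements of bounded degree to elements of bounded degree.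
  suffices hx : ∀ h' : Hecke P S c, (∃ n, h' ∈ heckeLT S c n) →
      ∃ n, RingQuot.mkAlgHom ℂ (HeckeRel P S c) x * h' ∈ heckeLT S c n by
    have h1 : (1 : Hecke P S c) ∈ heckeLT S c 1 := by
      have := tW_mul_tS_mem (S := S) (c := c) 1 (one_mem_symLT (K := ℂ ⊗[ℝ] N) 0)
      rwa [map_one, map_one, mul_one] at this
    simpa using hx 1 ⟨1, h1⟩
  induction x using FreeAlgebra.induction with
  | grade0 r =>
    rintro h' ⟨n, hn⟩
    rw [AlgHom.commutes, ← Algebra.smul_def]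
    exact ⟨n, Submodule.smul_mem _ r hn⟩
  | grade1 x =>
    rcases x with w | f
    · rintro h' ⟨n, hn⟩
      exact ⟨n, tW_mul_mem_heckeLT w hn⟩
    · change ∀ h' : Hecke P S c, (∃ n, h' ∈ heckeLT S c n) →
        ∃ n, tS P S c f * h' ∈ heckeLT S c n
      induction f using SymmetricAlgebra.induction with
      | algebraMap r =>
        rintro h' ⟨n, hn⟩
        rw [AlgHom.commutes, ← Algebra.smul_def]
        exact ⟨n, Submodule.smul_mem _ r hn⟩
      | ι v =>
        rintro h' ⟨n, hn⟩
        exact ⟨n + 1, tV_mul_mem_heckeLT hinv v hn⟩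
      | mul a b ha hb => intro h' hh; rw [map_mul, mul_assoc]; exact ha _ (hb _ hh)
      | add a b ha hb =>
        intro h' hh
        rw [map_add, add_mul]
        obtain ⟨n, hn⟩ := ha h' hh
        obtain ⟨m, hm⟩ := hb h' hh
        exact ⟨max n m, Submodule.add_mem _ (heckeLT_mono (le_max_left _ _) hn)
          (heckeLT_mono (le_max_right _ _) hm)⟩
  | mul a b ha hb => intro h' hh; rw [map_mul, mul_assoc]; exact ha _ (hb _ hh)
  | add a b ha hb =>
    intro h' hh
    rw [map_add, add_mul]
    obtain ⟨n, hn⟩ := ha h' hh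
    obtain ⟨m, hm⟩ := hb h' hh
    exact ⟨max n m, Submodule.add_mem _ (heckeLT_mono (le_max_left _ _) hn)
      (heckeLT_mono (le_max_right _ _) hm)⟩

variable (S) (c) in
/-- The multiplication map `ℂ[W] ⊗ S(V^∨) → H`, on functions `W → S(V^∨)`. -/
def pbwMap : (weylGroup P → Sym N) →ₗ[ℂ] Hecke P S c :=
  ∑ w, LinearMap.mulLeft ℂ (tW P S c w) ∘ₗ (tS P S c).toLinearMap ∘ₗ LinearMap.proj w

theorem pbwMap_apply (f : weylGroup P → Sym N) :
    pbwMap S c f = ∑ w, tW P S c w * tS P S c (f w) := by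
  simp [pbwMap, LinearMap.sum_apply]

theorem pbwMap_single [DecidableEq (weylGroup P)] (w : weylGroup P) (g : Sym N) :
    pbwMap S c (Pi.single w g) = tW P S c w * tS P S c g := by
  rw [pbwMap_apply, Finset.sum_eq_single w]
  · rw [Pi.single_eq_same]
  · intro u _ hu
    rw [Pi.single_eq_of_ne hu, map_zero, mul_zero]
  · simp

/-- Injectivity is seen on the regular module, applying the operators to the unit. -/
theorem pbwMap_injective (hinv : ∀ (i : ι) (x y : N),
      inner ℝ (P.coreflection i x) (P.coreflection i y) = inner ℝ x y)
    (hc : ∀ i j : ι, c (P.reflectionPerm i j) = c j) : Function.Injective (pbwMap S c) := by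
  classical
  obtain ⟨π, hπ⟩ := exists_regular_rep S c hinv hc
  have key : ∀ f, π (pbwMap S c f) (Pi.single 1 1) = f := by
    intro f
    rw [pbwMap_apply, map_sum, LinearMap.sum_apply]
    simp only [hπ]
    exact Finset.univ_sum_single f
  intro f g h
  rw [← key f, h, key g]

theorem exists_pbw_of_mem {n : ℕ} {h : Hecke P S c} (hh : h ∈ heckeLT S c n) :
    ∃ f : weylGroup P → Sym N, (∀ w, f w ∈ symLT (ℂ ⊗[ℝ] N) n) ∧ pbwMap S c f = h := by
  classical
  induction hh using Submodule.span_induction with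
  | mem x hx =>
    obtain ⟨u, g, hg, rfl⟩ := hx
    refine ⟨Pi.single u g, fun w => ?_, pbwMap_single u g⟩
    by_cases h : w = u
    · subst h; rwa [Pi.single_eq_same]
    · rw [Pi.single_eq_of_ne h]; exact zero_mem _
  | zero => exact ⟨0, fun w => zero_mem _, map_zero _⟩
  | add x y _ _ hx hy =>
    obtain ⟨f, hf, rfl⟩ := hx
    obtain ⟨g, hg, rfl⟩ := hy
    exact ⟨f + g, fun w => Submodule.add_mem _ (hf w) (hg w), map_add _ _ _⟩
  | smul r x _ hx =>
    obtain ⟨f, hf, rfl⟩ := hx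
    exact ⟨r • f, fun w => Submodule.smul_mem _ r (hf w), map_smul _ _ _⟩

variable (c) in
/-- The Poincaré–Birkhoff–Witt isomorphism. -/
def pbwEquiv (S : SimpleSystem P) (hinv : ∀ (i : ι) (x y : N),
      inner ℝ (P.coreflection i x) (P.coreflection i y) = inner ℝ x y)
    (hc : ∀ i j : ι, c (P.reflectionPerm i j) = c j) :
    (weylGroup P → Sym N) ≃ₗ[ℂ] Hecke P S c :=
  LinearEquiv.ofBijective (pbwMap S c) ⟨pbwMap_injective hinv hc, fun h => by
    obtain ⟨n, hn⟩ := exists_mem_heckeLT hinv h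
    obtain ⟨f, -, hf⟩ := exists_pbw_of_mem hn
    exact ⟨f, hf⟩⟩

end PBWBasis

/-! ### Sums of commuting idempotents -/

section Idempotents

variable {A κ : Type*} [Ring A] [Algebra ℂ A]

/-- A sum of finitely many commuting idempotents has only natural eigenvalues: adding a positive
scalar makes it invertible. -/
theorem isUnit_add_sum_idempotent (k : κ → A) (hk : ∀ i, k i * k i = k i)
    (hcomm : ∀ i j, k i * k j = k j * k i) (s : Finset κ) (m : ℕ) (hm : 0 < m) :
    IsUnit ((m : A) + ∑ i ∈ s, k i) := by
  classical
  induction s using Finset.induction_on generalizing m with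
  | empty =>
    have : IsUnit (m : ℂ) := by
      rw [isUnit_iff_ne_zero]; exact_mod_cast hm.ne'
    simpa using this.map (algebraMap ℂ A)
  | insert a s ha ih =>
    obtain ⟨T, hT⟩ := ih m hm
    obtain ⟨T', hT'⟩ := ih (m + 1) (Nat.succ_pos m)
    have hTT' : (T' : A) = T + 1 := by rw [hT, hT']; push_cast; abel
    have hc1 : Commute (k a) (T : A) := by
      rw [hT]
      exact (Nat.cast_commute m (k a)).symm.add_right
        (Commute.sum_right _ _ _ fun i _ => hcomm a i)
    have hc2 : Commute (k a) (T' : A) := by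
      rw [hTT']; exact hc1.add_right (Commute.one_right _)
    have hc1' : Commute (k a) (↑T⁻¹ : A) := hc1.units_inv_right
    have hc2' : Commute (k a) (↑T'⁻¹ : A) := hc2.units_inv_right
    rw [Finset.sum_insert ha, add_left_comm, ← hT, add_comm]
    -- The inverse is `T⁻¹` on the kernel of the idempotent and `(T + 1)⁻¹` on its image.
    have h1 : ((T : A) + k a) * (↑T⁻¹ * (1 - k a) + ↑T'⁻¹ * k a) = 1 := by
      have e1 : k a * (↑T⁻¹ * (1 - k a)) = 0 := by
        rw [← mul_assoc, hc1'.eq, mul_assoc, mul_sub, mul_one, hk, sub_self, mul_zero]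
      have e2 : k a * (↑T'⁻¹ * k a) = ↑T'⁻¹ * k a := by
        rw [← mul_assoc, hc2'.eq, mul_assoc, hk]
      have e3 : (T : A) * (↑T'⁻¹ * k a) + ↑T'⁻¹ * k a = k a := by
        have : ((T : A) + 1) * ↑T'⁻¹ = 1 := by rw [← hTT', Units.mul_inv]
        rw [← mul_assoc, ← add_mul]
        have h5 : (T : A) * ↑T'⁻¹ + ↑T'⁻¹ = ((T : A) + 1) * ↑T'⁻¹ := by rw [add_mul, one_mul]
        rw [h5, this, one_mul]
      rw [add_mul, mul_add, mul_add, e1, e2, zero_add, add_assoc, e3, ← mul_assoc,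
        Units.mul_inv, one_mul, sub_add_cancel]
    have h2 : (↑T⁻¹ * (1 - k a) + ↑T'⁻¹ * k a) * ((T : A) + k a) = 1 := by
      have hcc : Commute ((T : A) + k a) (↑T⁻¹ * (1 - k a) + ↑T'⁻¹ * k a) := by
        have hT1 : Commute (T : A) (↑T⁻¹ : A) := (Commute.refl (T : A)).units_inv_right
        have hT2 : Commute (T : A) (↑T'⁻¹ : A) := by
          have : Commute (T : A) (T' : A) := by
            rw [hTT']; exact (Commute.refl _).add_right (Commute.one_right _)
          exact this.units_inv_right
        have hka : Commute (k a) (1 - k a) := (Commute.one_right _).sub_right (Commute.refl _)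
        refine Commute.add_left ?_ ?_
        · exact (hT1.mul_right ((Commute.one_right _).sub_right hc1.symm)).add_right
            (hT2.mul_right hc1.symm)
        · exact (hc1'.mul_right hka).add_right (hc2'.mul_right (Commute.refl _))
      rw [← hcc.eq, h1]
    exact ⟨⟨_, _, h1, h2⟩, rfl⟩

/-- A vector in the sum of the images of commuting idempotents that is killed by all of them is
zero. -/
theorem eq_zero_of_sum_idempotent {M : Type*} [AddCommGroup M] [Module ℂ M]
    (k : κ → Module.End ℂ M) (hk : ∀ i, k i * k i = k i) (hcomm : ∀ i j, k i * k j = k j * k i)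
    (s : Finset κ) (z : κ → M) (h0 : ∀ j ∈ s, k j (∑ i ∈ s, k i (z i)) = 0) :
    ∑ i ∈ s, k i (z i) = 0 := by
  classical
  induction s using Finset.induction_on generalizing z with
  | empty => simp
  | insert a s ha ih =>
    set x := ∑ i ∈ insert a s, k i (z i) with hx
    have hxa : k a x = 0 := h0 a (Finset.mem_insert_self a s)
    have e1 : x = ∑ i ∈ s, k i (z i - k a (z i)) := by
      have h2 : x = x - k a x := by rw [hxa, sub_zero]
      rw [h2]
      conv_lhs => rw [hx]
      rw [Finset.sum_insert ha, map_add, map_sum, ← Module.End.mul_apply (k a), hk,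
        add_sub_add_left_eq_sub, ← Finset.sum_sub_distrib]
      refine Finset.sum_congr rfl fun i _ => ?_
      rw [map_sub, ← Module.End.mul_apply, ← Module.End.mul_apply, hcomm]
    rw [e1]
    refine ih _ fun j hj => ?_
    rw [← e1]
    exact h0 j (Finset.mem_insert_of_mem hj)

theorem neg_mul_idem {t w : A} (h1 : t * w = -1 - w * t) (h2 : w * w = 0) :
    -(w * t) * -(w * t) = -(w * t) := by
  rw [neg_mul_neg, mul_assoc, ← mul_assoc t, h1, sub_mul, neg_mul, one_mul,
    mul_sub, ← mul_assoc w, ← mul_assoc w, h2, zero_mul, zero_mul, sub_zero,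
    mul_neg]

theorem neg_mul_comm_of_anti {t w t' w' : A} (a1 : t * w' = -(w' * t)) (a2 : t' * w = -(w * t'))
    (a3 : w * w' = -(w' * w)) (a4 : t * t' = -(t' * t)) :
    -(w * t) * -(w' * t') = -(w' * t') * -(w * t) := by
  rw [neg_mul_neg, neg_mul_neg]
  calc w * t * (w' * t') = w * (t * w') * t' := by simp only [mul_assoc]
    _ = -((w * w') * (t * t')) := by rw [a1]; simp only [mul_assoc, neg_mul, mul_neg]
    _ = -((w' * w) * (t' * t)) := by rw [a3, a4, neg_mul_neg]
    _ = w' * (t' * w) * t := by rw [a2]; simp only [mul_assoc, neg_mul, mul_neg]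
    _ = _ := by simp only [mul_assoc]

theorem mul_neg_mul_self {t w : A} (h1 : t * w = -1 - w * t) (h2 : t * t = 0) :
    t * -(w * t) = (-(w * t) + 1) * t := by
  rw [mul_neg, ← mul_assoc, h1, sub_mul, mul_assoc, h2, mul_zero, add_mul,
    neg_mul (w * t), mul_assoc, h2, mul_zero]
  simp

theorem mul_neg_mul_of_anti {t t' w : A} (a1 : t' * w = -(w * t')) (a4 : t' * t = -(t * t')) :
    t' * -(w * t) = -(w * t) * t' := by
  rw [mul_neg, ← mul_assoc, a1, neg_mul, mul_assoc, a4, mul_neg, neg_mul, mul_assoc, neg_neg]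

theorem neg_mul_mul_self {t w : A} (h1 : t * w = -1 - w * t) (h2 : w * w = 0) :
    -(w * t) * w = w := by
  rw [neg_mul, mul_assoc, h1, mul_sub, ← mul_assoc, h2, zero_mul, sub_zero, mul_neg, mul_one,
    neg_neg]

end Idempotents

/-! ### Contraction and exterior multiplication on a Clifford algebra -/

section Clifford

open CliffordAlgebra

variable {K κ : Type*} [AddCommGroup K] [Module ℂ K] {Q : QuadraticForm ℂ K}

/-- Half the supercommutator with `v`: up to sign, the contraction with `v` under the
identification of the Clifford algebra with the exterior algebra. -/
def ctr (Q : QuadraticForm ℂ K) (v : K) : Module.End ℂ (CliffordAlgebra Q) :=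
  (1 / 2 : ℂ) • (LinearMap.mulLeft ℂ (ι Q v) -
    LinearMap.mulRight ℂ (ι Q v) ∘ₗ (involute (Q := Q)).toLinearMap)

/-- Half the super-anticommutator with `v`: the exterior multiplication by `v` under the
identification of the Clifford algebra with the exterior algebra. -/
def wdg (Q : QuadraticForm ℂ K) (v : K) : Module.End ℂ (CliffordAlgebra Q) :=
  (1 / 2 : ℂ) • (LinearMap.mulLeft ℂ (ι Q v) +
    LinearMap.mulRight ℂ (ι Q v) ∘ₗ (involute (Q := Q)).toLinearMap)

theorem ctr_apply (v : K) (x : CliffordAlgebra Q) :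
    ctr Q v x = (1 / 2 : ℂ) • (ι Q v * x - involute x * ι Q v) := rfl

theorem wdg_apply (v : K) (x : CliffordAlgebra Q) :
    wdg Q v x = (1 / 2 : ℂ) • (ι Q v * x + involute x * ι Q v) := rfl

theorem ctr_mul_ctr {v w : K} (h : ι Q v * ι Q w = -(ι Q w * ι Q v)) :
    ctr Q v * ctr Q w = -(ctr Q w * ctr Q v) := by
  refine LinearMap.ext fun x => ?_
  have h' : involute (involute x) = x := involute_involute x
  have h2 : x * (ι Q v * ι Q w) = -(x * (ι Q w * ι Q v)) := by rw [h, mul_neg]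
  have h3 : ι Q v * (ι Q w * x) = -(ι Q w * (ι Q v * x)) := by
    rw [← mul_assoc, h, neg_mul, mul_assoc]
  simp only [Module.End.mul_apply, LinearMap.neg_apply, ctr_apply, map_smul, map_sub, map_mul,
    involute_ι, h', neg_mul, mul_neg, mul_assoc,
    h2, h3]
  module

theorem ctr_mul_self {v : K} (h : ι Q v * ι Q v = -1) : ctr Q v * ctr Q v = 0 := by
  refine LinearMap.ext fun x => ?_
  have h' : involute (involute x) = x := involute_involute x
  have h3 : ι Q v * (ι Q v * x) = -x := by
    rw [← mul_assoc, h, neg_mul, one_mul]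
  simp only [Module.End.mul_apply, LinearMap.zero_apply, ctr_apply, map_smul, map_sub, map_mul,
    involute_ι, h', neg_mul, mul_neg, mul_assoc,
    h, h3, mul_one]
  module

theorem ctr_mul_wdg {v w : K} (h : ι Q v * ι Q w = -(ι Q w * ι Q v)) :
    ctr Q v * wdg Q w = -(wdg Q w * ctr Q v) := by
  refine LinearMap.ext fun x => ?_
  have h' : involute (involute x) = x := involute_involute x
  have h2 : x * (ι Q v * ι Q w) = -(x * (ι Q w * ι Q v)) := by rw [h, mul_neg]
  have h3 : ι Q v * (ι Q w * x) = -(ι Q w * (ι Q v * x)) := by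
    rw [← mul_assoc, h, neg_mul, mul_assoc]
  simp only [Module.End.mul_apply, LinearMap.neg_apply, ctr_apply, wdg_apply, map_smul, map_sub,
    map_add, map_mul, involute_ι, h', neg_mul, mul_neg, mul_assoc, h2, h3]
  module

theorem ctr_mul_wdg_self {v : K} (h : ι Q v * ι Q v = -1) :
    ctr Q v * wdg Q v = -1 - wdg Q v * ctr Q v := by
  refine LinearMap.ext fun x => ?_
  have h' : involute (involute x) = x := involute_involute x
  have h3 : ι Q v * (ι Q v * x) = -x := by
    rw [← mul_assoc, h, neg_mul, one_mul]
  simp only [Module.End.mul_apply, LinearMap.neg_apply, LinearMap.sub_apply, Module.End.one_apply,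
    ctr_apply, wdg_apply, map_smul, map_sub,
    map_add, map_mul, involute_ι, h', neg_mul, mul_neg, mul_assoc, h, h3, mul_one]
  module

theorem wdg_mul_wdg {v w : K} (h : ι Q v * ι Q w = -(ι Q w * ι Q v)) :
    wdg Q v * wdg Q w = -(wdg Q w * wdg Q v) := by
  refine LinearMap.ext fun x => ?_
  have h' : involute (involute x) = x := involute_involute x
  have h2 : x * (ι Q v * ι Q w) = -(x * (ι Q w * ι Q v)) := by rw [h, mul_neg]
  have h3 : ι Q v * (ι Q w * x) = -(ι Q w * (ι Q v * x)) := by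
    rw [← mul_assoc, h, neg_mul, mul_assoc]
  simp only [Module.End.mul_apply, LinearMap.neg_apply, wdg_apply, map_smul,
    map_add, map_mul, involute_ι, h', neg_mul, mul_neg, mul_assoc, h2, h3]
  module

theorem wdg_mul_self {v : K} (h : ι Q v * ι Q v = -1) : wdg Q v * wdg Q v = 0 := by
  refine LinearMap.ext fun x => ?_
  have h' : involute (involute x) = x := involute_involute x
  have h3 : ι Q v * (ι Q v * x) = -x := by
    rw [← mul_assoc, h, neg_mul, one_mul]
  simp only [Module.End.mul_apply, LinearMap.zero_apply, wdg_apply, map_smul, map_mul, map_add,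
    involute_ι, h', neg_mul, mul_neg, mul_assoc,
    h, h3, mul_one]
  module

/-- An orthonormal family for the Clifford relations `ω ω' + ω' ω = -2 ⟨ω, ω'⟩`. -/
structure IsCliffordOrthonormal (Q : QuadraticForm ℂ K) (e : κ → K) : Prop where
  sq : ∀ i, ι Q (e i) * ι Q (e i) = -1
  anti : ∀ i j, i ≠ j → ι Q (e i) * ι Q (e j) = -(ι Q (e j) * ι Q (e i))

/-- The idempotent of the Clifford algebra projecting onto the products that contain `v`. -/
def numOp (Q : QuadraticForm ℂ K) (v : K) : Module.End ℂ (CliffordAlgebra Q) :=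
  -(wdg Q v * ctr Q v)

variable {e : κ → K} (he : IsCliffordOrthonormal Q e)
include he

theorem numOp_idem (i : κ) : numOp Q (e i) * numOp Q (e i) = numOp Q (e i) :=
  neg_mul_idem (ctr_mul_wdg_self (he.sq i)) (wdg_mul_self (he.sq i))

theorem numOp_comm (i j : κ) : numOp Q (e i) * numOp Q (e j) = numOp Q (e j) * numOp Q (e i) := by
  by_cases hij : i = j
  · rw [hij]
  exact neg_mul_comm_of_anti (ctr_mul_wdg (he.anti i j hij))
    (ctr_mul_wdg (he.anti j i (Ne.symm hij))) (wdg_mul_wdg (he.anti i j hij))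
    (ctr_mul_ctr (he.anti i j hij))

theorem ctr_mul_numOp_self (i : κ) :
    ctr Q (e i) * numOp Q (e i) = (numOp Q (e i) + 1) * ctr Q (e i) :=
  mul_neg_mul_self (ctr_mul_wdg_self (he.sq i)) (ctr_mul_self (he.sq i))

theorem ctr_mul_numOp_of_ne {i j : κ} (hij : j ≠ i) :
    ctr Q (e j) * numOp Q (e i) = numOp Q (e i) * ctr Q (e j) :=
  mul_neg_mul_of_anti (ctr_mul_wdg (he.anti j i hij)) (ctr_mul_ctr (he.anti j i hij))

theorem wdg_eq_numOp_mul (i : κ) : wdg Q (e i) = numOp Q (e i) * wdg Q (e i) :=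
  (neg_mul_mul_self (ctr_mul_wdg_self (he.sq i)) (wdg_mul_self (he.sq i))).symm

variable [Fintype κ]

/-- Adding a positive scalar to the number operator of the Clifford algebra gives an invertible
operator. -/
theorem isUnit_number (m : ℕ) (hm : 0 < m) :
    IsUnit ((m : Module.End ℂ (CliffordAlgebra Q)) + ∑ i, numOp Q (e i)) :=
  isUnit_add_sum_idempotent _ (numOp_idem he) (numOp_comm he) _ m hm

end Clifford

section CliffordBasis

open CliffordAlgebra

variable {K κ : Type*} [AddCommGroup K] [Module ℂ K] {Q : QuadraticForm ℂ K} [Fintype κ]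
  {e : Module.Basis κ ℂ K} (he : IsCliffordOrthonormal Q e)
include he

theorem ctr_eq_contractLeft [DecidableEq κ] (i : κ) (x : CliffordAlgebra Q) :
    ctr Q (e i) x = -contractLeft (e.coord i) x := by
  induction x using CliffordAlgebra.left_induction with
  | algebraMap r =>
    rw [contractLeft_algebraMap, ctr_apply, AlgHom.commutes, Algebra.commutes, sub_self, smul_zero,
      neg_zero]
  | add x y hx hy => rw [map_add, map_add, hx, hy, neg_add]
  | ι_mul x v hx =>
    rw [contractLeft_ι_mul]
    have h1 : ctr Q (e i) (ι Q v * x) = (-(e.coord i v)) • x - ι Q v * ctr Q (e i) x := by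
      have h2 : ι Q (e i) * ι Q v = -(ι Q v * ι Q (e i)) - (2 * e.coord i v) • 1 := by
        rw [← e.sum_repr v]
        simp only [map_sum, map_smul, Finset.mul_sum, Finset.sum_mul, mul_smul_comm,
          smul_mul_assoc, Module.Basis.coord_apply, Module.Basis.repr_self]
        rw [← Finset.sum_neg_distrib, ← sub_eq_zero]
        have h3 : ∀ j, (e.repr v j) • (ι Q (e i) * ι Q (e j)) =
            -((e.repr v j) • (ι Q (e j) * ι Q (e i)))
              - if i = j then (2 * e.repr v j) • (1 : CliffordAlgebra Q) else 0 := by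
          intro j
          by_cases hij : i = j
          · subst hij
            rw [he.sq, if_pos rfl]; module
          · rw [he.anti i j hij, if_neg hij]; module
        simp only [h3, Finset.sum_sub_distrib, Finset.sum_ite_eq, Finset.mem_univ, if_true]
        simp [Finsupp.single_apply, mul_comm]
      rw [ctr_apply, ctr_apply, ← mul_assoc, h2, sub_mul, neg_mul, smul_mul_assoc, one_mul, map_mul,
        involute_ι, neg_mul, neg_mul, mul_smul_comm, mul_sub, mul_assoc, mul_assoc]
      module
    rw [h1, hx, mul_neg, neg_smul]
    abel

/-- Elements whose supercommutators with all vectors vanish are scalars. -/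
theorem exists_algebraMap_of_ctr [DecidableEq κ] (x : CliffordAlgebra Q)
    (hx : ∀ i, ctr Q (e i) x = 0) : ∃ r : ℂ, x = algebraMap ℂ _ r := by
  -- Through the exterior algebra, every element is a scalar plus a sum of exterior multiples.
  have hB := changeForm.associated_neg_proof (Q := Q)
  have key : ∀ y : CliffordAlgebra (0 : QuadraticForm ℂ K), ∃ (r : ℂ) (z : κ → CliffordAlgebra _),
      y = algebraMap ℂ _ r + ∑ i, ι 0 (e i) * z i := by
    intro y
    induction y using CliffordAlgebra.left_induction with
    | algebraMap r => exact ⟨r, 0, by simp⟩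
    | add x y hx hy =>
      obtain ⟨r, z, rfl⟩ := hx
      obtain ⟨s, w, rfl⟩ := hy
      refine ⟨r + s, z + w, ?_⟩
      simp only [map_add, Pi.add_apply, mul_add, Finset.sum_add_distrib]
      abel
    | ι_mul x v _ =>
      refine ⟨0, fun i => e.repr v i • x, ?_⟩
      rw [map_zero, zero_add]
      conv_lhs => rw [← e.sum_repr v]
      simp only [map_sum, map_smul, Finset.sum_mul, smul_mul_assoc, mul_smul_comm]
  obtain ⟨r, z, hz⟩ := key (changeForm hB x)
  have hwd : ∀ i (y : CliffordAlgebra Q),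
      changeForm hB (wdg Q (e i) y) = ι 0 (e i) * changeForm hB y := by
    intro i y
    have h1 : wdg Q (e i) y = ι Q (e i) * y - ctr Q (e i) y := by
      rw [wdg_apply, ctr_apply]; module
    have h2 : (QuadraticMap.associated (R := ℂ) (M := K) (-Q)) (e i) = e.coord i := by
      refine e.ext fun j => ?_
      rw [Module.Basis.coord_apply, Module.Basis.repr_self, QuadraticMap.associated_apply]
      have h3 : ι Q (e i) * ι Q (e j) + ι Q (e j) * ι Q (e i) =
          algebraMap ℂ _ (QuadraticMap.polar Q (e i) (e j)) := ι_mul_ι_add_swap _ _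
      have hinj : Function.Injective (algebraMap ℂ (CliffordAlgebra Q)) :=
        (algebraMap ℂ (CliffordAlgebra Q)).injective
      have h4 : QuadraticMap.polar Q (e i) (e j) = if i = j then -2 else 0 := by
        apply hinj
        rw [← h3]
        by_cases hij : i = j
        · subst hij
          rw [he.sq, if_pos rfl, map_neg, map_ofNat]; norm_num
        · rw [he.anti i j hij, if_neg hij, map_zero, neg_add_cancel]
      have h5 : (-Q) (e i + e j) - (-Q) (e i) - (-Q) (e j) = -QuadraticMap.polar Q (e i) (e j) := by
        simp only [QuadraticMap.polar, neg_apply]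
        ring
      rw [h5, h4]
      simp only [Finsupp.single_apply, eq_comm (a := j)]
      split_ifs <;> simp
    rw [h1, map_sub, changeForm_ι_mul, ctr_eq_contractLeft he, map_neg (changeForm hB),
      changeForm_contractLeft]
    have h6 : contractLeft (QuadraticMap.associated (R := ℂ) (M := K) (-Q) (e i))
        (changeForm hB y) = contractLeft (e.coord i) (changeForm hB y) :=
      congrArg (fun d => contractLeft d (changeForm hB y)) h2
    have h7 : ∀ p q r : CliffordAlgebra (0 : QuadraticForm ℂ K), q = r → p - q - -r = p := by
      rintro p q r rfl; abel
    exact h7 _ _ _ h6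
  have hx2 : x = algebraMap ℂ _ r + ∑ i, wdg Q (e i) ((changeFormEquiv hB).symm (z i)) := by
    apply (changeFormEquiv hB).injective
    simp only [map_add, map_sum]
    change changeForm hB x = changeForm hB _ + ∑ i, changeForm hB _
    rw [changeForm_algebraMap, hz]
    congr 1
    refine Finset.sum_congr rfl fun i _ => ?_
    rw [hwd]
    congr 1
    exact ((changeFormEquiv hB).apply_symm_apply (z i)).symm
  have hct : ∀ i (s : ℂ), ctr Q (e i) (algebraMap ℂ _ s) = 0 := by
    intro i s
    rw [ctr_apply, AlgHom.commutes, Algebra.commutes, sub_self, smul_zero]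
  refine ⟨r, ?_⟩
  have hsum : ∀ i, wdg Q (e i) ((changeFormEquiv hB).symm (z i)) =
      numOp Q (e i) (wdg Q (e i) ((changeFormEquiv hB).symm (z i))) := by
    intro i
    rw [← Module.End.mul_apply, ← wdg_eq_numOp_mul he]
  have h0 := eq_zero_of_sum_idempotent (fun i => numOp Q (e i)) (numOp_idem he) (numOp_comm he)
    Finset.univ (fun i => wdg Q (e i) ((changeFormEquiv hB).symm (z i))) (by
      intro j _
      have h1 : ∑ i, numOp Q (e i) (wdg Q (e i) ((changeFormEquiv hB).symm (z i))) =
          x - algebraMap ℂ _ r := by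
        rw [eq_sub_iff_add_eq, add_comm]
        conv_rhs => rw [hx2]
        congr 1
        exact Finset.sum_congr rfl fun i _ => (hsum i).symm
      rw [h1, numOp, LinearMap.neg_apply, Module.End.mul_apply, map_sub, hx, hct, sub_zero,
        map_zero, neg_zero])
  rw [hx2, Finset.sum_congr rfl fun i _ => hsum i, h0, add_zero]

end CliffordBasis

/-! ### Acyclicity of the Koszul complex -/

section Koszul

open CliffordAlgebra

variable {K κ : Type*} [AddCommGroup K] [Module ℂ K] {Q : QuadraticForm ℂ K} [Fintype κ]
  [DecidableEq κ] (e : Module.Basis κ ℂ K)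

/-- The partial derivative of the symmetric algebra in the direction dual to `e i`. -/
def pd (i : κ) : Module.End ℂ (SymmetricAlgebra ℂ K) :=
  (SymmetricAlgebra.equivMvPolynomial e).symm.toLinearMap ∘ₗ
    (MvPolynomial.pderiv i).toLinearMap ∘ₗ (SymmetricAlgebra.equivMvPolynomial e).toLinearMap

theorem pd_one (i : κ) : pd e i 1 = 0 := by
  simp [pd]

theorem pd_ι_mul (i : κ) (v : K) (f : SymmetricAlgebra ℂ K) :
    pd e i (SymmetricAlgebra.ι ℂ K v * f) =
      e.repr v i • f + SymmetricAlgebra.ι ℂ K v * pd e i f := by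
  have h1 : MvPolynomial.pderiv i (SymmetricAlgebra.equivMvPolynomial e
      (SymmetricAlgebra.ι ℂ K v)) = MvPolynomial.C (e.repr v i) := by
    conv_lhs => rw [← e.sum_repr v]
    simp only [map_sum, map_smul, SymmetricAlgebra.equivMvPolynomial_ι_apply,
      MvPolynomial.pderiv_X, MvPolynomial.smul_eq_C_mul, Derivation.leibniz,
      MvPolynomial.pderiv_C, smul_zero, add_zero]
    rw [Finset.sum_eq_single i]
    · simp
    · intro j _ hj
      simp [Pi.single_eq_of_ne hj]
    · simp
  simp only [pd, LinearMap.comp_apply, AlgEquiv.toLinearMap_apply, map_mul,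
    Derivation.coeFn_coe, Derivation.leibniz, h1, map_add,
    smul_eq_mul, AlgEquiv.symm_apply_apply]
  rw [add_comm, ← MvPolynomial.algebraMap_eq, AlgEquiv.commutes, mul_comm f, ← Algebra.smul_def]

/-- The Euler operator. -/
def eul : Module.End ℂ (SymmetricAlgebra ℂ K) :=
  ∑ i, LinearMap.mulLeft ℂ (SymmetricAlgebra.ι ℂ K (e i)) ∘ₗ pd e i

theorem eul_apply (f : SymmetricAlgebra ℂ K) :
    eul e f = ∑ i, SymmetricAlgebra.ι ℂ K (e i) * pd e i f := by
  simp [eul, LinearMap.sum_apply]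

theorem eul_one : eul e 1 = 0 := by simp [eul_apply, pd_one]

theorem eul_ι_mul (v : K) (f : SymmetricAlgebra ℂ K) :
    eul e (SymmetricAlgebra.ι ℂ K v * f) =
      SymmetricAlgebra.ι ℂ K v * f + SymmetricAlgebra.ι ℂ K v * eul e f := by
  simp only [eul_apply, pd_ι_mul, mul_add, Finset.sum_add_distrib, Finset.mul_sum]
  congr 1
  · conv_rhs => rw [← e.sum_repr v]
    simp only [map_sum, map_smul, Finset.sum_mul, mul_smul_comm, smul_mul_assoc]
  · exact Finset.sum_congr rfl fun i _ => mul_left_comm _ _ _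

theorem pd_mem_symLT (i : κ) {n : ℕ} {f : SymmetricAlgebra ℂ K} (hf : f ∈ symLT K (n + 1)) :
    pd e i f ∈ symLT K n := by
  induction n generalizing f with
  | zero =>
    obtain ⟨r, rfl⟩ := mem_symLT_one hf
    rw [map_smul, pd_one, smul_zero]; exact zero_mem _
  | succ n ih =>
    refine symLT_succ_induction (p := fun f => pd e i f ∈ symLT K (n + 1)) ?_ ?_ ?_ ?_ hf
    · rw [pd_one]; exact zero_mem _
    · intro f g hf hg; rw [map_add]; exact Submodule.add_mem _ hf hg
    · intro r f hf; rw [map_smul]; exact Submodule.smul_mem _ r hf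
    · intro v f hf
      rw [pd_ι_mul]
      exact Submodule.add_mem _ (Submodule.smul_mem _ _ hf) (ι_mul_mem_symLT v (ih hf))

/-- The Euler operator is multiplication by `n` on polynomials of degree `n`, up to lower
degree. -/
theorem eul_sub_mem_symLT {n : ℕ} {f : SymmetricAlgebra ℂ K} (hf : f ∈ symLT K (n + 1)) :
    eul e f - (n : ℂ) • f ∈ symLT K n := by
  induction n generalizing f with
  | zero =>
    obtain ⟨r, rfl⟩ := mem_symLT_one hf
    rw [map_smul, eul_one, smul_zero, Nat.cast_zero, zero_smul, sub_zero]; exact zero_mem _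
  | succ n ih =>
    refine symLT_succ_induction
      (p := fun f => eul e f - ((n + 1 : ℕ) : ℂ) • f ∈ symLT K (n + 1)) ?_ ?_ ?_ ?_ hf
    · rw [eul_one, zero_sub]
      exact Submodule.neg_mem _ (Submodule.smul_mem _ _ (one_mem_symLT n))
    · intro f g hf hg
      rw [map_add, smul_add, add_sub_add_comm]; exact Submodule.add_mem _ hf hg
    · intro r f hf
      rw [map_smul, smul_comm, ← smul_sub]; exact Submodule.smul_mem _ r hf
    · intro v f hf
      have h1 : eul e (SymmetricAlgebra.ι ℂ K v * f) -
          ((n + 1 : ℕ) : ℂ) • (SymmetricAlgebra.ι ℂ K v * f) =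
          SymmetricAlgebra.ι ℂ K v * (eul e f - (n : ℂ) • f) := by
        rw [eul_ι_mul, mul_sub, mul_smul_comm]; push_cast; module
      rw [h1]
      exact ι_mul_mem_symLT v (ih hf)

variable (Q) in
/-- Elements of `S(K) ⊗ C(K)` of polynomial degree less than `n`. -/
def symCliffLT (n : ℕ) : Submodule ℂ (SymmetricAlgebra ℂ K ⊗[ℂ] CliffordAlgebra Q) :=
  Submodule.span ℂ {x | ∃ g ∈ symLT K n, ∃ a, x = g ⊗ₜ a}

theorem tmul_mem_symCliffLT {n : ℕ} {g : SymmetricAlgebra ℂ K} (hg : g ∈ symLT K n)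
    (a : CliffordAlgebra Q) : g ⊗ₜ[ℂ] a ∈ symCliffLT Q n :=
  Submodule.subset_span ⟨g, hg, a, rfl⟩

/-- A linear map raising the degree of all decomposable tensors by a prescribed amount does so
on all elements. -/
theorem map_mem_symCliffLT {M : Type*} [AddCommGroup M] [Module ℂ M]
    (φ : SymmetricAlgebra ℂ K ⊗[ℂ] CliffordAlgebra Q →ₗ[ℂ] M) {n : ℕ} {L : Submodule ℂ M}
    (h : ∀ g ∈ symLT K n, ∀ a, φ (g ⊗ₜ a) ∈ L)
    {x : SymmetricAlgebra ℂ K ⊗[ℂ] CliffordAlgebra Q} (hx : x ∈ symCliffLT Q n) : φ x ∈ L := by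
  have : symCliffLT Q n ≤ L.comap φ := by
    refine Submodule.span_le.mpr ?_
    rintro _ ⟨g, hg, a, rfl⟩
    exact h g hg a
  exact this hx

variable (K) (Q) in
/-- The parity automorphism of `S(K) ⊗ C(K)`. -/
def symEps : SymmetricAlgebra ℂ K ⊗[ℂ] CliffordAlgebra Q →ₐ[ℂ]
    SymmetricAlgebra ℂ K ⊗[ℂ] CliffordAlgebra Q :=
  Algebra.TensorProduct.map (AlgHom.id ℂ _) involute

variable (Q) in
/-- The symbol `∑ e_i ⊗ e_i` of the Dirac element. -/
def symDirac : SymmetricAlgebra ℂ K ⊗[ℂ] CliffordAlgebra Q :=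
  ∑ i, SymmetricAlgebra.ι ℂ K (e i) ⊗ₜ ι Q (e i)

variable (Q) in
/-- The Koszul differential: the supercommutator with the symbol of the Dirac element. -/
def kosz : Module.End ℂ (SymmetricAlgebra ℂ K ⊗[ℂ] CliffordAlgebra Q) :=
  LinearMap.mulLeft ℂ (symDirac Q e) -
    LinearMap.mulRight ℂ (symDirac Q e) ∘ₗ (symEps K Q).toLinearMap

theorem kosz_apply (x : SymmetricAlgebra ℂ K ⊗[ℂ] CliffordAlgebra Q) :
    kosz Q e x = symDirac Q e * x - symEps K Q x * symDirac Q e := rfl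

theorem kosz_tmul (g : SymmetricAlgebra ℂ K) (a : CliffordAlgebra Q) :
    kosz Q e (g ⊗ₜ a) =
      (2 : ℂ) • ∑ i, (SymmetricAlgebra.ι ℂ K (e i) * g) ⊗ₜ[ℂ] ctr Q (e i) a := by
  rw [kosz_apply, symDirac, symEps, Algebra.TensorProduct.map_tmul, Finset.sum_mul,
    Finset.mul_sum, ← Finset.sum_sub_distrib, Finset.smul_sum]
  refine Finset.sum_congr rfl fun i _ => ?_
  rw [Algebra.TensorProduct.tmul_mul_tmul, Algebra.TensorProduct.tmul_mul_tmul, AlgHom.id_apply,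
    mul_comm g, ← TensorProduct.tmul_sub, ctr_apply, TensorProduct.tmul_smul, smul_smul]
  norm_num

variable (Q) in
/-- The de Rham type homotopy for the Koszul differential. -/
def koszHtpy : Module.End ℂ (SymmetricAlgebra ℂ K ⊗[ℂ] CliffordAlgebra Q) :=
  ∑ i, TensorProduct.map (pd e i) (wdg Q (e i))

theorem koszHtpy_tmul (g : SymmetricAlgebra ℂ K) (a : CliffordAlgebra Q) :
    koszHtpy Q e (g ⊗ₜ a) = ∑ i, pd e i g ⊗ₜ[ℂ] wdg Q (e i) a := by
  simp [koszHtpy, LinearMap.sum_apply]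

theorem koszHtpy_mem {n : ℕ} {x : SymmetricAlgebra ℂ K ⊗[ℂ] CliffordAlgebra Q}
    (hx : x ∈ symCliffLT Q (n + 1)) : koszHtpy Q e x ∈ symCliffLT Q n := by
  refine map_mem_symCliffLT _ (fun g hg a => ?_) hx
  rw [koszHtpy_tmul]
  exact Submodule.sum_mem _ fun i _ => tmul_mem_symCliffLT (pd_mem_symLT e i hg) _

variable {e} (he : IsCliffordOrthonormal Q e)
include he

theorem ctr_wdg_anticomm (i j : κ) (a : CliffordAlgebra Q) :
    ctr Q (e i) (wdg Q (e j) a) + wdg Q (e j) (ctr Q (e i) a) = if i = j then -a else 0 := by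
  by_cases hij : i = j
  · subst hij
    have := congrArg (fun T => T a) (ctr_mul_wdg_self (he.sq i))
    change ctr Q (e i) (wdg Q (e i) a) = -a - wdg Q (e i) (ctr Q (e i) a) at this
    rw [this, if_pos rfl, sub_add_cancel]
  · have := congrArg (fun T => T a) (ctr_mul_wdg (he.anti i j hij))
    change ctr Q (e i) (wdg Q (e j) a) = -(wdg Q (e j) (ctr Q (e i) a)) at this
    rw [this, if_neg hij, neg_add_cancel]

/-- The homotopy formula for the Koszul differential. -/
theorem kosz_homotopy (x : SymmetricAlgebra ℂ K ⊗[ℂ] CliffordAlgebra Q) :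
    kosz Q e (koszHtpy Q e x) + koszHtpy Q e (kosz Q e x) =
      (-2 : ℂ) • (TensorProduct.map (eul e) LinearMap.id x +
        TensorProduct.map LinearMap.id (∑ i, numOp Q (e i)) x) := by
  induction x using TensorProduct.induction_on with
  | zero => simp
  | add x y hx hy =>
    have h1 : kosz Q e (koszHtpy Q e (x + y)) + koszHtpy Q e (kosz Q e (x + y)) =
        (kosz Q e (koszHtpy Q e x) + koszHtpy Q e (kosz Q e x)) +
        (kosz Q e (koszHtpy Q e y) + koszHtpy Q e (kosz Q e y)) := by
      simp only [map_add]; abel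
    rw [h1, hx, hy]
    simp only [map_add]
    module
  | tmul g a =>
    have e1 : kosz Q e (koszHtpy Q e (g ⊗ₜ a)) = (2 : ℂ) • ∑ i, ∑ j,
        (SymmetricAlgebra.ι ℂ K (e i) * pd e j g) ⊗ₜ[ℂ] ctr Q (e i) (wdg Q (e j) a) := by
      rw [koszHtpy_tmul, map_sum, Finset.sum_comm, Finset.smul_sum]
      exact Finset.sum_congr rfl fun j _ => kosz_tmul _ _ _
    have e2 : koszHtpy Q e (kosz Q e (g ⊗ₜ a)) =
        (2 : ℂ) • (∑ i, ∑ j,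
          (SymmetricAlgebra.ι ℂ K (e i) * pd e j g) ⊗ₜ[ℂ] wdg Q (e j) (ctr Q (e i) a)) +
        (2 : ℂ) • ∑ i, g ⊗ₜ[ℂ] wdg Q (e i) (ctr Q (e i) a) := by
      rw [kosz_tmul, map_smul, map_sum, ← smul_add, ← Finset.sum_add_distrib]
      congr 1
      refine Finset.sum_congr rfl fun i _ => ?_
      rw [koszHtpy_tmul]
      simp only [pd_ι_mul, TensorProduct.add_tmul, Finset.sum_add_distrib,
        Module.Basis.repr_self]
      rw [add_comm]
      congr 1
      rw [Finset.sum_eq_single i]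
      · simp
      · intro j _ hj
        rw [Finsupp.single_eq_of_ne hj, zero_smul, TensorProduct.zero_tmul]
      · simp
    rw [e1, e2, ← add_assoc, ← smul_add, ← Finset.sum_add_distrib]
    simp only [← Finset.sum_add_distrib, ← TensorProduct.tmul_add, ctr_wdg_anticomm he]
    have e3 : ∀ i, ∑ j, (SymmetricAlgebra.ι ℂ K (e i) * pd e j g) ⊗ₜ[ℂ] (if i = j then -a else 0)
        = -((SymmetricAlgebra.ι ℂ K (e i) * pd e i g) ⊗ₜ[ℂ] a) := by
      intro i
      rw [Finset.sum_eq_single i]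
      · rw [if_pos rfl, TensorProduct.tmul_neg]
      · intro j _ hj
        rw [if_neg (Ne.symm hj), TensorProduct.tmul_zero]
      · simp
    simp only [e3, TensorProduct.map_tmul, LinearMap.id_apply, eul_apply, LinearMap.sum_apply,
      numOp, LinearMap.neg_apply, Module.End.mul_apply, TensorProduct.sum_tmul,
      TensorProduct.tmul_sum, TensorProduct.tmul_neg, Finset.sum_neg_distrib]
    module

/-- The inverse of the number operator shifted by `m > 0`. -/
theorem exists_number_inv (m : ℕ) (hm : 0 < m) : ∃ G : Module.End ℂ (CliffordAlgebra Q),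
    (∀ a, (m : ℂ) • G a + (∑ i, numOp Q (e i)) (G a) = a) ∧
    (∀ a, G ((m : ℂ) • a + (∑ i, numOp Q (e i)) a) = a) := by
  obtain ⟨u, hu⟩ := isUnit_number (Q := Q) he m hm
  have hcast : ∀ a : CliffordAlgebra Q, (m : Module.End ℂ (CliffordAlgebra Q)) a = (m : ℂ) • a := by
    intro a
    rw [Module.End.natCast_apply, Nat.cast_smul_eq_nsmul]
  refine ⟨(↑u⁻¹ : Module.End ℂ (CliffordAlgebra Q)), fun a => ?_, fun a => ?_⟩
  · have := congrArg (fun T : Module.End ℂ (CliffordAlgebra Q) => T a) u.mul_inv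
    rw [hu] at this
    rw [← hcast]
    exact this
  · have := congrArg (fun T : Module.End ℂ (CliffordAlgebra Q) => T a) u.inv_mul
    rw [hu] at this
    rw [← hcast]
    exact this

theorem ctr_number (j : κ) (a : CliffordAlgebra Q) :
    ctr Q (e j) ((∑ i, numOp Q (e i)) a) =
      (∑ i, numOp Q (e i)) (ctr Q (e j) a) + ctr Q (e j) a := by
  rw [LinearMap.sum_apply, LinearMap.sum_apply, map_sum]
  have h1 : ∀ i, ctr Q (e j) (numOp Q (e i) a) =
      numOp Q (e i) (ctr Q (e j) a) + if i = j then ctr Q (e j) a else 0 := by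
    intro i
    by_cases hij : i = j
    · subst hij
      rw [if_pos rfl]
      exact congrArg (fun T => T a) (ctr_mul_numOp_self he i)
    · rw [if_neg hij, add_zero]
      exact congrArg (fun T => T a) (ctr_mul_numOp_of_ne he (Ne.symm hij))
  simp only [h1, Finset.sum_add_distrib, Finset.sum_ite_eq', Finset.mem_univ, if_true]

/-- An element of positive degree whose Koszul differential does not raise the degree is a
boundary up to lower degree. -/
theorem kosz_exact {n : ℕ} (hn : 0 < n) {x : SymmetricAlgebra ℂ K ⊗[ℂ] CliffordAlgebra Q}
    (hx : x ∈ symCliffLT Q (n + 1)) (hd : kosz Q e x ∈ symCliffLT Q (n + 1)) :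
    ∃ y ∈ symCliffLT Q n, x - kosz Q e y ∈ symCliffLT Q n := by
  obtain ⟨G, hG1, hG2⟩ := exists_number_inv he n hn
  obtain ⟨G', hG1', hG2'⟩ := exists_number_inv he (n + 1) (Nat.succ_pos n)
  have hctr : ∀ j a, ctr Q (e j) (G a) = G' (ctr Q (e j) a) := by
    intro j a
    have h1 := ctr_number he j (G a)
    conv_rhs => rw [← hG1 a]
    rw [map_add, map_smul, h1]
    conv_lhs => rw [← hG2' (ctr Q (e j) (G a))]
    congr 1
    push_cast
    module
  have hmem : ∀ (T : Module.End ℂ (CliffordAlgebra Q)) {m : ℕ}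
      {z : SymmetricAlgebra ℂ K ⊗[ℂ] CliffordAlgebra Q}, z ∈ symCliffLT Q m →
      TensorProduct.map LinearMap.id T z ∈ symCliffLT Q m := by
    intro T m z hz
    refine map_mem_symCliffLT _ (fun g hg a => ?_) hz
    rw [TensorProduct.map_tmul]
    exact tmul_mem_symCliffLT hg _
  set x' := TensorProduct.map LinearMap.id G x with hx'
  have hx'mem : x' ∈ symCliffLT Q (n + 1) := hmem G hx
  have hdx' : kosz Q e x' = TensorProduct.map LinearMap.id G' (kosz Q e x) := by
    rw [hx']
    clear hx' hx'mem hx hd x'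
    induction x using TensorProduct.induction_on with
    | zero => simp
    | add x y hx hy => simp only [map_add, hx, hy]
    | tmul g a =>
      simp only [TensorProduct.map_tmul, LinearMap.id_apply, kosz_tmul, map_smul, map_sum, hctr]
  have hxx' : (n : ℂ) • x' + TensorProduct.map LinearMap.id (∑ i, numOp Q (e i)) x' = x := by
    rw [hx']
    clear hdx' hx' hx'mem hx hd x'
    induction x using TensorProduct.induction_on with
    | zero => simp
    | add x y hx hy =>
      simp only [map_add, smul_add]
      rw [add_add_add_comm, hx, hy]
    | tmul g a =>
      rw [TensorProduct.map_tmul, TensorProduct.map_tmul, LinearMap.id_apply, LinearMap.id_apply,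
        ← TensorProduct.tmul_smul, ← TensorProduct.tmul_add, hG1]
  have heul : TensorProduct.map (eul e) LinearMap.id x' - (n : ℂ) • x' ∈ symCliffLT Q n := by
    have := map_mem_symCliffLT (L := symCliffLT Q n)
      (TensorProduct.map (eul e) (LinearMap.id (M := CliffordAlgebra Q)) - (n : ℂ) • LinearMap.id)
      (fun g hg a => ?_) hx'mem
    · exact this
    · rw [LinearMap.sub_apply, LinearMap.smul_apply, TensorProduct.map_tmul, LinearMap.id_apply,
        LinearMap.id_apply, TensorProduct.smul_tmul', ← TensorProduct.sub_tmul]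
      exact tmul_mem_symCliffLT (eul_sub_mem_symLT e hg) a
  have hhd : koszHtpy Q e (kosz Q e x') ∈ symCliffLT Q n := by
    rw [hdx']
    exact koszHtpy_mem e (hmem G' hd)
  refine ⟨(-1 / 2 : ℂ) • koszHtpy Q e x', Submodule.smul_mem _ _ (koszHtpy_mem e hx'mem), ?_⟩
  have h := kosz_homotopy he x'
  have key : x - kosz Q e ((-1 / 2 : ℂ) • koszHtpy Q e x') =
      -(TensorProduct.map (eul e) LinearMap.id x' - (n : ℂ) • x')
        - (1 / 2 : ℂ) • koszHtpy Q e (kosz Q e x') := by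
    rw [map_smul, eq_sub_of_add_eq h]
    conv_lhs => rw [← hxx']
    module
  rw [key]
  exact Submodule.sub_mem _ (Submodule.neg_mem _ heul) (Submodule.smul_mem _ _ hhd)

/-- An element of degree zero whose Koszul differential has degree zero is a scalar. -/
theorem kosz_exact_zero {x : SymmetricAlgebra ℂ K ⊗[ℂ] CliffordAlgebra Q}
    (hx : x ∈ symCliffLT Q 1) (hd : kosz Q e x ∈ symCliffLT Q 1) :
    ∃ r : ℂ, x = algebraMap ℂ _ r := by
  obtain ⟨a, rfl⟩ : ∃ a : CliffordAlgebra Q, x = 1 ⊗ₜ a := by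
    have := map_mem_symCliffLT (L := LinearMap.range
      (TensorProduct.mk ℂ (SymmetricAlgebra ℂ K) (CliffordAlgebra Q) 1)) LinearMap.id
      (fun g hg a => by
        obtain ⟨r, rfl⟩ := mem_symLT_one hg
        exact ⟨r • a, by simp [TensorProduct.smul_tmul]⟩) hx
    obtain ⟨a, ha⟩ := this
    exact ⟨a, ha.symm⟩
  have h0 : ∀ j, ctr Q (e j) a = 0 := by
    intro j
    have h1 : TensorProduct.map (pd e j) LinearMap.id (kosz Q e (1 ⊗ₜ a)) = 0 := by
      have := map_mem_symCliffLT (L := ⊥) (TensorProduct.map (pd e j)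
        (LinearMap.id (M := CliffordAlgebra Q))) (fun g hg a => by
          obtain ⟨r, rfl⟩ := mem_symLT_one hg
          simp [pd_one]) hd
      exact this
    rw [kosz_tmul, map_smul, map_sum, Finset.sum_eq_single j] at h1
    · rw [TensorProduct.map_tmul, pd_ι_mul, Module.Basis.repr_self, Finsupp.single_eq_same,
        pd_one, mul_zero, add_zero, one_smul, LinearMap.id_apply] at h1
      have h2 := congrArg (TensorProduct.lid ℂ _ ∘
        TensorProduct.map (SymmetricAlgebra.algebraMapInv (R := ℂ) (M := K)).toLinearMap
          (LinearMap.id (M := CliffordAlgebra Q))) h1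
      simpa using h2
    · intro i _ hi
      rw [TensorProduct.map_tmul, pd_ι_mul, Module.Basis.repr_self,
        Finsupp.single_eq_of_ne (Ne.symm hi), pd_one, mul_zero, add_zero, zero_smul,
        TensorProduct.zero_tmul]
    · simp
  obtain ⟨r, rfl⟩ := exists_algebraMap_of_ctr he a h0
  exact ⟨r, by rw [Algebra.TensorProduct.algebraMap_apply, Algebra.algebraMap_eq_smul_one,
    Algebra.algebraMap_eq_smul_one, TensorProduct.smul_tmul]⟩

end Koszul

/-! ### The filtered Dirac differential -/

section Abstract

/-- The formal structure behind the Dirac cohomology argument: an algebra `A` with a parity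
automorphism `eps`, a finite group acting through `rho`, an odd element `D` which intertwines `rho`
and its parity twist and whose square commutes with the (twisted) invariants, and a filtration
`F` (with `F n` thought of as the elements of degree less than `n`) for which the differential
`x ↦ D x - eps(x) D` is exact up to lower degree, away from the span of the group. -/
structure DiracDatum (A G : Type*) [Ring A] [Algebra ℂ A] [Group G] where
  /-- The parity automorphism. -/
  eps : A →ₐ[ℂ] A
  eps_eps : ∀ x, eps (eps x) = x
  /-- The group homomorphism to `A`. -/
  rho : G →* A
  eps_rho : ∀ g, ∃ g', eps (rho g) = rho g'
  /-- The Dirac element. -/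
  D : A
  eps_D : eps D = -D
  D_rho : ∀ g, D * rho g = eps (rho g) * D
  D_sq_comm : ∀ y, (∀ g, y * rho g = rho g * y) → D * D * y = y * (D * D)
  D_sq_comm' : ∀ y, (∀ g, y * rho g = eps (rho g) * y) → D * D * y = y * (D * D)
  /-- The filtration, by elements of degree less than `n`. -/
  F : ℕ → Submodule ℂ A
  F_zero : F 0 = ⊥
  F_mono : Monotone F
  exists_mem_F : ∀ x, ∃ n, x ∈ F n
  rho_mem : ∀ g, rho g ∈ F 1
  rho_mul_mem : ∀ n g, ∀ x ∈ F n, rho g * x ∈ F n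
  mul_rho_mem : ∀ n g, ∀ x ∈ F n, x * rho g ∈ F n
  exact_one : ∀ x ∈ F 1, D * x - eps x * D ∈ F 1 → x ∈ Submodule.span ℂ (Set.range rho)
  exact_succ : ∀ n, 0 < n → ∀ x ∈ F (n + 1), D * x - eps x * D ∈ F (n + 1) →
    ∃ y, x - (D * y - eps y * D) ∈ F n

namespace DiracDatum

variable {A G : Type*} [Ring A] [Algebra ℂ A] [Group G] (X : DiracDatum A G)

/-- The Dirac differential `x ↦ D x - eps(x) D`. -/
def d : A →ₗ[ℂ] A :=
  LinearMap.mulLeft ℂ X.D - LinearMap.mulRight ℂ X.D ∘ₗ X.eps.toLinearMap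

theorem d_apply (x : A) : X.d x = X.D * x - X.eps x * X.D := rfl

/-- The identity or the parity automorphism. -/
def tw : Bool → A →ₐ[ℂ] A
  | false => AlgHom.id ℂ A
  | true => X.eps

theorem eps_tw (b : Bool) (x : A) : X.eps (X.tw b x) = X.tw (!b) x := by
  cases b
  · rfl
  · exact X.eps_eps x

theorem D_mul_tw (b : Bool) (g : G) : X.D * X.tw b (X.rho g) = X.tw (!b) (X.rho g) * X.D := by
  cases b
  · exact X.D_rho g
  · have h := congrArg X.eps (X.D_rho g)
    rw [map_mul, map_mul, X.eps_D, X.eps_eps, neg_mul, mul_neg, neg_inj] at h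
    exact h

theorem tw_rho (b : Bool) (g : G) : ∃ g', X.tw b (X.rho g) = X.rho g' := by
  cases b
  · exact ⟨g, rfl⟩
  · exact X.eps_rho g

/-- Invariants (`b = false`) and parity-twisted invariants (`b = true`) of the group. -/
def Inv (b : Bool) (a : A) : Prop := ∀ g, a * X.rho g = X.tw b (X.rho g) * a

variable {X}

theorem Inv.add {b : Bool} {x y : A} (hx : X.Inv b x) (hy : X.Inv b y) : X.Inv b (x + y) :=
  fun g => by rw [add_mul, hx, hy, mul_add]

theorem Inv.sub {b : Bool} {x y : A} (hx : X.Inv b x) (hy : X.Inv b y) : X.Inv b (x - y) :=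
  fun g => by rw [sub_mul, hx, hy, mul_sub]

theorem Inv.smul {b : Bool} {x : A} (r : ℂ) (hx : X.Inv b x) : X.Inv b (r • x) :=
  fun g => by rw [smul_mul_assoc, hx, mul_smul_comm]

theorem Inv.eps {b : Bool} {x : A} (hx : X.Inv b x) : X.Inv b (X.eps x) := by
  intro g
  obtain ⟨g', hg'⟩ := X.eps_rho g
  have h := congrArg X.eps (hx g')
  rw [map_mul, map_mul, ← hg', X.eps_eps] at h
  rw [h]
  congr 1
  cases b
  · exact X.eps_eps _
  · change X.eps (X.eps (X.eps (X.rho g))) = X.eps (X.rho g)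
    rw [X.eps_eps]

theorem Inv.d {b : Bool} {x : A} (hx : X.Inv b x) : X.Inv (!b) (X.d x) := by
  intro g
  have h1 := congrArg X.eps (hx g)
  rw [map_mul, map_mul, X.eps_tw] at h1
  rw [d_apply, sub_mul, mul_assoc, hx, ← mul_assoc, D_mul_tw, mul_assoc (X.eps x), X.D_rho,
    ← mul_assoc, h1, mul_sub, mul_assoc, mul_assoc]

theorem Inv.d_d {b : Bool} {x : A} (hx : X.Inv b x) : X.d (X.d x) = 0 := by
  have h1 : X.D * X.D * x = x * (X.D * X.D) := by
    cases b
    · exact X.D_sq_comm x hx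
    · exact X.D_sq_comm' x hx
  rw [d_apply, d_apply, map_sub, map_mul, map_mul, X.eps_eps, X.eps_D]
  rw [mul_sub, sub_mul, ← mul_assoc, h1]
  noncomm_ring

variable (X)

theorem d_of_mem_span {r : A} (hr : r ∈ Submodule.span ℂ (Set.range X.rho)) : X.d r = 0 := by
  induction hr using Submodule.span_induction with
  | mem x hx =>
    obtain ⟨g, rfl⟩ := hx
    rw [d_apply, X.D_rho, sub_self]
  | zero => exact map_zero _
  | add x y _ _ hx hy => rw [map_add, hx, hy, add_zero]
  | smul c x _ hx => rw [map_smul, hx, smul_zero]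

theorem span_le_F_one : Submodule.span ℂ (Set.range X.rho) ≤ X.F 1 := by
  refine Submodule.span_le.mpr ?_
  rintro _ ⟨g, rfl⟩
  exact X.rho_mem g

variable [Fintype G]

/-- The projection onto the (twisted) invariants by averaging. -/
def avg (b : Bool) : A →ₗ[ℂ] A :=
  (Fintype.card G : ℂ)⁻¹ • ∑ g : G,
    LinearMap.mulLeft ℂ (X.tw b (X.rho g)) ∘ₗ LinearMap.mulRight ℂ (X.rho g⁻¹)

theorem avg_apply (b : Bool) (a : A) :
    X.avg b a = (Fintype.card G : ℂ)⁻¹ • ∑ g : G, X.tw b (X.rho g) * (a * X.rho g⁻¹) := by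
  simp [avg, LinearMap.sum_apply]

theorem inv_avg (b : Bool) (a : A) : X.Inv b (X.avg b a) := by
  intro x
  rw [avg_apply, smul_mul_assoc, mul_smul_comm, Finset.sum_mul, Finset.mul_sum]
  congr 1
  refine Fintype.sum_equiv (Equiv.mulLeft x⁻¹) _ _ fun g => ?_
  rw [Equiv.coe_mulLeft, mul_inv_rev, inv_inv, map_mul X.rho x⁻¹ g, map_mul X.rho g⁻¹ x,
    map_mul (X.tw b), ← mul_assoc (X.tw b (X.rho x)), ← mul_assoc (X.tw b (X.rho x)),
    ← map_mul (X.tw b), ← map_mul X.rho, mul_inv_cancel, map_one, map_one, one_mul, mul_assoc,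
    mul_assoc]

theorem avg_of_inv {b : Bool} {a : A} (ha : X.Inv b a) : X.avg b a = a := by
  have h : ∀ g : G, X.tw b (X.rho g) * (a * X.rho g⁻¹) = a := by
    intro g
    rw [← mul_assoc, ← ha, mul_assoc, ← map_mul, mul_inv_cancel, map_one, mul_one]
  have hc : (Fintype.card G : ℂ) ≠ 0 := by exact_mod_cast Fintype.card_ne_zero
  rw [avg_apply, Finset.sum_congr rfl fun g _ => h g, Finset.sum_const, Finset.card_univ,
    ← Nat.cast_smul_eq_nsmul ℂ, smul_smul, inv_mul_cancel₀ hc, one_smul]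

theorem d_avg (b : Bool) (y : A) : X.d (X.avg (!b) y) = X.avg b (X.d y) := by
  rw [avg_apply, avg_apply, map_smul, map_sum]
  congr 1
  refine Finset.sum_congr rfl fun g _ => ?_
  rw [d_apply, d_apply, map_mul, map_mul, X.eps_tw, Bool.not_not, ← mul_assoc, D_mul_tw,
    Bool.not_not, sub_mul, mul_sub, mul_assoc, mul_assoc, mul_assoc, mul_assoc, mul_assoc, X.D_rho]

theorem avg_mem {b : Bool} {n : ℕ} {a : A} (ha : a ∈ X.F n) : X.avg b a ∈ X.F n := by
  rw [avg_apply]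
  refine Submodule.smul_mem _ _ (Submodule.sum_mem _ fun g _ => ?_)
  obtain ⟨g', hg'⟩ := X.tw_rho b g
  rw [hg']
  exact X.rho_mul_mem _ _ _ (X.mul_rho_mem _ _ _ ha)

/-- A (twisted) invariant whose Dirac differential has degree zero is, up to the differential of
a (twisted) invariant, in the span of the group. -/
theorem exists_sub_d_mem (b : Bool) {a : A} (ha : X.Inv b a) (hd : X.d a ∈ X.F 1) :
    ∃ y, X.Inv (!b) y ∧ a - X.d y ∈ Submodule.span ℂ (Set.range X.rho) := by
  obtain ⟨n, hn⟩ := X.exists_mem_F a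
  induction n generalizing a with
  | zero =>
    rw [X.F_zero, Submodule.mem_bot] at hn
    refine ⟨0, fun g => by simp, ?_⟩
    rw [hn, map_zero, sub_zero]; exact zero_mem _
  | succ n ih =>
    rcases Nat.eq_zero_or_pos n with rfl | hpos
    · refine ⟨0, fun g => by simp, ?_⟩
      rw [map_zero, sub_zero]
      exact X.exact_one a hn hd
    · obtain ⟨y₀, hy₀⟩ := X.exact_succ n hpos a hn (X.F_mono (Nat.succ_le_succ (Nat.zero_le n)) hd)
      -- Averaging the primitive keeps it a primitive up to lower degree.
      have hy := X.inv_avg (!b) y₀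
      have h1 : a - X.d (X.avg (!b) y₀) ∈ X.F n := by
        have h0 := X.avg_mem (b := b) hy₀
        rw [map_sub, X.avg_of_inv ha] at h0
        rw [d_avg]
        exact h0
      have h2 : X.Inv b (X.d (X.avg (!b) y₀)) := by
        have := hy.d
        rwa [Bool.not_not] at this
      obtain ⟨y', hy', hr⟩ := ih (ha.sub h2) (by rwa [map_sub, hy.d_d, sub_zero]) h1
      exact ⟨X.avg (!b) y₀ + y', hy.add hy', by rwa [map_add, ← sub_sub]⟩

/-- An even invariant cycle is, up to the differential of an odd twisted invariant, in the span of
the group. -/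
theorem exists_odd_sub_d_mem {t : A} (ht : X.Inv false t) (het : X.eps t = t) (hd : X.d t = 0) :
    ∃ a, X.Inv true a ∧ X.eps a = -a ∧ t - X.d a ∈ Submodule.span ℂ (Set.range X.rho) := by
  obtain ⟨y, hy, hspan⟩ := X.exists_sub_d_mem false ht (by rw [hd]; exact zero_mem _)
  -- The odd part of a primitive is a primitive.
  refine ⟨(1 / 2 : ℂ) • (y - X.eps y), (Inv.sub hy (Inv.eps hy)).smul _, ?_, ?_⟩
  · rw [map_smul, map_sub, X.eps_eps, ← smul_neg, neg_sub]
  · have hspan' : X.eps (t - X.d y) ∈ Submodule.span ℂ (Set.range X.rho) := by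
      generalize t - X.d y = s at hspan
      induction hspan using Submodule.span_induction with
      | mem x hx =>
        obtain ⟨g, rfl⟩ := hx
        obtain ⟨g', hg'⟩ := X.eps_rho g
        rw [hg']
        exact Submodule.subset_span ⟨g', rfl⟩
      | zero => rw [map_zero]; exact zero_mem _
      | add x y _ _ hx hy => rw [map_add]; exact add_mem hx hy
      | smul r x _ hx => rw [map_smul]; exact Submodule.smul_mem _ _ hx
    have h1 : X.d (y - X.eps y) = X.d y + X.eps (X.d y) := by
      rw [map_sub, d_apply X (X.eps y), d_apply, map_sub, map_mul, map_mul, X.eps_eps, X.eps_D]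
      noncomm_ring
    have hsum : t - X.d ((1 / 2 : ℂ) • (y - X.eps y)) =
        (1 / 2 : ℂ) • ((t - X.d y) + X.eps (t - X.d y)) := by
      rw [map_smul, h1, map_sub X.eps t, het]
      module
    rw [hsum]
    exact Submodule.smul_mem _ _ (add_mem hspan hspan')

/-- An invariant differential of degree zero vanishes. -/
theorem d_eq_zero {x : A} (hx : X.Inv false (X.d x)) (hd : X.d x ∈ X.F 1) : X.d x = 0 := by
  have h1 : X.d (X.avg true x) = X.d x := by
    have := X.d_avg false x
    rw [X.avg_of_inv hx] at this
    exact this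
  obtain ⟨y, hy, hr⟩ := X.exists_sub_d_mem true (X.inv_avg true x) (by rwa [h1])
  have h2 := X.d_of_mem_span hr
  rw [map_sub, hy.d_d, sub_zero, h1] at h2
  exact h2

/-- The span of the group meets `D A + A D` trivially in invariants. The role of `v` (the volume
element) is to turn the anticommutator with `D` into the differential `d`. -/
theorem eq_zero_of_eq_add {r a b : A} (hr : r ∈ Submodule.span ℂ (Set.range X.rho))
    (hinv : X.Inv false r) (h : r = X.D * a + b * X.D)
    (hD : ∀ x, x * X.D = 0 → x = 0) {v w : A} {σ : ℂ} {β : Bool} (hσ : σ * σ = 1)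
    (hvw : v * w = 1) (hwv : w * v = 1) (hvD : v * X.D = σ • (X.D * v))
    (hev : X.eps v = -(σ • v)) (hvρ : ∀ g, v * X.rho g = X.tw β (X.rho g) * v) : r = 0 := by
  have hsm : ∀ x : A, σ • σ • x = x := fun x => by rw [smul_smul, hσ, one_smul]
  have hwD : w * X.D = σ • (X.D * w) := by
    have h1 : w * (v * X.D) * w = w * (σ • (X.D * v)) * w := by rw [hvD]
    rw [← mul_assoc, hwv, one_mul, mul_smul_comm, smul_mul_assoc, mul_assoc, mul_assoc, hvw,
      mul_one] at h1
    rw [h1, hsm]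
  have hew : X.eps w = -(σ • w) := by
    have h1 : X.eps w * X.eps v = 1 := by rw [← map_mul, hwv, map_one]
    have h2 : X.eps w * X.eps v * w = -(σ • X.eps w) := by
      rw [hev, mul_neg, neg_mul, mul_smul_comm, smul_mul_assoc, mul_assoc, hvw, mul_one]
    rw [h1, one_mul] at h2
    conv_rhs => rw [h2, smul_neg, hsm, neg_neg]
  -- Rewrite the relation as `r = d a₁ + e₁ D` with `a₁`, `e₁` twisted invariants.
  set a₁ := X.avg true a with ha₁
  set e₁ := X.eps (X.avg true (X.eps (b + X.eps a))) with he₁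
  have ha₁i : X.Inv true a₁ := X.inv_avg true a
  have he₁i : X.Inv true e₁ := (X.inv_avg true _).eps
  have hre : r = X.d a₁ + e₁ * X.D := by
    have h1 : r = X.d a + (b + X.eps a) * X.D := by rw [h, d_apply, add_mul]; abel
    have h2 : X.avg false ((b + X.eps a) * X.D) = e₁ * X.D := by
      rw [he₁, avg_apply, avg_apply, map_smul, smul_mul_assoc, map_sum, Finset.sum_mul]
      congr 1
      refine Finset.sum_congr rfl fun g _ => ?_
      rw [map_mul, map_mul, X.eps_eps, X.eps_tw, Bool.not_true, mul_assoc, mul_assoc,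
        mul_assoc, ← X.D_rho]
    have h3 := X.d_avg false a
    calc r = X.avg false r := (X.avg_of_inv hinv).symm
      _ = X.avg false (X.d a) + X.avg false ((b + X.eps a) * X.D) := by
        conv_lhs => rw [h1]
        rw [map_add]
      _ = X.d a₁ + e₁ * X.D := by rw [h2, ← h3, ha₁]; rfl
  have hanti : X.D * e₁ + X.eps e₁ * X.D = 0 := by
    apply hD
    have h1 := X.d_of_mem_span hr
    rw [hre, map_add, ha₁i.d_d, zero_add, d_apply, map_mul, X.eps_D] at h1
    rw [← h1]
    noncomm_ring
  have hdev : X.d (e₁ * v) = 0 := by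
    have h1 : X.d (e₁ * v) = (X.D * e₁ + X.eps e₁ * X.D) * v := by
      rw [d_apply, map_mul, hev, mul_neg, neg_mul, mul_smul_comm, smul_mul_assoc, mul_assoc,
        hvD, mul_smul_comm, hsm]
      noncomm_ring
    rw [h1, hanti, zero_mul]
  have hevi : X.Inv (!β) (e₁ * v) := by
    intro g
    obtain ⟨g', hg'⟩ := X.tw_rho β g
    rw [mul_assoc, hvρ, hg', ← mul_assoc, he₁i g', ← mul_assoc, ← X.eps_tw, hg']
    rfl
  obtain ⟨y, hy, hs⟩ := X.exists_sub_d_mem (!β) hevi (by rw [hdev]; exact zero_mem _)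
  set s := e₁ * v - X.d y with hs_def
  have he₁s : e₁ = s * w + X.d y * w := by
    rw [hs_def, sub_mul, mul_assoc, hvw, mul_one, sub_add_cancel]
  -- Both contributions to `e₁ D` are differentials.
  have hpart1 : X.d y * w * X.D = X.d (y * w * X.D) := by
    have h2 : X.eps y * X.D * w * X.D = -(X.eps y * X.eps w * X.D * X.D) := by
      have h3 : X.eps w * X.D = -(X.D * w) := by
        rw [hew, neg_mul, smul_mul_assoc, hwD, hsm]
      have h4 : X.eps y * X.eps w * X.D * X.D = X.eps y * (X.eps w * X.D) * X.D := by
        noncomm_ring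
      rw [h4, h3]
      noncomm_ring
    rw [d_apply, d_apply, map_mul, map_mul, X.eps_D, sub_mul, sub_mul, h2]
    noncomm_ring
  have hDs : X.D * X.eps s = s * X.D := by
    have h1 := congrArg X.eps (X.d_of_mem_span hs)
    rw [d_apply, map_sub, map_mul, map_mul, X.eps_eps, X.eps_D, map_zero] at h1
    have h2 : -(X.D * X.eps s) + s * X.D = 0 := by rw [← h1]; noncomm_ring
    rw [neg_add_eq_zero] at h2
    exact h2
  have hpart2 : s * w * X.D = X.d ((σ / 2) • (X.eps s * w)) := by
    have h1 : X.d (X.eps s * w) = (2 * σ) • (s * w * X.D) := by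
      have h3 : X.D * w = σ • (w * X.D) := by rw [hwD, hsm]
      rw [d_apply, map_mul, X.eps_eps, hew, ← mul_assoc, hDs, mul_assoc, h3, mul_neg, neg_mul,
        mul_smul_comm, mul_smul_comm, smul_mul_assoc, mul_assoc]
      module
    rw [map_smul, h1, smul_smul]
    have : σ / 2 * (2 * σ) = 1 := by rw [← hσ]; ring
    rw [this, one_smul]
  have hfin : r = X.d (a₁ + ((σ / 2) • (X.eps s * w) + y * w * X.D)) := by
    rw [map_add, map_add, ← hpart1, ← hpart2, ← add_mul, ← he₁s, hre]
  rw [hfin]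
  exact X.d_eq_zero (by rwa [← hfin]) (by rw [← hfin]; exact X.span_le_F_one hr)

end DiracDatum

end Abstract

/-! ### The volume element of a Clifford algebra -/

section Volume

open CliffordAlgebra

variable {K κ : Type*} [AddCommGroup K] [Module ℂ K] {Q : QuadraticForm ℂ K} [Fintype κ]
  {e : Module.Basis κ ℂ K} (he : IsCliffordOrthonormal Q e)
include he

/-- The volume element: an invertible element of parity `-σ` commuting with vectors up to the
sign `σ`. -/
theorem exists_volume : ∃ (v w : CliffordAlgebra Q) (σ : ℂ), (σ = 1 ∨ σ = -1) ∧
    v * w = 1 ∧ w * v = 1 ∧ (∀ x, v * ι Q x = σ • (ι Q x * v)) ∧ involute v = -(σ • v) := by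
  classical
  have key : ∀ s : Finset κ, ∃ (v w : CliffordAlgebra Q) (τ : ℂ), (τ = 1 ∨ τ = -1) ∧
      v * w = 1 ∧ w * v = 1 ∧ (∀ i, i ∉ s → v * ι Q (e i) = τ • (ι Q (e i) * v)) ∧
      (∀ i ∈ s, v * ι Q (e i) = -(τ • (ι Q (e i) * v))) ∧ involute v = τ • v := by
    intro s
    induction s using Finset.induction_on with
    | empty => exact ⟨1, 1, 1, Or.inl rfl, by simp, by simp, by simp, by simp, by simp⟩
    | insert a s ha ih =>
      obtain ⟨v, w, τ, hτ, h1, h2, h3, h4, h5⟩ := ih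
      refine ⟨ι Q (e a) * v, w * -ι Q (e a), -τ, ?_, ?_, ?_, ?_, ?_, ?_⟩
      · rcases hτ with rfl | rfl
        · exact Or.inr rfl
        · exact Or.inl (neg_neg _)
      · rw [mul_assoc, ← mul_assoc v, h1, one_mul, mul_neg, he.sq, neg_neg]
      · rw [mul_assoc, ← mul_assoc (-ι Q (e a)), neg_mul, he.sq, neg_neg, one_mul, h2]
      · intro i hi
        rw [Finset.mem_insert, not_or] at hi
        rw [mul_assoc, h3 i hi.2, mul_smul_comm, ← mul_assoc, he.anti a i (Ne.symm hi.1), neg_mul,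
          smul_neg, neg_smul, mul_assoc]
      · intro i hi
        rw [Finset.mem_insert] at hi
        by_cases hia : i = a
        · subst hia
          rw [mul_assoc, h3 i ha, mul_smul_comm, neg_smul, neg_neg]
        · rw [mul_assoc, h4 i (hi.resolve_left hia), mul_neg, mul_smul_comm, ← mul_assoc,
            he.anti a i (Ne.symm hia), neg_mul, smul_neg, neg_smul, neg_neg, neg_neg, mul_assoc]
      · rw [map_mul, involute_ι, h5, neg_mul, mul_smul_comm, neg_smul]
  obtain ⟨v, w, τ, hτ, h1, h2, -, h4, h5⟩ := key Finset.univ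
  refine ⟨v, w, -τ, ?_, h1, h2, ?_, ?_⟩
  · rcases hτ with rfl | rfl
    · exact Or.inr rfl
    · exact Or.inl (neg_neg _)
  · intro x
    rw [← e.sum_repr x]
    simp only [map_sum, map_smul, Finset.mul_sum, Finset.sum_mul, Finset.smul_sum, mul_smul_comm,
      smul_mul_assoc, h4 _ (Finset.mem_univ _)]
    refine Finset.sum_congr rfl fun i _ => ?_
    module
  · rw [h5, neg_smul, neg_neg]

end Volume

theorem volume_mul {K : Type*} [AddCommGroup K] [Module ℂ K] {Q : QuadraticForm ℂ K}
    {v : CliffordAlgebra Q} (hv : ∀ x, v * CliffordAlgebra.ι Q x = CliffordAlgebra.ι Q x * v)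
    (y : CliffordAlgebra Q) : v * y = y * v := by
  induction y using CliffordAlgebra.induction with
  | algebraMap r => exact (Algebra.commutes r v).symm
  | ι x => exact hv x
  | mul a b ha hb => rw [← mul_assoc, ha, mul_assoc, hb, mul_assoc]
  | add a b ha hb => rw [mul_add, ha, hb, add_mul]

theorem volume_mul' {K : Type*} [AddCommGroup K] [Module ℂ K] {Q : QuadraticForm ℂ K}
    {v : CliffordAlgebra Q} (hv : ∀ x, v * CliffordAlgebra.ι Q x = -(CliffordAlgebra.ι Q x * v))
    (y : CliffordAlgebra Q) : v * y = CliffordAlgebra.involute y * v := by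
  induction y using CliffordAlgebra.induction with
  | algebraMap r => rw [AlgHom.commutes]; exact (Algebra.commutes r v).symm
  | ι x => rw [hv, CliffordAlgebra.involute_ι, neg_mul]
  | mul a b ha hb => rw [← mul_assoc, ha, mul_assoc, hb, map_mul, mul_assoc]
  | add a b ha hb => rw [mul_add, ha, hb, map_add, add_mul]

/-! ### The spin cover of the Weyl group -/

section Form

variable {N : Type*} [NormedAddCommGroup N] [InnerProductSpace ℝ N]

theorem complexForm_tmul (r s : ℂ) (x y : N) :
    complexForm N (r ⊗ₜ x) (s ⊗ₜ y) = r * s * (inner ℝ x y : ℝ) := by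
  rw [complexForm, LinearMap.BilinForm.baseChange_tmul]
  simp [innerₗ_apply_apply, mul_comm]

theorem complexForm_comm (v w : ℂ ⊗[ℝ] N) : complexForm N v w = complexForm N w v := by
  induction v using TensorProduct.induction_on with
  | zero => simp
  | add x y hx hy => rw [map_add, LinearMap.add_apply, hx, hy, map_add]
  | tmul r x =>
    induction w using TensorProduct.induction_on with
    | zero => simp
    | add x y hx hy => rw [map_add, hx, hy, map_add, LinearMap.add_apply]
    | tmul s y => rw [complexForm_tmul, complexForm_tmul, real_inner_comm, mul_comm r]

theorem cliff_ι_mul_ι_add (v w : ℂ ⊗[ℝ] N) :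
    CliffordAlgebra.ι (negForm N) v * CliffordAlgebra.ι (negForm N) w +
      CliffordAlgebra.ι (negForm N) w * CliffordAlgebra.ι (negForm N) v =
        -((2 * complexForm N v w) • (1 : Cliff N)) := by
  rw [CliffordAlgebra.ι_mul_ι_add_swap, ← neg_smul, ← Algebra.algebraMap_eq_smul_one]
  congr 1
  simp only [negForm, LinearMap.BilinMap.polar_toQuadraticMap, LinearMap.neg_apply]
  rw [complexForm_comm w v]
  ring

theorem cliff_ι_mul_self (v : ℂ ⊗[ℝ] N) :
    CliffordAlgebra.ι (negForm N) v * CliffordAlgebra.ι (negForm N) v =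
        -(complexForm N v v • (1 : Cliff N)) := by
  rw [CliffordAlgebra.ι_sq_scalar, ← neg_smul, ← Algebra.algebraMap_eq_smul_one]
  congr 1

variable (N) in
/-- The complexification of an orthonormal basis of `V₀^∨`. -/
def onb [FiniteDimensional ℝ N] : Module.Basis (Fin (Module.finrank ℝ N)) ℂ (ℂ ⊗[ℝ] N) :=
  (stdOrthonormalBasis ℝ N).toBasis.baseChange ℂ

variable [FiniteDimensional ℝ N]

theorem complexForm_onb (i j : Fin (Module.finrank ℝ N)) :
    complexForm N (onb N i) (onb N j) = if i = j then 1 else 0 := by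
  have h := orthonormal_iff_ite.mp (stdOrthonormalBasis ℝ N).orthonormal i j
  rw [onb, Module.Basis.baseChange_apply, Module.Basis.baseChange_apply, complexForm_tmul,
    OrthonormalBasis.coe_toBasis, h]
  split_ifs <;> simp

variable (N) in
theorem onb_orthonormal : IsCliffordOrthonormal (negForm N) (onb N) where
  sq i := by rw [cliff_ι_mul_self, complexForm_onb, if_pos rfl, one_smul]
  anti i j h := by
    rw [eq_neg_iff_add_eq_zero, cliff_ι_mul_ι_add, complexForm_onb, if_neg h, mul_zero, zero_smul,
      neg_zero]

end Form

section Spin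

variable {ι V N : Type*} [Fintype ι] [AddCommGroup V] [Module ℝ V]
  [NormedAddCommGroup N] [InnerProductSpace ℝ N] {P : RootPairing ι ℝ V N}

theorem rootFun_mul_norm
    (hinv : ∀ (i : ι) (x y : N),
      inner ℝ (P.coreflection i x) (P.coreflection i y) = inner ℝ x y) (i : ι)
    (v : ℂ ⊗[ℝ] N) :
    rootFun P i v * ((‖P.coroot i‖ : ℂ) * ‖P.coroot i‖) =
      2 * complexForm N ((1 : ℂ) ⊗ₜ P.coroot i) v := by
  induction v using TensorProduct.induction_on with
  | zero => simp
  | add x y hx hy => rw [map_add, map_add, add_mul, hx, hy, mul_add]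
  | tmul r x =>
    have h := root'_mul_inner_coroot hinv i x
    rw [real_inner_self_eq_norm_mul_norm] at h
    rw [rootFun_tmul, complexForm_tmul, one_mul, mul_left_comm 2 r, mul_assoc]
    congr 1
    exact_mod_cast h

theorem norm_coroot_ne_zero (i : ι) : (‖P.coroot i‖ : ℂ) ≠ 0 := by
  rw [Complex.ofReal_ne_zero, norm_ne_zero_iff]
  exact P.ne_zero' i

/-- The unit vector in the direction of the coroot `α^∨`. -/
def unitCoroot (P : RootPairing ι ℝ V N) (i : ι) : ℂ ⊗[ℝ] N :=
  (‖P.coroot i‖ : ℂ)⁻¹ • ((1 : ℂ) ⊗ₜ P.coroot i)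

theorem complexForm_unitCoroot
    (hinv : ∀ (i : ι) (x y : N),
      inner ℝ (P.coreflection i x) (P.coreflection i y) = inner ℝ x y) (i : ι)
    (v : ℂ ⊗[ℝ] N) :
    2 * complexForm N (unitCoroot P i) v = ‖P.coroot i‖ * rootFun P i v := by
  have h := rootFun_mul_norm hinv i v
  have h0 := norm_coroot_ne_zero (P := P) i
  rw [unitCoroot, map_smul, LinearMap.smul_apply, smul_eq_mul, mul_left_comm, ← h]
  field_simp

theorem complexForm_unitCoroot_self (i : ι) :
    complexForm N (unitCoroot P i) (unitCoroot P i) = 1 := by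
  have h0 := norm_coroot_ne_zero (P := P) i
  rw [unitCoroot, map_smul, map_smul, LinearMap.smul_apply, complexForm_tmul,
    real_inner_self_eq_norm_mul_norm]
  simp only [smul_eq_mul, Complex.ofReal_mul]
  field_simp

theorem cliff_unitCoroot_sq (i : ι) :
    CliffordAlgebra.ι (negForm N) (unitCoroot P i) * CliffordAlgebra.ι (negForm N) (unitCoroot P i)
      = -1 := by
  rw [cliff_ι_mul_self, complexForm_unitCoroot_self, one_smul]

theorem act_weylRefl_eq (i : ι) (v : ℂ ⊗[ℝ] N) :
    act P (weylRefl P i) v =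
      v - ((‖P.coroot i‖ : ℂ) * rootFun P i v) • unitCoroot P i := by
  have h0 := norm_coroot_ne_zero (P := P) i
  rw [act_weylRefl, unitCoroot, smul_smul]
  congr 2
  field_simp

/-- The lift to the spin cover of the reflection `s_α`, given by the normalized coroot. -/
def spinRefl (hinv : ∀ (i : ι) (x y : N),
      inner ℝ (P.coreflection i x) (P.coreflection i y) = inner ℝ x y) (i : ι) : spinCover P :=
  ⟨(⟨CliffordAlgebra.ι (negForm N) (unitCoroot P i), by
      rw [Unitary.mem_iff, CliffordAlgebra.star_ι, neg_mul, mul_neg, cliff_unitCoroot_sq]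
      simp⟩, weylRefl P i), by
    intro v
    change CliffordAlgebra.involute (CliffordAlgebra.ι (negForm N) (unitCoroot P i)) *
        CliffordAlgebra.ι (negForm N) v =
      CliffordAlgebra.ι (negForm N) (act P (weylRefl P i) v) *
        CliffordAlgebra.ι (negForm N) (unitCoroot P i)
    have h := cliff_ι_mul_ι_add (unitCoroot P i) v
    rw [complexForm_unitCoroot hinv] at h
    rw [CliffordAlgebra.involute_ι, act_weylRefl_eq, map_sub, map_smul, sub_mul, smul_mul_assoc,
      cliff_unitCoroot_sq, smul_neg, ← h, neg_mul]
    abel⟩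

variable [P.IsRootSystem] [P.IsReduced]

theorem finiteDimensional_of_isRootSystem (P : RootPairing ι ℝ V N) [P.IsRootSystem] :
    FiniteDimensional ℝ N := by
  refine ⟨⟨(Set.finite_range P.coroot).toFinset, ?_⟩⟩
  rw [Set.Finite.coe_toFinset]
  exact RootPairing.IsRootSystem.span_coroot_eq_top

/-- Every element of the Weyl group lifts to the spin cover. -/
theorem exists_lift (S : SimpleSystem P) (hinv : ∀ (i : ι) (x y : N),
      inner ℝ (P.coreflection i x) (P.coreflection i y) = inner ℝ x y) (w : weylGroup P) :
    ∃ x : spinCover P, x.1.2 = w := by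
  induction w using S.weyl_induction hinv with
  | one => exact ⟨1, rfl⟩
  | mul a ha w ih =>
    obtain ⟨x, rfl⟩ := ih
    exact ⟨spinRefl hinv a * x, rfl⟩

/-- The kernel of the spin cover is `{±1}`. -/
theorem eq_one_or_minusOne (x : spinCover P) (hx : x.1.2 = 1) : x = 1 ∨ x = minusOne P := by
  have := finiteDimensional_of_isRootSystem P
  obtain ⟨r, hr⟩ := exists_algebraMap_of_ctr (onb_orthonormal N) (x.1.1 : Cliff N) (by
    intro i
    have h := x.2 (onb N i)
    rw [hx, act_one] at h
    rw [ctr_apply, h, sub_self, smul_zero])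
  have h1 : star (x.1.1 : Cliff N) * (x.1.1 : Cliff N) = 1 := Unitary.coe_star_mul_self x.1.1
  rw [hr, CliffordAlgebra.star_algebraMap, ← map_mul, ← map_one (algebraMap ℂ (Cliff N))] at h1
  have h2 : r * r = 1 := (algebraMap ℂ (Cliff N)).injective h1
  rcases mul_self_eq_one_iff.mp h2 with rfl | rfl
  · left
    refine Subtype.ext (Prod.ext (Subtype.ext ?_) hx)
    rw [hr, map_one]
    rfl
  · right
    refine Subtype.ext (Prod.ext (Subtype.ext ?_) hx)
    rw [hr, map_neg, map_one]
    rfl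

theorem eq_or_eq_minusOne_mul {x y : spinCover P} (h : x.1.2 = y.1.2) :
    x = y ∨ x = minusOne P * y := by
  have h1 : (x * y⁻¹).1.2 = 1 := by
    change x.1.2 * (y.1.2)⁻¹ = 1
    rw [h, mul_inv_cancel]
  rcases eq_one_or_minusOne _ h1 with h2 | h2
  · left; exact mul_inv_eq_one.mp h2
  · right; rw [← h2, inv_mul_cancel_right]

theorem spinCover_finite (S : SimpleSystem P) (hinv : ∀ (i : ι) (x y : N),
      inner ℝ (P.coreflection i x) (P.coreflection i y) = inner ℝ x y) :
    Finite (spinCover P) := by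
  choose l hl using exists_lift S hinv
  let f : Bool × weylGroup P → spinCover P :=
    fun p => if p.1 then l p.2 else minusOne P * l p.2
  refine Finite.of_surjective f fun x => ?_
  rcases eq_or_eq_minusOne_mul (hl x.1.2).symm with h | h
  · exact ⟨(true, x.1.2), h.symm⟩
  · exact ⟨(false, x.1.2), h.symm⟩

/-- The restriction to the spin cover of the parity automorphism of the Clifford algebra. -/
def spinInvolute (x : spinCover P) : spinCover P :=
  ⟨(⟨CliffordAlgebra.involute (x.1.1 : Cliff N), by
      have h1 : star (x.1.1 : Cliff N) * (x.1.1 : Cliff N) = 1 := Unitary.coe_star_mul_self x.1.1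
      have h2 : (x.1.1 : Cliff N) * star (x.1.1 : Cliff N) = 1 := Unitary.coe_mul_star_self x.1.1
      have h3 : ∀ y : Cliff N, star (CliffordAlgebra.involute y) =
          CliffordAlgebra.involute (star y) := fun y => by
        rw [CliffordAlgebra.star_def, CliffordAlgebra.star_def, CliffordAlgebra.reverse_involute]
      rw [Unitary.mem_iff, h3, ← map_mul, ← map_mul, h1, h2, map_one]
      exact ⟨rfl, rfl⟩⟩, x.1.2), by
    intro v
    have h := congrArg CliffordAlgebra.involute (x.2 v)
    rw [map_mul, map_mul, CliffordAlgebra.involute_ι, CliffordAlgebra.involute_ι, mul_neg, neg_mul,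
      neg_inj] at h
    exact h⟩

end Spin

/-! ### Dual bases and invariance of the complexified inner product -/

section Dual

variable {N : Type*} [NormedAddCommGroup N] [InnerProductSpace ℝ N] [FiniteDimensional ℝ N]

theorem onb_repr (v : ℂ ⊗[ℝ] N) (i : Fin (Module.finrank ℝ N)) :
    (onb N).repr v i = complexForm N (onb N i) v := by
  conv_rhs => rw [← (onb N).sum_repr v]
  rw [map_sum, Finset.sum_eq_single i]
  · rw [map_smul, complexForm_onb, if_pos rfl, smul_eq_mul, mul_one]
  · intro j _ hj
    rw [map_smul, complexForm_onb, if_neg (Ne.symm hj), smul_zero]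
  · intro h; exact absurd (Finset.mem_univ i) h

theorem sum_complexForm_smul (v : ℂ ⊗[ℝ] N) : ∑ i, complexForm N (onb N i) v • onb N i = v := by
  conv_rhs => rw [← (onb N).sum_repr v]
  exact Finset.sum_congr rfl fun i _ => by rw [onb_repr]

/-- The canonical tensor `∑ ω_i ⊗ ω^i` does not depend on the dual bases. -/
theorem sum_dual_basis {M : Type*} [AddCommMonoid M] [Module ℂ M]
    (F : (ℂ ⊗[ℝ] N) →ₗ[ℂ] (ℂ ⊗[ℝ] N) →ₗ[ℂ] M) {κ : Type*} [Fintype κ] [DecidableEq κ]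
    (b : Module.Basis κ ℂ (ℂ ⊗[ℝ] N)) (b' : κ → ℂ ⊗[ℝ] N)
    (hb : ∀ i j, complexForm N (b i) (b' j) = if i = j then 1 else 0) :
    ∑ i, F (b i) (b' i) = ∑ i, F (onb N i) (onb N i) := by
  have h1 : ∀ k, ∑ i, complexForm N (onb N k) (b' i) • b i = onb N k := by
    intro k
    conv_rhs => rw [← b.sum_repr (onb N k)]
    refine Finset.sum_congr rfl fun i _ => ?_
    congr 1
    conv_lhs => rw [← b.sum_repr (onb N k)]
    rw [map_sum, LinearMap.sum_apply, Finset.sum_eq_single i]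
    · rw [map_smul, LinearMap.smul_apply, hb, if_pos rfl, smul_eq_mul, mul_one]
    · intro j _ hj
      rw [map_smul, LinearMap.smul_apply, hb, if_neg hj, smul_zero]
    · intro h; exact absurd (Finset.mem_univ i) h
  calc ∑ i, F (b i) (b' i)
      = ∑ i, ∑ k, complexForm N (onb N k) (b' i) • F (b i) (onb N k) := by
        refine Finset.sum_congr rfl fun i _ => ?_
        conv_lhs => rw [← sum_complexForm_smul (b' i)]
        rw [map_sum]
        exact Finset.sum_congr rfl fun k _ => by rw [map_smul]
    _ = ∑ k, ∑ i, complexForm N (onb N k) (b' i) • F (b i) (onb N k) := Finset.sum_comm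
    _ = ∑ k, F (onb N k) (onb N k) := by
        refine Finset.sum_congr rfl fun k _ => ?_
        have h2 := congrArg (F.flip (onb N k)) (h1 k)
        rw [map_sum] at h2
        rw [← LinearMap.flip_apply F (onb N k) (onb N k), ← h2]
        exact Finset.sum_congr rfl fun i _ => by rw [map_smul, LinearMap.flip_apply]

end Dual

section DualWeyl

variable {ι V N : Type*} [AddCommGroup V] [Module ℝ V]
  [NormedAddCommGroup N] [InnerProductSpace ℝ N] {P : RootPairing ι ℝ V N}

theorem complexForm_act
    (hinv : ∀ (i : ι) (x y : N),
      inner ℝ (P.coreflection i x) (P.coreflection i y) = inner ℝ x y) (w : weylGroup P)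
    (v v' : ℂ ⊗[ℝ] N) : complexForm N (act P w v) (act P w v') = complexForm N v v' := by
  have h : ∀ x y : N, (inner ℝ ((w : N ≃ₗ[ℝ] N) x) ((w : N ≃ₗ[ℝ] N) y) : ℝ) = inner ℝ x y := by
    obtain ⟨w, hw⟩ := w
    induction hw using Subgroup.closure_induction with
    | mem x hx => obtain ⟨i, rfl⟩ := hx; exact hinv i
    | one => intro x y; rfl
    | mul x y _ _ hx hy => intro u u'; exact (hx _ _).trans (hy _ _)
    | inv x _ hx =>
      intro u u'
      have := hx (x.symm u) (x.symm u')
      change (inner ℝ (x (x.symm u)) (x (x.symm u')) : ℝ) = _ at this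
      rw [x.apply_symm_apply, x.apply_symm_apply] at this
      exact this.symm
  induction v using TensorProduct.induction_on with
  | zero => simp
  | add x y hx hy => rw [map_add, map_add, map_add, LinearMap.add_apply,
      LinearMap.add_apply, hx, hy]
  | tmul r x =>
    induction v' using TensorProduct.induction_on with
    | zero => simp
    | add x y hx hy => rw [map_add, map_add, map_add, hx, hy]
    | tmul s y => rw [act_tmul, act_tmul, complexForm_tmul, complexForm_tmul, h]

variable [FiniteDimensional ℝ N]

/-- The canonical tensor `∑ ω_i ⊗ ω^i` is invariant under the Weyl group. -/
theorem sum_onb_act (hinv : ∀ (i : ι) (x y : N),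
      inner ℝ (P.coreflection i x) (P.coreflection i y) = inner ℝ x y)
    {M : Type*} [AddCommMonoid M] [Module ℂ M]
    (F : (ℂ ⊗[ℝ] N) →ₗ[ℂ] (ℂ ⊗[ℝ] N) →ₗ[ℂ] M) (w : weylGroup P) :
    ∑ i, F (act P w (onb N i)) (act P w (onb N i)) = ∑ i, F (onb N i) (onb N i) := by
  let E : (ℂ ⊗[ℝ] N) ≃ₗ[ℂ] (ℂ ⊗[ℝ] N) := LinearEquiv.ofLinearMap (act P w) (act P w⁻¹)
    (LinearMap.ext fun v => act_act_inv P w v) (LinearMap.ext fun v => act_inv_act P w v)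
  have h := sum_dual_basis F ((onb N).map E) (fun i => act P w (onb N i)) (by
    intro i j
    rw [Module.Basis.map_apply]
    change complexForm N (act P w (onb N i)) _ = _
    rw [complexForm_act hinv, complexForm_onb])
  rw [← h]
  exact Finset.sum_congr rfl fun i _ => by rw [Module.Basis.map_apply]; rfl

theorem sum_rootFun_smul [Fintype ι] (hinv : ∀ (i : ι) (x y : N),
      inner ℝ (P.coreflection i x) (P.coreflection i y) = inner ℝ x y) (i : ι) :
    ∑ k, rootFun P i (onb N k) • onb N k = (2 / ‖P.coroot i‖ : ℂ) • unitCoroot P i := by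
  have h0 := norm_coroot_ne_zero (P := P) i
  conv_rhs => rw [← sum_complexForm_smul (unitCoroot P i)]
  rw [Finset.smul_sum]
  refine Finset.sum_congr rfl fun k _ => ?_
  rw [smul_smul]
  congr 1
  have h := complexForm_unitCoroot hinv i (onb N k)
  rw [complexForm_comm] at h
  rw [div_mul_eq_mul_div, h, mul_div_cancel_left₀ _ h0]

theorem act_weylRefl_unitCoroot (i : ι) :
    act P (weylRefl P i) (unitCoroot P i) = -unitCoroot P i := by
  rw [act_weylRefl, unitCoroot, map_smul, rootFun_coroot_self]
  module

end DualWeyl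

/-! ### Equivariance of the shifted generators and of the Dirac element -/

section Shift

variable {ι V N : Type*} [Fintype ι] [AddCommGroup V] [Module ℝ V]
  [NormedAddCommGroup N] [InnerProductSpace ℝ N]
  {P : RootPairing ι ℝ V N} (S : SimpleSystem P) (c : ι → ℝ)

/-- The map `ω ↦ ω̃`, as a linear map. -/
def tildeVₗ : (ℂ ⊗[ℝ] N) →ₗ[ℂ] Hecke P S c where
  toFun := tildeV P S c
  map_add' v w := by
    simp only [tildeV, tV_add, map_add, mul_add, add_smul, Finset.sum_add_distrib, smul_add]
    abel
  map_smul' r v := by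
    rw [RingHom.id_apply, tildeV, tildeV, tV_smul, smul_sub, smul_comm r (1 / 2 : ℂ),
      Finset.smul_sum (r := r)]
    congr 2
    refine Finset.sum_congr rfl fun β _ => ?_
    rw [map_smul, smul_smul, smul_eq_mul]
    congr 1; ring

variable {S} {c}

/-- For a simple reflection `s_α`, the term of `ω̃` at `α` absorbs the scalar `c_α (α, ω)` of the
cross relation. -/
theorem tW_mul_tildeV_simple [P.IsReduced] (hc : ∀ i j : ι, c (P.reflectionPerm i j) = c j)
    {a : ι} (ha : a ∈ S.simple) (v : ℂ ⊗[ℝ] N) :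
    tW P S c (weylRefl P a) * tildeV P S c v =
      tildeV P S c (act P (weylRefl P a) v) * tW P S c (weylRefl P a) := by
  classical
  have h1 := tV_mul_tW_simple (S := S) c ha (act P (weylRefl P a) v)
  rw [← act_mul, weylRefl_mul_self, act_one, rootFun_act_self] at h1
  -- The simple reflection permutes the positive roots other than `α`.
  have h2 : ∑ β : ι with S.IsPos β, ((c β : ℂ) * rootFun P β v) •
        (tW P S c (weylRefl P a) * tW P S c (weylRefl P β)) =
      ∑ β : ι with S.IsPos β, ((c β : ℂ) * rootFun P β (act P (weylRefl P a) v)) •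
        (tW P S c (weylRefl P β) * tW P S c (weylRefl P a)) +
      (2 * ((c a : ℂ) * rootFun P a v)) • (1 : Hecke P S c) := by
    have hmem : a ∈ Finset.univ.filter S.IsPos := by simpa using S.isPos_of_mem ha
    rw [← Finset.add_sum_erase _ _ hmem, ← Finset.add_sum_erase _ _ hmem, ← map_mul,
      weylRefl_mul_self, map_one, rootFun_act_self]
    have h3 : ∑ β ∈ (Finset.univ.filter S.IsPos).erase a, ((c β : ℂ) * rootFun P β v) •
          (tW P S c (weylRefl P a) * tW P S c (weylRefl P β)) =
        ∑ β ∈ (Finset.univ.filter S.IsPos).erase a,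
          ((c β : ℂ) * rootFun P β (act P (weylRefl P a) v)) •
          (tW P S c (weylRefl P β) * tW P S c (weylRefl P a)) := by
      have hinvol : ∀ β, P.reflectionPerm a (P.reflectionPerm a β) = β :=
        fun β => P.reflectionPerm_involutive a β
      have hmaps : ∀ β ∈ (Finset.univ.filter S.IsPos).erase a,
          P.reflectionPerm a β ∈ (Finset.univ.filter S.IsPos).erase a := by
        intro β hβ
        simp only [Finset.mem_erase, Finset.mem_filter, Finset.mem_univ, true_and] at hβ ⊢
        refine ⟨fun h => ?_, S.isPos_reflectionPerm ha hβ.2 hβ.1⟩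
        have h4 := hinvol β
        rw [h] at h4
        have h5 := (S.isPos_reflectionPerm_self_iff a).mp (by rw [h4]; exact hβ.2)
        exact h5 (S.isPos_of_mem ha)
      refine Finset.sum_nbij' (P.reflectionPerm a) (P.reflectionPerm a) hmaps hmaps
        (fun β _ => hinvol β) (fun β _ => hinvol β) fun β _ => ?_
      rw [hc, rootFun_reflectionPerm, ← act_mul, weylRefl_mul_self, act_one,
        weylRefl_reflectionPerm, ← map_mul, ← map_mul, mul_assoc, weylRefl_mul_self, mul_one]
    rw [h3]
    module
  simp only [tildeV, mul_sub, sub_mul, mul_smul_comm, smul_mul_assoc, Finset.mul_sum,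
    Finset.sum_mul]
  rw [h1, h2]
  module

/-- Unlike the generators `ω`, the shifted ones `ω̃` are permuted by conjugation with `t_w`. -/
theorem tW_mul_tildeV [P.IsReduced] (hinv : ∀ (i : ι) (x y : N),
      inner ℝ (P.coreflection i x) (P.coreflection i y) = inner ℝ x y)
    (hc : ∀ i j : ι, c (P.reflectionPerm i j) = c j) (w : weylGroup P) (v : ℂ ⊗[ℝ] N) :
    tW P S c w * tildeV P S c v = tildeV P S c (act P w v) * tW P S c w := by
  induction w using S.weyl_induction hinv generalizing v with
  | one => rw [map_one, one_mul, act_one, mul_one]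
  | mul a ha w ih =>
    rw [map_mul, mul_assoc, ih, ← mul_assoc, tW_mul_tildeV_simple hc ha, mul_assoc, act_mul]

end Shift

/-! ### The Dirac element and its square -/

section Dirac

variable {ι V N : Type*} [Fintype ι] [AddCommGroup V] [Module ℝ V]
  [NormedAddCommGroup N] [InnerProductSpace ℝ N]
  {P : RootPairing ι ℝ V N} (S : SimpleSystem P) (c : ι → ℝ)

/-- The algebra `H ⊗ C(V^∨)`. A definition rather than an abbreviation, so that its ring structure
is found directly and not through the tensor product and the quotient presenting `H`. -/
def HeckeCliff : Type _ := Hecke P S c ⊗[ℂ] Cliff N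

/-- The ring structure of `H ⊗ C(V^∨)`, deliberately not reducible, so that unification does not
unfold it. -/
def heckeCliffRing : Ring (HeckeCliff S c) :=
  (Algebra.TensorProduct.instRing : Ring (Hecke P S c ⊗[ℂ] Cliff N))

instance : Ring (HeckeCliff S c) := heckeCliffRing S c

/-- The algebra structure of `H ⊗ C(V^∨)`, deliberately not reducible. -/
def heckeCliffAlgebra : Algebra ℂ (HeckeCliff S c) :=
  (Algebra.TensorProduct.leftAlgebra : Algebra ℂ (Hecke P S c ⊗[ℂ] Cliff N))

instance : Algebra ℂ (HeckeCliff S c) := heckeCliffAlgebra S c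

/-- The pure tensors of `H ⊗ C(V^∨)`. -/
def pureTensor : Hecke P S c →ₗ[ℂ] Cliff N →ₗ[ℂ] HeckeCliff S c := TensorProduct.mk ℂ _ _

/-- The parity automorphism of `H ⊗ C(V^∨)`. -/
def parity : HeckeCliff S c →ₐ[ℂ] HeckeCliff S c :=
  (Algebra.TensorProduct.map (AlgHom.id ℂ _) CliffordAlgebra.involute :
    Hecke P S c ⊗[ℂ] Cliff N →ₐ[ℂ] Hecke P S c ⊗[ℂ] Cliff N)

/-- The diagonal map `ρ`, with values in `HeckeCliff`. -/
def diagHom : SpinAlg P →ₐ[ℂ] HeckeCliff S c := rho P S c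

/-- The map `w̃ ↦ t_{p(w̃)} ⊗ w̃` on the group `W̃`. -/
def spinHom : spinCover P →* HeckeCliff S c :=
  (diagHom S c : SpinAlg P →* HeckeCliff S c).comp (MonoidAlgebra.of ℂ (spinCover P))

/-- The algebra map `S(V^∨) ⊗ C(V^∨) → H ⊗ C(V^∨)`. -/
def symHom : Sym N ⊗[ℂ] Cliff N →ₐ[ℂ] HeckeCliff S c :=
  (Algebra.TensorProduct.map (tS P S c) (AlgHom.id ℂ _) :
    Sym N ⊗[ℂ] Cliff N →ₐ[ℂ] Hecke P S c ⊗[ℂ] Cliff N)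

/-- The Dirac element formed with an orthonormal basis. -/
def diracElt [FiniteDimensional ℝ N] : HeckeCliff S c :=
  ∑ i, pureTensor S c (tildeV P S c (onb N i)) (CliffordAlgebra.ι (negForm N) (onb N i))

variable {S} {c}

theorem pureTensor_mul (h h' : Hecke P S c) (a a' : Cliff N) :
    pureTensor S c h a * pureTensor S c h' a' = pureTensor S c (h * h') (a * a') :=
  Algebra.TensorProduct.tmul_mul_tmul h h' a a'

theorem pureTensor_one : pureTensor S c 1 1 = 1 := rfl

theorem heckeCliff_induction {p : HeckeCliff S c → Prop} (zero : p 0)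
    (tmul : ∀ h a, p (pureTensor S c h a)) (add : ∀ x y, p x → p y → p (x + y))
    (x : HeckeCliff S c) : p x :=
  TensorProduct.induction_on (R := ℂ) (M := Hecke P S c) (N := Cliff N) (motive := p) x zero
    tmul add

theorem parity_tmul (h : Hecke P S c) (a : Cliff N) :
    parity S c (pureTensor S c h a) = pureTensor S c h (CliffordAlgebra.involute a) := rfl

theorem symHom_tmul (g : Sym N) (a : Cliff N) :
    symHom S c (g ⊗ₜ a) = pureTensor S c (tS P S c g) a := rfl

theorem diagHom_of (x : spinCover P) :
    diagHom S c (MonoidAlgebra.of ℂ _ x) = spinHom S c x := rfl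

theorem spinHom_apply (x : spinCover P) :
    spinHom S c x = pureTensor S c (tW P S c x.1.2) (x.1.1 : Cliff N) := by
  change rho P S c (MonoidAlgebra.of ℂ _ x) = _
  rw [rho, MonoidAlgebra.lift_of]
  rfl

theorem parity_parity (x : HeckeCliff S c) : parity S c (parity S c x) = x := by
  induction x using heckeCliff_induction with
  | zero => rw [map_zero, map_zero]
  | add x y hx hy => rw [map_add, map_add, hx, hy]
  | tmul h a => rw [parity_tmul, parity_tmul, CliffordAlgebra.involute_involute]

theorem parity_spinHom (x : spinCover P) :
    parity S c (spinHom S c x) = spinHom S c (spinInvolute x) := by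
  rw [spinHom_apply, spinHom_apply, parity_tmul]
  rfl

theorem parity_symHom (x : Sym N ⊗[ℂ] Cliff N) :
    parity S c (symHom S c x) = symHom S c (symEps _ (negForm N) x) := by
  induction x using TensorProduct.induction_on with
  | zero => simp only [map_zero]
  | add x y hx hy => rw [map_add, map_add, map_add, map_add, hx, hy]
  | tmul h a => rfl

theorem spinHom_minusOne : spinHom S c (minusOne P) = -1 := by
  rw [spinHom_apply]
  change pureTensor S c (tW P S c 1) (-1 : Cliff N) = -1
  rw [map_one, map_neg, pureTensor_one]

variable [FiniteDimensional ℝ N]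

/-- The Dirac element does not depend on the dual bases. -/
theorem dirac_eq {κ : Type*} [Fintype κ] [DecidableEq κ] (b b' : Module.Basis κ ℂ (ℂ ⊗[ℝ] N))
    (hb : ∀ i j : κ, complexForm N (b i) (b' j) = if i = j then 1 else 0) :
    dirac P S c b b' = diracElt S c :=
  sum_dual_basis ((pureTensor S c).compl₁₂ (tildeVₗ S c)
    (CliffordAlgebra.ι (negForm N))) b b' hb

theorem parity_dirac : parity S c (diracElt S c) = -diracElt S c := by
  rw [diracElt, map_sum, ← Finset.sum_neg_distrib]
  refine Finset.sum_congr rfl fun i _ => ?_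
  rw [parity_tmul, CliffordAlgebra.involute_ι, map_neg]

/-- The Dirac element intertwines the image of the spin cover with its parity twist. -/
theorem dirac_mul_spinHom [P.IsReduced] (hinv : ∀ (i : ι) (x y : N),
      inner ℝ (P.coreflection i x) (P.coreflection i y) = inner ℝ x y)
    (hc : ∀ i j : ι, c (P.reflectionPerm i j) = c j) (x : spinCover P) :
    diracElt S c * spinHom S c x = parity S c (spinHom S c x) * diracElt S c := by
  have h := sum_onb_act (P := P) hinv
    ((pureTensor S c).compl₁₂ (tildeVₗ S c)
      (CliffordAlgebra.ι (negForm N))) x.1.2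
  have h2 : diracElt S c = ∑ i, pureTensor S c (tildeV P S c (act P x.1.2 (onb N i)))
      (CliffordAlgebra.ι (negForm N) (act P x.1.2 (onb N i))) := h.symm
  conv_lhs => rw [h2]
  rw [diracElt, Finset.sum_mul, Finset.mul_sum]
  refine Finset.sum_congr rfl fun i _ => ?_
  rw [spinHom_apply, parity_tmul, pureTensor_mul, pureTensor_mul, tW_mul_tildeV hinv hc,
    ← x.2 (onb N i)]

open Classical in
variable (S) (c) in
/-- The part of the Dirac element of degree zero, up to sign: a combination of the lifts of the
reflections. -/
def reflSum (hinv : ∀ (i : ι) (x y : N),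
      inner ℝ (P.coreflection i x) (P.coreflection i y) = inner ℝ x y) : SpinAlg P :=
  ∑ β : ι with S.IsPos β,
    ((c β : ℂ) / ‖P.coroot β‖) • MonoidAlgebra.of ℂ (spinCover P) (spinRefl hinv β)

/-- The Dirac element is its symbol minus a combination of the lifts of the reflections, since
`∑ (β, ω_i) ω^i` is a multiple of the unit coroot of `β`. -/
theorem dirac_eq_sub (hinv : ∀ (i : ι) (x y : N),
      inner ℝ (P.coreflection i x) (P.coreflection i y) = inner ℝ x y) :
    diracElt S c = symHom S c (symDirac (negForm N) (onb N)) - diagHom S c (reflSum S c hinv) := by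
  classical
  have h : diagHom S c (reflSum S c hinv) = ∑ i,
      pureTensor S c ((1 / 2 : ℂ) • ∑ β : ι with S.IsPos β, ((c β : ℂ) * rootFun P β (onb N i)) •
        tW P S c (weylRefl P β)) (CliffordAlgebra.ι (negForm N) (onb N i)) := by
    simp only [reflSum, map_sum, map_smul, diagHom_of, Finset.smul_sum, LinearMap.sum_apply]
    rw [Finset.sum_comm]
    refine Finset.sum_congr rfl fun β _ => ?_
    have h1 := congrArg (CliffordAlgebra.ι (negForm N)) (sum_rootFun_smul hinv β)
    rw [map_sum, map_smul] at h1
    have h2 : (c β : ℂ) / ‖P.coroot β‖ = (1 / 2 * c β) * (2 / ‖P.coroot β‖) := by ring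
    have h3 : spinHom S c (spinRefl hinv β) = pureTensor S c (tW P S c (weylRefl P β))
      (CliffordAlgebra.ι (negForm N) (unitCoroot P β)) := spinHom_apply _
    rw [h3, h2, mul_smul, ← map_smul, ← h1, map_sum, Finset.smul_sum]
    refine Finset.sum_congr rfl fun i _ => ?_
    rw [map_smul, map_smul, smul_smul, LinearMap.smul_apply, LinearMap.smul_apply, smul_smul]
    congr 1
    ring
  rw [h, diracElt, symDirac, map_sum, ← Finset.sum_sub_distrib]
  refine Finset.sum_congr rfl fun i _ => ?_
  rw [symHom_tmul, tS_ι, ← LinearMap.sub_apply, ← map_sub, tildeV]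

theorem parity_reflSum (hinv : ∀ (i : ι) (x y : N),
      inner ℝ (P.coreflection i x) (P.coreflection i y) = inner ℝ x y) :
    parity S c (diagHom S c (reflSum S c hinv)) = -diagHom S c (reflSum S c hinv) := by
  simp only [reflSum, map_sum, map_smul, diagHom_of]
  rw [← Finset.sum_neg_distrib]
  refine Finset.sum_congr rfl fun β _ => ?_
  rw [← smul_neg]
  congr 1
  rw [spinHom_apply, parity_tmul, ← map_neg]
  congr 1
  exact CliffordAlgebra.involute_ι _

theorem dirac_mul_rho [P.IsReduced] (hinv : ∀ (i : ι) (x y : N),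
      inner ℝ (P.coreflection i x) (P.coreflection i y) = inner ℝ x y)
    (hc : ∀ i j : ι, c (P.reflectionPerm i j) = c j) (ζ : SpinAlg P) :
    diracElt S c * diagHom S c ζ = parity S c (diagHom S c ζ) * diracElt S c := by
  induction ζ using MonoidAlgebra.induction_on with
  | of x => rw [diagHom_of]; exact dirac_mul_spinHom hinv hc x
  | add x y hx hy => rw [map_add, map_add, mul_add, add_mul, hx, hy]
  | smul r x hx => rw [map_smul, map_smul, mul_smul_comm, smul_mul_assoc, hx]

variable (N) in
/-- The Casimir element `∑ ω_i ω^i` of the symmetric algebra. -/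
def symCasimir : Sym N := ∑ i, SymmetricAlgebra.ι ℂ _ (onb N i) * SymmetricAlgebra.ι ℂ _ (onb N i)

theorem symDirac_mul_self :
    symDirac (negForm N) (onb N) * symDirac (negForm N) (onb N) =
      -(symCasimir N ⊗ₜ[ℂ] (1 : Cliff N)) := by
  have he := onb_orthonormal N
  have h1 : symDirac (negForm N) (onb N) * symDirac (negForm N) (onb N) = ∑ i, ∑ j,
      (SymmetricAlgebra.ι ℂ (ℂ ⊗[ℝ] N) (onb N i) * SymmetricAlgebra.ι ℂ (ℂ ⊗[ℝ] N) (onb N j)) ⊗ₜ[ℂ]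
      (CliffordAlgebra.ι (negForm N) (onb N i) * CliffordAlgebra.ι (negForm N) (onb N j)) := by
    rw [symDirac, Finset.sum_mul_sum]
    simp only [Algebra.TensorProduct.tmul_mul_tmul]
  have h2 : (2 : ℂ) • (symDirac (negForm N) (onb N) * symDirac (negForm N) (onb N)) =
      (2 : ℂ) • -(symCasimir N ⊗ₜ[ℂ] (1 : Cliff N)) := by
    rw [two_smul]
    conv_lhs => enter [2]; rw [h1, Finset.sum_comm]
    rw [h1, ← Finset.sum_add_distrib, symCasimir, TensorProduct.sum_tmul,
      ← Finset.sum_neg_distrib, Finset.smul_sum]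
    refine Finset.sum_congr rfl fun i _ => ?_
    rw [← Finset.sum_add_distrib, Finset.sum_eq_single i]
    · rw [he.sq, TensorProduct.tmul_neg, two_smul]
    · intro j _ hj
      rw [mul_comm (SymmetricAlgebra.ι ℂ (ℂ ⊗[ℝ] N) (onb N j)), ← TensorProduct.tmul_add,
        he.anti i j (Ne.symm hj), neg_add_cancel, TensorProduct.tmul_zero]
    · intro h; exact absurd (Finset.mem_univ i) h
  exact smul_right_injective _ (two_ne_zero' ℂ) h2

/-- The square of the Dirac element; the mixed terms cancel since the lifts of the reflections are
odd, and hence anticommute with it. -/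
theorem dirac_mul_self [P.IsReduced] (hinv : ∀ (i : ι) (x y : N),
      inner ℝ (P.coreflection i x) (P.coreflection i y) = inner ℝ x y)
    (hc : ∀ i j : ι, c (P.reflectionPerm i j) = c j) :
    diracElt S c * diracElt S c = -pureTensor S c (tS P S c (symCasimir N)) 1 -
      diagHom S c (reflSum S c hinv) * diagHom S c (reflSum S c hinv) := by
  have h1 := dirac_mul_rho (S := S) hinv hc (reflSum S c hinv)
  rw [parity_reflSum] at h1
  have h2 : symHom S c (symDirac (negForm N) (onb N)) = diracElt S c +
      diagHom S c (reflSum S c hinv) := by rw [dirac_eq_sub hinv, sub_add_cancel]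
  have h3 := congrArg (symHom S c) (symDirac_mul_self (N := N))
  rw [map_mul, h2, map_neg, symHom_tmul] at h3
  rw [← h3, add_mul, mul_add, mul_add, h1]
  noncomm_ring

/-- The Casimir element of the symmetric algebra is central in the Hecke algebra. -/
theorem casimir_comm [P.IsRootSystem] [P.IsReduced] (hinv : ∀ (i : ι) (x y : N),
      inner ℝ (P.coreflection i x) (P.coreflection i y) = inner ℝ x y)
    (hc : ∀ i j : ι, c (P.reflectionPerm i j) = c j) (h : Hecke P S c) :
    tS P S c (symCasimir N) * h = h * tS P S c (symCasimir N) := by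
  have hq : tS P S c (symCasimir N) = ∑ i, tV P S c (onb N i) * tV P S c (onb N i) := by
    simp only [symCasimir, map_sum, map_mul, tS_ι]
  have h1 : ∀ a ∈ S.simple, tS P S c (symCasimir N) * tW P S c (weylRefl P a) =
      tW P S c (weylRefl P a) * tS P S c (symCasimir N) := by
    intro a ha
    let F : (ℂ ⊗[ℝ] N) →ₗ[ℂ] (ℂ ⊗[ℝ] N) →ₗ[ℂ] Hecke P S c :=
      (LinearMap.mul ℂ (Hecke P S c)).compl₁₂
        ((tS P S c).toLinearMap ∘ₗ SymmetricAlgebra.ι ℂ _)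
        ((tS P S c).toLinearMap ∘ₗ SymmetricAlgebra.ι ℂ _)
    have hF : ∀ v v', F v v' = tV P S c v * tV P S c v' := fun _ _ => rfl
    have h2 := sum_onb_act hinv F (weylRefl P a)
    simp only [hF] at h2
    have h3 : ∀ v, tV P S c v * tV P S c v * tW P S c (weylRefl P a) =
        tW P S c (weylRefl P a) *
          (tV P S c (act P (weylRefl P a) v) * tV P S c (act P (weylRefl P a) v)) +
        (c a : ℂ) • (rootFun P a v • tV P S c (act P (weylRefl P a) v) +
          rootFun P a v • tV P S c v) := by
      intro v
      rw [mul_assoc, tV_mul_tW_simple c ha, mul_add, ← mul_assoc, tV_mul_tW_simple c ha, add_mul,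
        smul_mul_assoc, one_mul, mul_smul_comm, mul_one, mul_assoc, add_assoc]
      module
    have h4 : ∑ i, rootFun P a (onb N i) • tV P S c (onb N i) =
        (2 / ‖P.coroot a‖ : ℂ) • tV P S c (unitCoroot P a) := by
      have := congrArg ((tS P S c).toLinearMap ∘ₗ SymmetricAlgebra.ι ℂ _)
        (sum_rootFun_smul hinv a)
      rw [map_sum, map_smul] at this
      simp only [map_smul] at this
      exact this
    have h5 : ∑ i, rootFun P a (onb N i) • tV P S c (act P (weylRefl P a) (onb N i)) =
        -((2 / ‖P.coroot a‖ : ℂ) • tV P S c (unitCoroot P a)) := by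
      have := congrArg ((tS P S c).toLinearMap ∘ₗ SymmetricAlgebra.ι ℂ _ ∘ₗ act P (weylRefl P a))
        (sum_rootFun_smul hinv a)
      rw [map_sum, map_smul] at this
      simp only [map_smul] at this
      rw [LinearMap.comp_apply, LinearMap.comp_apply, act_weylRefl_unitCoroot,
        map_neg, map_neg, smul_neg] at this
      exact this
    rw [hq, Finset.sum_mul, Finset.sum_congr rfl fun i _ => h3 (onb N i), Finset.sum_add_distrib,
      ← Finset.mul_sum, h2, ← Finset.smul_sum, Finset.sum_add_distrib, h4, h5, neg_add_cancel,
      smul_zero, add_zero]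
  have h2 : ∀ w, tS P S c (symCasimir N) * tW P S c w = tW P S c w * tS P S c (symCasimir N) := by
    intro w
    induction w using S.weyl_induction hinv with
    | one => rw [map_one, one_mul, mul_one]
    | mul a ha w ih => rw [map_mul, ← mul_assoc, h1 a ha, mul_assoc, ih, mul_assoc]
  obtain ⟨f, rfl⟩ := (pbwEquiv c S hinv hc).surjective h
  change _ * pbwMap S c f = pbwMap S c f * _
  rw [pbwMap_apply, Finset.mul_sum, Finset.sum_mul]
  refine Finset.sum_congr rfl fun w _ => ?_
  rw [← mul_assoc, h2, mul_assoc, ← map_mul, mul_comm, map_mul, mul_assoc]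

theorem casimir_tmul_comm [P.IsRootSystem] [P.IsReduced] (hinv : ∀ (i : ι) (x y : N),
      inner ℝ (P.coreflection i x) (P.coreflection i y) = inner ℝ x y)
    (hc : ∀ i j : ι, c (P.reflectionPerm i j) = c j) (y : HeckeCliff S c) :
    pureTensor S c (tS P S c (symCasimir N)) 1 * y =
      y * pureTensor S c (tS P S c (symCasimir N)) 1 := by
  induction y using heckeCliff_induction with
  | zero => rw [mul_zero, zero_mul]
  | add x y hx hy => rw [mul_add, hx, hy, add_mul]
  | tmul h a =>
    rw [pureTensor_mul, pureTensor_mul, casimir_comm hinv hc, one_mul, mul_one]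

end Dirac

section Regular

variable {ι V N : Type*} [Fintype ι] [AddCommGroup V] [Module ℝ V]
  [NormedAddCommGroup N] [InnerProductSpace ℝ N]
  {P : RootPairing ι ℝ V N} {S : SimpleSystem P} {c : ι → ℝ} [FiniteDimensional ℝ N]

/-- The Casimir element is transcendental: under a suitable evaluation it takes any value. -/
theorem aeval_casimir_ne_zero [Nontrivial N] {p : Polynomial ℂ} (hp : p ≠ 0) :
    Polynomial.aeval (-symCasimir N) p ≠ 0 := by
  obtain ⟨μ, hμ⟩ := p.exists_eval_ne_zero_of_natDegree_lt_card hp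
    ((Cardinal.natCast_lt_aleph0).trans_le (Cardinal.aleph0_le_mk ℂ))
  obtain ⟨s, hs⟩ := IsAlgClosed.exists_eq_mul_self (-μ)
  have hpos : 0 < Module.finrank ℝ N := Module.finrank_pos
  let k : Fin (Module.finrank ℝ N) := ⟨0, hpos⟩
  let φ : Sym N →ₐ[ℂ] ℂ := SymmetricAlgebra.lift (s • (onb N).coord k)
  have hφ : ∀ v, φ (SymmetricAlgebra.ι ℂ _ v) = s * (onb N).coord k v := fun v => by
    rw [SymmetricAlgebra.lift_ι_apply]; rfl
  have h1 : φ (-symCasimir N) = μ := by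
    rw [symCasimir, map_neg, map_sum, Finset.sum_eq_single k]
    · rw [map_mul, hφ, Module.Basis.coord_apply, Module.Basis.repr_self, Finsupp.single_eq_same,
        mul_one, ← hs, neg_neg]
    · intro j _ hj
      rw [map_mul, hφ, Module.Basis.coord_apply, Module.Basis.repr_self,
        Finsupp.single_eq_of_ne (Ne.symm hj), mul_zero, mul_zero]
    · intro h; exact absurd (Finset.mem_univ k) h
  intro h
  apply hμ
  have h2 := congrArg φ h
  rwa [← Polynomial.aeval_algHom_apply, h1, map_zero, Polynomial.coe_aeval_eq_eval] at h2

theorem eq_zero_of_mul_tS [P.IsRootSystem] [P.IsReduced] (hinv : ∀ (i : ι) (x y : N),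
      inner ℝ (P.coreflection i x) (P.coreflection i y) = inner ℝ x y)
    (hc : ∀ i j : ι, c (P.reflectionPerm i j) = c j) {g : Sym N} (hg : g ≠ 0)
    {h : Hecke P S c} (hh : h * tS P S c g = 0) : h = 0 := by
  obtain ⟨f, rfl⟩ := (pbwEquiv c S hinv hc).surjective h
  have h1 : pbwMap S c f * tS P S c g = pbwMap S c (fun w => f w * g) := by
    rw [pbwMap_apply, pbwMap_apply, Finset.sum_mul]
    exact Finset.sum_congr rfl fun w _ => by rw [map_mul, mul_assoc]
  have h2 : (fun w => f w * g) = 0 :=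
    pbwMap_injective hinv hc ((h1.symm.trans hh).trans (map_zero _).symm)
  have h3 : f = 0 := funext fun w => (mul_eq_zero.mp (congrFun h2 w)).resolve_right hg
  rw [h3, map_zero]

theorem eq_zero_of_mul_pureTensor [P.IsRootSystem] [P.IsReduced] (hinv : ∀ (i : ι) (x y : N),
      inner ℝ (P.coreflection i x) (P.coreflection i y) = inner ℝ x y)
    (hc : ∀ i j : ι, c (P.reflectionPerm i j) = c j) {g : Sym N} (hg : g ≠ 0)
    {x : HeckeCliff S c} (hx : x * pureTensor S c (tS P S c g) 1 = 0) : x = 0 := by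
  have hinj : Function.Injective (LinearMap.mulRight ℂ (tS P S c g)) :=
    (injective_iff_map_eq_zero _).mpr fun h hh => eq_zero_of_mul_tS hinv hc hg hh
  have h1 := Module.Flat.rTensor_preserves_injective_linearMap (M := Cliff N) _ hinj
  have h2 : ∀ y : HeckeCliff S c, y * pureTensor S c (tS P S c g) 1 =
      (LinearMap.mulRight ℂ (tS P S c g)).rTensor (Cliff N) y := by
    intro y
    induction y using heckeCliff_induction with
    | zero => rw [zero_mul]; exact (map_zero _).symm
    | add y z hy hz => rw [add_mul, hy, hz]; exact (map_add _ _ _).symm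
    | tmul h a => rw [pureTensor_mul, mul_one]; rfl
  rw [h2] at hx
  exact h1 (hx.trans (map_zero _).symm)

/-- The Dirac element is not a zero divisor: up to sign its square differs from the transcendental
central element by an element of the finite-dimensional group algebra. -/
theorem eq_zero_of_mul_dirac [Nontrivial N] [P.IsRootSystem] [P.IsReduced]
    (hinv : ∀ (i : ι) (x y : N),
      inner ℝ (P.coreflection i x) (P.coreflection i y) = inner ℝ x y)
    (hc : ∀ i j : ι, c (P.reflectionPerm i j) = c j)
    {x : HeckeCliff S c} (hx : x * diracElt S c = 0) : x = 0 := by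
  have := spinCover_finite S hinv
  set q := pureTensor S c (tS P S c (symCasimir N)) 1 with hq
  set τ := reflSum S c hinv * reflSum S c hinv with hτ
  have h1 : x * diagHom S c τ = x * -q := by
    have h : x * (diracElt S c * diracElt S c) = x * _ :=
      congrArg (x * ·) (dirac_mul_self (S := S) hinv hc)
    rw [← mul_assoc, hx, zero_mul, ← map_mul, mul_sub, eq_comm, sub_eq_zero] at h
    exact h.symm
  have hcomm : ∀ y, Commute (-q) y := fun y =>
    Commute.neg_left (show Commute q y from casimir_tmul_comm hinv hc y)
  obtain ⟨p, hp, hpτ⟩ := Algebra.IsIntegral.isIntegral (R := ℂ) τ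
  have h2 : ∀ p : Polynomial ℂ, x * Polynomial.aeval (diagHom S c τ) p =
      x * Polynomial.aeval (-q) p := by
    intro p
    induction p using Polynomial.induction_on' with
    | add p r hp hr => rw [map_add, map_add, mul_add, mul_add, hp, hr]
    | monomial n r =>
      rw [Polynomial.aeval_monomial, Polynomial.aeval_monomial, ← mul_assoc, ← mul_assoc,
        ← Algebra.commutes, mul_assoc, mul_assoc]
      congr 1
      induction n with
      | zero => rw [pow_zero, pow_zero]
      | succ n ih =>
        rw [pow_succ, ← mul_assoc, ih, mul_assoc, ((hcomm (diagHom S c τ)).pow_left n).eq,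
          ← mul_assoc, h1, mul_assoc, ← pow_succ']
  have h3 : Polynomial.aeval (diagHom S c τ) p = 0 := by
    rw [Polynomial.aeval_algHom_apply, Polynomial.aeval_def, hpτ, map_zero]
  have h4 : Polynomial.aeval (-q) p =
      pureTensor S c (tS P S c (Polynomial.aeval (-symCasimir N) p)) 1 := by
    have h5 : -q = ((symHom S c).comp Algebra.TensorProduct.includeLeft) (-symCasimir N) := by
      rw [map_neg]; rfl
    rw [h5, Polynomial.aeval_algHom_apply]
    rfl
  refine eq_zero_of_mul_pureTensor hinv hc (aeval_casimir_ne_zero hp.ne_zero) (x := x) ?_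
  rw [← h4, ← h2, h3, mul_zero]

/-- In rank zero the Dirac element is an empty sum. -/
theorem dirac_eq_zero [Subsingleton N] : diracElt S c = 0 := by
  rw [diracElt]
  refine Finset.sum_eq_zero fun i _ => ?_
  have h : Module.finrank ℝ N = 0 := Module.finrank_zero_of_subsingleton
  exact absurd i.2 (by omega)

end Regular

/-! ### The expansion of `H ⊗ C(V^∨)` along lifts of the Weyl group -/

section Expansion

variable {ι V N : Type*} [Fintype ι] [AddCommGroup V] [Module ℝ V]
  [NormedAddCommGroup N] [InnerProductSpace ℝ N]
  {P : RootPairing ι ℝ V N} {S : SimpleSystem P} {c : ι → ℝ}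
  [P.IsRootSystem] [P.IsReduced]

variable (S) in
/-- A chosen lift to the spin cover of an element of the Weyl group. -/
def spinLift (hinv : ∀ (i : ι) (x y : N),
      inner ℝ (P.coreflection i x) (P.coreflection i y) = inner ℝ x y) (w : weylGroup P) :
    spinCover P := (exists_lift S hinv w).choose

theorem spinLift_snd (hinv : ∀ (i : ι) (x y : N),
      inner ℝ (P.coreflection i x) (P.coreflection i y) = inner ℝ x y) (w : weylGroup P) :
    (spinLift S hinv w).1.2 = w := (exists_lift S hinv w).choose_spec

/-- The coefficient of `x` at `w` in the expansion of `H ⊗ C(V^∨)` as a free right module over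
`S(V^∨) ⊗ C(V^∨)`, with basis the chosen lifts of the elements of the Weyl group. -/
def coeff (hinv : ∀ (i : ι) (x y : N),
      inner ℝ (P.coreflection i x) (P.coreflection i y) = inner ℝ x y)
    (hc : ∀ i j : ι, c (P.reflectionPerm i j) = c j) (w : weylGroup P) :
    HeckeCliff S c →ₗ[ℂ] Sym N ⊗[ℂ] Cliff N :=
  (TensorProduct.map (LinearMap.proj w ∘ₗ (pbwEquiv c S hinv hc).symm.toLinearMap)
    (LinearMap.mulLeft ℂ (star ((spinLift S hinv w).1.1 : Cliff N))) :
    Hecke P S c ⊗[ℂ] Cliff N →ₗ[ℂ] Sym N ⊗[ℂ] Cliff N)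

theorem coeff_pureTensor (hinv : ∀ (i : ι) (x y : N),
      inner ℝ (P.coreflection i x) (P.coreflection i y) = inner ℝ x y)
    (hc : ∀ i j : ι, c (P.reflectionPerm i j) = c j) (w : weylGroup P) (f : weylGroup P → Sym N)
    (a : Cliff N) :
    coeff hinv hc w (pureTensor S c (pbwMap S c f) a) =
      f w ⊗ₜ (star ((spinLift S hinv w).1.1 : Cliff N) * a) := by
  change (pbwEquiv c S hinv hc).symm (pbwEquiv c S hinv hc f) w ⊗ₜ _ = _
  rw [LinearEquiv.symm_apply_apply]
  rfl

theorem spinHom_mul_symHom_tmul (x : spinCover P) (g : Sym N) (a : Cliff N) :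
    spinHom S c x * symHom S c (g ⊗ₜ a) =
      pureTensor S c (tW P S c x.1.2 * tS P S c g) ((x.1.1 : Cliff N) * a) := by
  rw [spinHom_apply, symHom_tmul, pureTensor_mul]

theorem coeff_spinLift_mul [DecidableEq (weylGroup P)] (hinv : ∀ (i : ι) (x y : N),
      inner ℝ (P.coreflection i x) (P.coreflection i y) = inner ℝ x y)
    (hc : ∀ i j : ι, c (P.reflectionPerm i j) = c j) (w u : weylGroup P)
    (y : Sym N ⊗[ℂ] Cliff N) :
    coeff hinv hc w (spinHom S c (spinLift S hinv u) * symHom S c y) = if w = u then y else 0 := by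
  induction y using TensorProduct.induction_on with
  | zero => rw [map_zero, mul_zero, map_zero, ite_self]
  | add x y hx hy => rw [map_add, mul_add, map_add, hx, hy]; split_ifs <;> simp
  | tmul g a =>
    rw [spinHom_mul_symHom_tmul, spinLift_snd, ← pbwMap_single, coeff_pureTensor]
    split_ifs with h
    · subst h
      have h1 : star ((spinLift S hinv w).1.1 : Cliff N) *
          ((spinLift S hinv w).1.1 : Cliff N) = 1 :=
        Unitary.coe_star_mul_self (spinLift S hinv w).1.1
      rw [Pi.single_eq_same, ← mul_assoc, h1, one_mul]
    · rw [Pi.single_eq_of_ne h, TensorProduct.zero_tmul]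

theorem sum_coeff (hinv : ∀ (i : ι) (x y : N),
      inner ℝ (P.coreflection i x) (P.coreflection i y) = inner ℝ x y)
    (hc : ∀ i j : ι, c (P.reflectionPerm i j) = c j) (x : HeckeCliff S c) :
    ∑ w, spinHom S c (spinLift S hinv w) * symHom S c (coeff hinv hc w x) = x := by
  induction x using heckeCliff_induction with
  | zero => exact Finset.sum_eq_zero fun w _ => by rw [map_zero, map_zero, mul_zero]
  | add x y hx hy =>
    conv_rhs => rw [← hx, ← hy]
    rw [← Finset.sum_add_distrib]
    exact Finset.sum_congr rfl fun w _ => by rw [map_add, map_add, mul_add]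
  | tmul h a =>
    obtain ⟨f, rfl⟩ := (pbwEquiv c S hinv hc).surjective h
    change ∑ w, _ * symHom S c (coeff hinv hc w (pureTensor S c (pbwMap S c f) a)) =
      pureTensor S c (pbwMap S c f) a
    conv_rhs => rw [pbwMap_apply, map_sum, LinearMap.sum_apply]
    refine Finset.sum_congr rfl fun w _ => ?_
    have h1 : ((spinLift S hinv w).1.1 : Cliff N) * star ((spinLift S hinv w).1.1 : Cliff N) = 1 :=
      Unitary.coe_mul_star_self (spinLift S hinv w).1.1
    rw [coeff_pureTensor, spinHom_mul_symHom_tmul, spinLift_snd, ← mul_assoc, h1, one_mul]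

/-! ### The degree filtration of `H ⊗ C(V^∨)` -/

variable (S) (c) in
/-- Elements of `H ⊗ C(V^∨)` of polynomial degree less than `n`. -/
def heckeCliffLT (n : ℕ) : Submodule ℂ (HeckeCliff S c) :=
  Submodule.span ℂ {x | ∃ h ∈ heckeLT S c n, ∃ a, x = pureTensor S c h a}

theorem pureTensor_mem {n : ℕ} {h : Hecke P S c} (hh : h ∈ heckeLT S c n) (a : Cliff N) :
    pureTensor S c h a ∈ heckeCliffLT S c n := Submodule.subset_span ⟨h, hh, a, rfl⟩

theorem heckeCliffLT_mono : Monotone (heckeCliffLT S c) := fun n m h => by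
  refine Submodule.span_mono ?_
  rintro _ ⟨g, hg, a, rfl⟩
  exact ⟨g, heckeLT_mono h hg, a, rfl⟩

theorem map_mem_of_mem_heckeCliffLT {M : Type*} [AddCommMonoid M] [Module ℂ M]
    (φ : HeckeCliff S c →ₗ[ℂ] M) {n : ℕ} {L : Submodule ℂ M}
    (h : ∀ g ∈ heckeLT S c n, ∀ a, φ (pureTensor S c g a) ∈ L)
    {x : HeckeCliff S c} (hx : x ∈ heckeCliffLT S c n) : φ x ∈ L := by
  have : heckeCliffLT S c n ≤ L.comap φ := by
    refine Submodule.span_le.mpr ?_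
    rintro _ ⟨g, hg, a, rfl⟩
    exact h g hg a
  exact this hx

theorem heckeCliffLT_zero : heckeCliffLT S c 0 = ⊥ := by
  refine Submodule.span_eq_bot.mpr ?_
  rintro _ ⟨h, hh, a, rfl⟩
  have h0 : heckeLT S c 0 = ⊥ := by
    refine Submodule.span_eq_bot.mpr ?_
    rintro _ ⟨w, g, hg, rfl⟩
    have hg0 : g = 0 := hg
    rw [hg0, map_zero, mul_zero]
  rw [h0, Submodule.mem_bot] at hh
  rw [hh, map_zero, LinearMap.zero_apply]

theorem exists_mem_heckeCliffLT (hinv : ∀ (i : ι) (x y : N),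
      inner ℝ (P.coreflection i x) (P.coreflection i y) = inner ℝ x y) (x : HeckeCliff S c) :
    ∃ n, x ∈ heckeCliffLT S c n := by
  induction x using heckeCliff_induction with
  | zero => exact ⟨0, zero_mem _⟩
  | tmul h a =>
    obtain ⟨n, hn⟩ := exists_mem_heckeLT hinv h
    exact ⟨n, pureTensor_mem hn a⟩
  | add x y hx hy =>
    obtain ⟨n, hn⟩ := hx
    obtain ⟨m, hm⟩ := hy
    exact ⟨max n m, add_mem (heckeCliffLT_mono (le_max_left _ _) hn)
      (heckeCliffLT_mono (le_max_right _ _) hm)⟩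

theorem spinHom_mem (x : spinCover P) : spinHom S c x ∈ heckeCliffLT S c 1 := by
  rw [spinHom_apply]
  refine pureTensor_mem ?_ _
  have := tW_mul_tS_mem (S := S) (c := c) x.1.2 (one_mem_symLT (K := ℂ ⊗[ℝ] N) 0)
  rwa [map_one, mul_one] at this

theorem spinHom_mul_mem {n : ℕ} (u : spinCover P) {x : HeckeCliff S c}
    (hx : x ∈ heckeCliffLT S c n) : spinHom S c u * x ∈ heckeCliffLT S c n := by
  refine map_mem_of_mem_heckeCliffLT (LinearMap.mulLeft ℂ (spinHom S c u)) (fun g hg a => ?_) hx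
  rw [LinearMap.mulLeft_apply, spinHom_apply, pureTensor_mul]
  exact pureTensor_mem (tW_mul_mem_heckeLT _ hg) _

theorem mul_spinHom_mem (hinv : ∀ (i : ι) (x y : N),
      inner ℝ (P.coreflection i x) (P.coreflection i y) = inner ℝ x y) {n : ℕ} (u : spinCover P)
    {x : HeckeCliff S c} (hx : x ∈ heckeCliffLT S c n) :
    x * spinHom S c u ∈ heckeCliffLT S c n := by
  refine map_mem_of_mem_heckeCliffLT (LinearMap.mulRight ℂ (spinHom S c u)) (fun g hg a => ?_) hx
  rw [LinearMap.mulRight_apply, spinHom_apply, pureTensor_mul]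
  exact pureTensor_mem (mul_tW_mem_heckeLT hinv _ hg) _

theorem parity_mem {n : ℕ} {x : HeckeCliff S c} (hx : x ∈ heckeCliffLT S c n) :
    parity S c x ∈ heckeCliffLT S c n :=
  map_mem_of_mem_heckeCliffLT (parity S c).toLinearMap (fun _ hg _ => pureTensor_mem hg _) hx

theorem symHom_mem {n : ℕ} {y : Sym N ⊗[ℂ] Cliff N} (hy : y ∈ symCliffLT (negForm N) n) :
    symHom S c y ∈ heckeCliffLT S c n := by
  refine map_mem_symCliffLT (symHom S c).toLinearMap (fun g hg a => ?_) hy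
  have := tW_mul_tS_mem (S := S) (c := c) 1 hg
  rw [map_one, one_mul] at this
  exact pureTensor_mem this a

theorem diagHom_mul_mem {n : ℕ} (ζ : SpinAlg P) {x : HeckeCliff S c}
    (hx : x ∈ heckeCliffLT S c n) : diagHom S c ζ * x ∈ heckeCliffLT S c n := by
  induction ζ using MonoidAlgebra.induction_on with
  | of u => rw [diagHom_of]; exact spinHom_mul_mem u hx
  | add y z hy hz => rw [map_add, add_mul]; exact add_mem hy hz
  | smul r y hy => rw [map_smul, smul_mul_assoc]; exact Submodule.smul_mem _ _ hy

theorem mul_diagHom_mem (hinv : ∀ (i : ι) (x y : N),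
      inner ℝ (P.coreflection i x) (P.coreflection i y) = inner ℝ x y) {n : ℕ} (ζ : SpinAlg P)
    {x : HeckeCliff S c} (hx : x ∈ heckeCliffLT S c n) :
    x * diagHom S c ζ ∈ heckeCliffLT S c n := by
  induction ζ using MonoidAlgebra.induction_on with
  | of u => rw [diagHom_of]; exact mul_spinHom_mem hinv u hx
  | add y z hy hz => rw [map_add, mul_add]; exact add_mem hy hz
  | smul r y hy => rw [map_smul, mul_smul_comm]; exact Submodule.smul_mem _ _ hy

theorem coeff_mem (hinv : ∀ (i : ι) (x y : N),
      inner ℝ (P.coreflection i x) (P.coreflection i y) = inner ℝ x y)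
    (hc : ∀ i j : ι, c (P.reflectionPerm i j) = c j) (w : weylGroup P) {n : ℕ}
    {x : HeckeCliff S c} (hx : x ∈ heckeCliffLT S c n) :
    coeff hinv hc w x ∈ symCliffLT (negForm N) n := by
  refine map_mem_of_mem_heckeCliffLT _ (fun h hh a => ?_) hx
  obtain ⟨f, hf, rfl⟩ := exists_pbw_of_mem hh
  rw [coeff_pureTensor]
  exact tmul_mem_symCliffLT (hf w) _

theorem symEps_symEps (y : Sym N ⊗[ℂ] Cliff N) :
    symEps _ (negForm N) (symEps _ (negForm N) y) = y := by
  induction y using TensorProduct.induction_on with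
  | zero => rw [map_zero, map_zero]
  | add x y hx hy => rw [map_add, map_add, hx, hy]
  | tmul g a =>
    rw [symEps, Algebra.TensorProduct.map_tmul, Algebra.TensorProduct.map_tmul,
      CliffordAlgebra.involute_involute]
    rfl

theorem symEps_mem {n : ℕ} {y : Sym N ⊗[ℂ] Cliff N} (hy : y ∈ symCliffLT (negForm N) n) :
    symEps _ (negForm N) y ∈ symCliffLT (negForm N) n :=
  map_mem_symCliffLT (symEps _ (negForm N)).toLinearMap
    (fun _ hg _ => tmul_mem_symCliffLT hg _) hy

/-! ### Exactness of the Dirac differential up to lower degree -/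

variable [FiniteDimensional ℝ N]

/-- The Dirac differential acts on the coefficients of the expansion through the Koszul
differential, up to terms of lower degree. -/
theorem dirac_diff_mem (hinv : ∀ (i : ι) (x y : N),
      inner ℝ (P.coreflection i x) (P.coreflection i y) = inner ℝ x y)
    (hc : ∀ i j : ι, c (P.reflectionPerm i j) = c j) (u : spinCover P) {n : ℕ}
    {y : Sym N ⊗[ℂ] Cliff N} (hy : y ∈ symCliffLT (negForm N) n) :
    diracElt S c * (spinHom S c u * symHom S c y) -
        parity S c (spinHom S c u * symHom S c y) * diracElt S c -
      spinHom S c (spinInvolute u) * symHom S c (kosz (negForm N) (onb N) y) ∈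
        heckeCliffLT S c n := by
  set T := diagHom S c (reflSum S c hinv) with hT
  have h1 : diracElt S c * (spinHom S c u * symHom S c y) -
        parity S c (spinHom S c u * symHom S c y) * diracElt S c -
      spinHom S c (spinInvolute u) * symHom S c (kosz (negForm N) (onb N) y) =
      spinHom S c (spinInvolute u) *
        (symHom S c (symEps _ (negForm N) y) * T - T * symHom S c y) := by
    rw [← mul_assoc, dirac_mul_spinHom hinv hc, parity_spinHom, map_mul, parity_spinHom,
      parity_symHom, kosz_apply, map_sub, map_mul, map_mul, dirac_eq_sub hinv, ← hT]
    noncomm_ring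
  rw [h1]
  exact spinHom_mul_mem _ (sub_mem (mul_diagHom_mem hinv _ (symHom_mem (symEps_mem hy)))
    (diagHom_mul_mem _ (symHom_mem hy)))

/-- If the Dirac differential does not raise the degree of `x`, the Koszul differential does not
raise the degree of its coefficients. -/
theorem kosz_coeff_mem (hinv : ∀ (i : ι) (x y : N),
      inner ℝ (P.coreflection i x) (P.coreflection i y) = inner ℝ x y)
    (hc : ∀ i j : ι, c (P.reflectionPerm i j) = c j) {n : ℕ} {x : HeckeCliff S c}
    (hx : x ∈ heckeCliffLT S c n)
    (hd : diracElt S c * x - parity S c x * diracElt S c ∈ heckeCliffLT S c n)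
    (w : weylGroup P) :
    kosz (negForm N) (onb N) (coeff hinv hc w x) ∈ symCliffLT (negForm N) n := by
  classical
  have h1 : ∑ u, spinHom S c (spinInvolute (spinLift S hinv u)) *
      symHom S c (kosz (negForm N) (onb N) (coeff hinv hc u x)) ∈ heckeCliffLT S c n := by
    have h2 := Submodule.sum_mem (heckeCliffLT S c n) (t := Finset.univ) fun u _ =>
      dirac_diff_mem hinv hc (spinLift S hinv u) (coeff_mem hinv hc u hx)
    rw [Finset.sum_sub_distrib, Finset.sum_sub_distrib, ← Finset.mul_sum, ← Finset.sum_mul,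
      ← map_sum, sum_coeff] at h2
    have h3 := sub_mem hd h2
    rwa [sub_sub_cancel] at h3
  have h2 := parity_mem h1
  have h3 : parity S c (∑ u, spinHom S c (spinInvolute (spinLift S hinv u)) *
      symHom S c (kosz (negForm N) (onb N) (coeff hinv hc u x))) =
      ∑ u, spinHom S c (spinLift S hinv u) * symHom S c (symEps _ (negForm N)
        (kosz (negForm N) (onb N) (coeff hinv hc u x))) := by
    rw [map_sum]
    refine Finset.sum_congr rfl fun u _ => ?_
    rw [map_mul, ← parity_spinHom, parity_parity, parity_symHom]
  rw [h3] at h2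
  have h4 := coeff_mem hinv hc w h2
  rw [map_sum, Finset.sum_congr rfl fun u _ => coeff_spinLift_mul hinv hc w u _,
    Finset.sum_ite_eq, if_pos (Finset.mem_univ w)] at h4
  have h5 := symEps_mem h4
  rwa [symEps_symEps] at h5

/-- In degree zero the cycles up to lower degree are the combinations of the group elements. -/
theorem dirac_exact_one (hinv : ∀ (i : ι) (x y : N),
      inner ℝ (P.coreflection i x) (P.coreflection i y) = inner ℝ x y)
    (hc : ∀ i j : ι, c (P.reflectionPerm i j) = c j) {x : HeckeCliff S c}
    (hx : x ∈ heckeCliffLT S c 1)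
    (hd : diracElt S c * x - parity S c x * diracElt S c ∈ heckeCliffLT S c 1) :
    x ∈ Submodule.span ℂ (Set.range (spinHom S c)) := by
  rw [← sum_coeff hinv hc x]
  refine Submodule.sum_mem _ fun w _ => ?_
  obtain ⟨r, hr⟩ := kosz_exact_zero (onb_orthonormal N) (coeff_mem hinv hc w hx)
    (kosz_coeff_mem hinv hc hx hd w)
  rw [hr, AlgHom.commutes, ← Algebra.commutes, ← Algebra.smul_def]
  exact Submodule.smul_mem _ _ (Submodule.subset_span ⟨_, rfl⟩)

/-- In positive degree every cycle is a boundary up to lower degree. The primitive is assembled from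
primitives of the coefficients for the Koszul differential; the parity twist of the lifts
compensates the one in `dirac_diff_mem`. -/
theorem dirac_exact_succ (hinv : ∀ (i : ι) (x y : N),
      inner ℝ (P.coreflection i x) (P.coreflection i y) = inner ℝ x y)
    (hc : ∀ i j : ι, c (P.reflectionPerm i j) = c j) {n : ℕ} (hn : 0 < n) {x : HeckeCliff S c}
    (hx : x ∈ heckeCliffLT S c (n + 1))
    (hd : diracElt S c * x - parity S c x * diracElt S c ∈ heckeCliffLT S c (n + 1)) :
    ∃ y, x - (diracElt S c * y - parity S c y * diracElt S c) ∈ heckeCliffLT S c n := by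
  have h1 : ∀ w, ∃ y ∈ symCliffLT (negForm N) n,
      coeff hinv hc w x - kosz (negForm N) (onb N) y ∈ symCliffLT (negForm N) n := fun w =>
    kosz_exact (onb_orthonormal N) hn (coeff_mem hinv hc w hx) (kosz_coeff_mem hinv hc hx hd w)
  choose f hf hf' using h1
  refine ⟨∑ w, spinHom S c (spinInvolute (spinLift S hinv w)) * symHom S c (f w), ?_⟩
  have hinvol : ∀ w, spinHom S c (spinInvolute (spinInvolute (spinLift S hinv w))) =
      spinHom S c (spinLift S hinv w) := fun w => by
    rw [← parity_spinHom, ← parity_spinHom, parity_parity]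
  conv in x - _ => rw [← sum_coeff hinv hc x]
  rw [map_sum, Finset.mul_sum, Finset.sum_mul, ← Finset.sum_sub_distrib,
    ← Finset.sum_sub_distrib]
  refine Submodule.sum_mem _ fun w _ => ?_
  have h2 := dirac_diff_mem (S := S) hinv hc (spinInvolute (spinLift S hinv w)) (hf w)
  rw [hinvol] at h2
  have h3 := sub_mem (spinHom_mul_mem (spinLift S hinv w) (symHom_mem (S := S) (c := c) (hf' w))) h2
  rw [map_sub, mul_sub] at h3
  convert h3 using 1
  abel

theorem comm_diagHom {y : HeckeCliff S c}
    (hy : ∀ u, y * spinHom S c u = spinHom S c u * y) (ζ : SpinAlg P) :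
    y * diagHom S c ζ = diagHom S c ζ * y := by
  induction ζ using MonoidAlgebra.induction_on with
  | of u => rw [diagHom_of, hy]
  | add a b ha hb => rw [map_add, mul_add, ha, hb, add_mul]
  | smul r a ha => rw [map_smul, mul_smul_comm, ha, smul_mul_assoc]

theorem twisted_comm_diagHom {y : HeckeCliff S c}
    (hy : ∀ u, y * spinHom S c u = parity S c (spinHom S c u) * y) (ζ : SpinAlg P) :
    y * diagHom S c ζ = parity S c (diagHom S c ζ) * y := by
  induction ζ using MonoidAlgebra.induction_on with
  | of u => rw [diagHom_of, hy]
  | add a b ha hb => rw [map_add, map_add, mul_add, ha, hb, add_mul]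
  | smul r a ha => rw [map_smul, map_smul, mul_smul_comm, ha, smul_mul_assoc]

variable (S) in
/-- The algebra `H ⊗ C(V^∨)` with its Dirac element, as an instance of the formal setting. -/
def diracDatum (hinv : ∀ (i : ι) (x y : N),
      inner ℝ (P.coreflection i x) (P.coreflection i y) = inner ℝ x y)
    (hc : ∀ i j : ι, c (P.reflectionPerm i j) = c j) :
    DiracDatum (HeckeCliff S c) (spinCover P) where
  eps := parity S c
  eps_eps := parity_parity
  rho := spinHom S c
  eps_rho x := ⟨_, parity_spinHom x⟩
  D := diracElt S c
  eps_D := parity_dirac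
  D_rho := dirac_mul_spinHom hinv hc
  D_sq_comm y hy := by
    have h := comm_diagHom hy (reflSum S c hinv)
    rw [dirac_mul_self hinv hc, sub_mul, mul_sub, neg_mul, mul_neg, casimir_tmul_comm hinv hc,
      mul_assoc, ← h, ← mul_assoc, ← h, mul_assoc]
  D_sq_comm' y hy := by
    have h := twisted_comm_diagHom hy (reflSum S c hinv)
    rw [parity_reflSum] at h
    rw [dirac_mul_self hinv hc, sub_mul, mul_sub, neg_mul, mul_neg, casimir_tmul_comm hinv hc,
      ← mul_assoc, h, neg_mul, neg_mul, mul_assoc _ y, h, neg_mul, mul_neg, neg_neg, mul_assoc]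
  F := heckeCliffLT S c
  F_zero := heckeCliffLT_zero
  F_mono := heckeCliffLT_mono
  exists_mem_F := exists_mem_heckeCliffLT hinv
  rho_mem := spinHom_mem
  rho_mul_mem _ u _ hx := spinHom_mul_mem u hx
  mul_rho_mem _ u _ hx := mul_spinHom_mem hinv u hx
  exact_one _ hx hd := dirac_exact_one hinv hc hx hd
  exact_succ _ hn _ hx hd := dirac_exact_succ hinv hc hn hx hd

end Expansion

/-! ### Genuine elements of the group algebra of the spin cover -/

section Genuine

variable {ι V N : Type*} [Fintype ι] [AddCommGroup V] [Module ℝ V]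
  [NormedAddCommGroup N] [InnerProductSpace ℝ N]
  {P : RootPairing ι ℝ V N} {S : SimpleSystem P} {c : ι → ℝ}

theorem cliff_nontrivial : Nontrivial (Cliff N) := by
  have : Invertible (2 : ℂ) := invertibleOfNonzero two_ne_zero
  infer_instance

theorem minusOne_mul_self : minusOne P * minusOne P = 1 := by
  refine Subtype.ext (Prod.ext (Subtype.ext ?_) (mul_one _))
  change (-1 : Cliff N) * -1 = 1
  rw [neg_mul_neg, mul_one]

theorem minusOne_mul (x : spinCover P) : minusOne P * x = x * minusOne P := by
  refine Subtype.ext (Prod.ext (Subtype.ext ?_) ?_)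
  · change (-1 : Cliff N) * (x.1.1 : Cliff N) = (x.1.1 : Cliff N) * -1
    rw [neg_one_mul, mul_neg_one]
  · exact (one_mul x.1.2).trans (mul_one x.1.2).symm

theorem minusOne_ne_one : minusOne P ≠ 1 := by
  have := cliff_nontrivial (N := N)
  intro h
  have h1 : (-1 : Cliff N) = 1 := congrArg (fun x : spinCover P => (x.1.1 : Cliff N)) h
  have h2 : (2 : ℂ) • (1 : Cliff N) = 0 := by
    rw [two_smul]
    conv_lhs => rw [← h1]
    rw [h1]
    nth_rewrite 1 [← h1]
    rw [neg_add_cancel]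
  exact one_ne_zero ((smul_eq_zero.mp h2).resolve_left two_ne_zero)

variable [P.IsRootSystem] [P.IsReduced]

/-- The two lifts `±w̃` of `w` have opposite images under the diagonal map, so that the coefficient
at `w` is the difference of their coefficients. -/
theorem coeff_diagHom (hinv : ∀ (i : ι) (x y : N),
      inner ℝ (P.coreflection i x) (P.coreflection i y) = inner ℝ x y)
    (hc : ∀ i j : ι, c (P.reflectionPerm i j) = c j) (w : weylGroup P) (ζ : SpinAlg P) :
    coeff hinv hc w (diagHom S c ζ) =
      (ζ.coeff (spinLift S hinv w) - ζ.coeff (minusOne P * spinLift S hinv w)) • 1 := by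
  classical
  have hne : ∀ x : spinCover P, minusOne P * x ≠ x := fun x h =>
    minusOne_ne_one (mul_eq_right.mp h)
  have hlift : ∀ u, coeff hinv hc w (spinHom S c (spinLift S hinv u)) = if w = u then 1 else 0 := by
    intro u
    have h := coeff_spinLift_mul (S := S) hinv hc w u 1
    rwa [map_one, mul_one] at h
  induction ζ using MonoidAlgebra.induction_on with
  | add x y hx hy =>
    rw [map_add, map_add, hx, hy, ← add_smul]
    congr 1
    simp only [MonoidAlgebra.coeff_add, Finsupp.add_apply]
    ring
  | smul r x hx =>
    rw [map_smul, map_smul, hx, smul_smul]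
    congr 1
    simp only [MonoidAlgebra.coeff_smul, Finsupp.smul_apply, smul_eq_mul]
    ring
  | of u =>
    rw [diagHom_of]
    simp only [MonoidAlgebra.of_apply, MonoidAlgebra.coeff_single, Finsupp.single_apply]
    rcases eq_or_eq_minusOne_mul (spinLift_snd (S := S) hinv u.1.2).symm with h | h
    · rw [h, hlift]
      by_cases hw : w = u.1.2
      · rw [if_pos hw, hw, if_pos rfl, if_neg fun h' => hne _ h'.symm, sub_zero, one_smul]
      · rw [if_neg hw, if_neg, if_neg, sub_zero, zero_smul]
        · intro h'
          apply hw
          have := congrArg (fun x : spinCover P => x.1.2) h'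
          change (spinLift S hinv u.1.2).1.2 = 1 * (spinLift S hinv w).1.2 at this
          rw [spinLift_snd, spinLift_snd, one_mul] at this
          exact this.symm
        · intro h'
          apply hw
          have := congrArg (fun x : spinCover P => x.1.2) h'
          simp only [spinLift_snd] at this
          exact this.symm
    · have hsnd : (minusOne P * spinLift S hinv u.1.2).1.2 = u.1.2 := by rw [← h]
      rw [h, map_mul, spinHom_minusOne, neg_one_mul, map_neg, hlift]
      by_cases hw : w = u.1.2
      · rw [if_pos hw, hw, if_neg (hne _), if_pos rfl, zero_sub]
        exact (neg_one_smul ℂ _).symm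
      · rw [if_neg hw, if_neg, if_neg, sub_zero, zero_smul, neg_zero]
        · intro h'
          apply hw
          have := congrArg (fun x : spinCover P => x.1.2) (mul_left_cancel h')
          simp only [spinLift_snd] at this
          exact this.symm
        · intro h'
          apply hw
          have := congrArg (fun x : spinCover P => x.1.2) h'
          simp only [spinLift_snd, hsnd] at this
          exact this.symm

/-- The diagonal map is injective on genuine elements. -/
theorem eq_zero_of_isGenuine (hinv : ∀ (i : ι) (x y : N),
      inner ℝ (P.coreflection i x) (P.coreflection i y) = inner ℝ x y)
    (hc : ∀ i j : ι, c (P.reflectionPerm i j) = c j) {ζ : SpinAlg P} (hζ : IsGenuine P ζ)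
    (h : diagHom S c ζ = 0) : ζ = 0 := by
  have := cliff_nontrivial (N := N)
  have : Nontrivial (Sym N ⊗[ℂ] Cliff N) := inferInstance
  have h1 : ∀ x, ζ.coeff x = -ζ.coeff (minusOne P * x) := by
    intro x
    have h2 := congrArg (fun ξ : SpinAlg P => ξ.coeff (minusOne P * x)) hζ
    simp only [MonoidAlgebra.of_apply, MonoidAlgebra.coeff_single_mul_apply, one_mul,
      inv_mul_cancel_left] at h2
    exact h2
  have h2 : ∀ w, ζ.coeff (spinLift S hinv w) = 0 := by
    intro w
    have h3 := coeff_diagHom (S := S) hinv hc w ζ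
    rw [h, map_zero, eq_comm] at h3
    have h4 := (smul_eq_zero.mp h3).resolve_right one_ne_zero
    have h5 := h1 (spinLift S hinv w)
    linear_combination (1 / 2 : ℂ) * h4 + (1 / 2 : ℂ) * h5
  refine MonoidAlgebra.ext (Finsupp.ext fun x => ?_)
  change ζ.coeff x = 0
  rcases eq_or_eq_minusOne_mul (spinLift_snd (S := S) hinv x.1.2).symm with h3 | h3
  · rw [h3, h2]
  · have h4 := h1 (spinLift S hinv x.1.2)
    rw [h2, ← h3] at h4
    exact neg_eq_zero.mp h4.symm

theorem eq_of_isGenuine (hinv : ∀ (i : ι) (x y : N),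
      inner ℝ (P.coreflection i x) (P.coreflection i y) = inner ℝ x y)
    (hc : ∀ i j : ι, c (P.reflectionPerm i j) = c j)
    {ζ ζ' : SpinAlg P} (hζ : IsGenuine P ζ) (hζ' : IsGenuine P ζ')
    (h : diagHom S c ζ' = diagHom S c ζ) : ζ' = ζ := by
  rw [← sub_eq_zero]
  refine eq_zero_of_isGenuine (S := S) hinv hc ?_ (by rw [map_sub, h, sub_self])
  rw [IsGenuine] at hζ hζ' ⊢
  rw [mul_sub, hζ, hζ']
  abel

theorem IsGenuine.mul_right {ζ : SpinAlg P} (hζ : IsGenuine P ζ) (ξ : SpinAlg P) :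
    IsGenuine P (ζ * ξ) := by
  rw [IsGenuine] at hζ ⊢
  rw [← mul_assoc, hζ, neg_mul]

theorem IsGenuine.of_mul {ζ : SpinAlg P} (hζ : IsGenuine P ζ) (u : spinCover P) :
    IsGenuine P (MonoidAlgebra.of ℂ (spinCover P) u * ζ) := by
  rw [IsGenuine] at hζ ⊢
  rw [← mul_assoc, ← map_mul, minusOne_mul, map_mul, mul_assoc, hζ, mul_neg]

/-- The genuine part of an element has the same image under the diagonal map, as `-1 ∈ W̃` is
mapped to the scalar `-1`. -/
theorem exists_genuine_part (ξ : SpinAlg P) :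
    ∃ ζ : SpinAlg P, IsGenuine P ζ ∧ diagHom S c ζ = diagHom S c ξ := by
  have hm : diagHom S c (MonoidAlgebra.of ℂ (spinCover P) (minusOne P)) = -1 := by
    rw [diagHom_of, spinHom_minusOne]
  refine ⟨(1 / 2 : ℂ) • (ξ - MonoidAlgebra.of ℂ (spinCover P) (minusOne P) * ξ), ?_, ?_⟩
  · rw [IsGenuine, mul_smul_comm, mul_sub, ← mul_assoc, ← map_mul, minusOne_mul_self, map_one,
      one_mul, ← smul_neg, neg_sub]
  · rw [map_smul, map_sub, map_mul, hm, neg_one_mul, sub_neg_eq_add, ← two_smul ℂ, smul_smul]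
    norm_num

theorem span_spinHom :
    Submodule.span ℂ (Set.range (spinHom S c)) = LinearMap.range (diagHom S c).toLinearMap := by
  apply le_antisymm
  · refine Submodule.span_le.mpr ?_
    rintro _ ⟨x, rfl⟩
    exact ⟨MonoidAlgebra.of ℂ _ x, diagHom_of x⟩
  · rintro _ ⟨ζ, rfl⟩
    change diagHom S c ζ ∈ _
    induction ζ using MonoidAlgebra.induction_on with
    | of u => rw [diagHom_of]; exact Submodule.subset_span ⟨u, rfl⟩
    | add x y hx hy => rw [map_add]; exact add_mem hx hy
    | smul r x hx => rw [map_smul]; exact Submodule.smul_mem _ _ hx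

theorem mem_center_of_comm {ζ : SpinAlg P}
    (h : ∀ u, MonoidAlgebra.of ℂ (spinCover P) u * ζ = ζ * MonoidAlgebra.of ℂ (spinCover P) u) :
    ζ ∈ Subalgebra.center ℂ (SpinAlg P) := by
  rw [Subalgebra.mem_center_iff]
  intro ξ
  induction ξ using MonoidAlgebra.induction_on with
  | of u => exact h u
  | add x y hx hy => rw [add_mul, hx, hy, mul_add]
  | smul r x hx => rw [smul_mul_assoc, hx, mul_smul_comm]

end Genuine

/-! ### The Dirac cohomology of central elements -/

section Main

variable {ι V N : Type*} [Fintype ι] [AddCommGroup V] [Module ℝ V]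
  [NormedAddCommGroup N] [InnerProductSpace ℝ N]
  {P : RootPairing ι ℝ V N} {S : SimpleSystem P} {c : ι → ℝ}
  [P.IsRootSystem] [P.IsReduced] [FiniteDimensional ℝ N]

theorem pureTensor_center_comm {z : Hecke P S c} (hz : z ∈ Subalgebra.center ℂ (Hecke P S c))
    (y : HeckeCliff S c) : y * pureTensor S c z 1 = pureTensor S c z 1 * y := by
  rw [Subalgebra.mem_center_iff] at hz
  induction y using heckeCliff_induction with
  | zero => rw [mul_zero, zero_mul]
  | add x y hx hy => rw [add_mul, hx, hy, mul_add]
  | tmul h a => rw [pureTensor_mul, pureTensor_mul, hz, one_mul, mul_one]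

/-- Existence of the genuine central element attached to `z`, with equal left and right multipliers
of the Dirac element. -/
theorem exists_genuine_of_center (hinv : ∀ (i : ι) (x y : N),
      inner ℝ (P.coreflection i x) (P.coreflection i y) = inner ℝ x y)
    (hc : ∀ i j : ι, c (P.reflectionPerm i j) = c j)
    {z : Hecke P S c} (hz : z ∈ Subalgebra.center ℂ (Hecke P S c)) :
    ∃ ζ ∈ Subalgebra.center ℂ (SpinAlg P), IsGenuine P ζ ∧ ∃ a : HeckeCliff S c,
      pureTensor S c z 1 = diagHom S c ζ + diracElt S c * a + a * diracElt S c := by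
  have := spinCover_finite S hinv
  have := Fintype.ofFinite (spinCover P)
  let X := diracDatum S hinv hc
  set t := pureTensor S c z 1 with ht
  have hinvt : X.Inv false t := fun u => (pureTensor_center_comm hz _).symm
  have hept : X.eps t = t := by
    change parity S c (pureTensor S c z 1) = pureTensor S c z 1
    rw [parity_tmul, map_one]
  have hdt : X.d t = 0 := by
    rw [DiracDatum.d_apply, hept, ht, pureTensor_center_comm hz, sub_self]
  obtain ⟨a, hay, hepa, hspan⟩ := X.exists_odd_sub_d_mem hinvt hept hdt
  have hmem : t - X.d a ∈ LinearMap.range (diagHom S c).toLinearMap := by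
    rw [← span_spinHom]
    exact hspan
  obtain ⟨ξ, hξ⟩ := hmem
  have hξ' : diagHom S c ξ = t - X.d a := hξ
  obtain ⟨ζ, hgen, hdiag⟩ := exists_genuine_part (S := S) (c := c) ξ
  rw [hξ'] at hdiag
  refine ⟨ζ, mem_center_of_comm fun u => ?_, hgen, a, ?_⟩
  · have hinvζ : X.Inv false (diagHom S c ζ) := by
      rw [hdiag]
      exact hinvt.sub hay.d
    have h1 : diagHom S c (MonoidAlgebra.of ℂ (spinCover P) u * ζ) =
        diagHom S c (ζ * MonoidAlgebra.of ℂ (spinCover P) u) := by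
      rw [map_mul, map_mul, diagHom_of]
      exact (hinvζ u).symm
    exact eq_of_isGenuine hinv hc (hgen.mul_right _) (hgen.of_mul u) h1
  · have hda : X.d a = diracElt S c * a + a * diracElt S c := by
      rw [DiracDatum.d_apply, hepa, neg_mul, sub_neg_eq_add]
      rfl
    rw [hdiag, add_assoc, ← hda, sub_add_cancel]

/-- The image of the center of `ℂ[W̃]` meets `D A + A D` trivially. -/
theorem diagHom_eq_zero_of_center (hinv : ∀ (i : ι) (x y : N),
      inner ℝ (P.coreflection i x) (P.coreflection i y) = inner ℝ x y)
    (hc : ∀ i j : ι, c (P.reflectionPerm i j) = c j)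
    {ζ : SpinAlg P} (hζ : ζ ∈ Subalgebra.center ℂ (SpinAlg P)) {a b : HeckeCliff S c}
    (h : diagHom S c ζ = diracElt S c * a + b * diracElt S c) : diagHom S c ζ = 0 := by
  rcases subsingleton_or_nontrivial N with hN | hN
  · rw [h, dirac_eq_zero, zero_mul, mul_zero, add_zero]
  have := spinCover_finite S hinv
  have := Fintype.ofFinite (spinCover P)
  let X := diracDatum S hinv hc
  have hspan : diagHom S c ζ ∈ Submodule.span ℂ (Set.range X.rho) := by
    change _ ∈ Submodule.span ℂ (Set.range (spinHom S c))
    rw [span_spinHom]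
    exact ⟨ζ, rfl⟩
  have hinvζ : X.Inv false (diagHom S c ζ) := by
    rw [Subalgebra.mem_center_iff] at hζ
    intro u
    change diagHom S c ζ * spinHom S c u = spinHom S c u * diagHom S c ζ
    rw [← diagHom_of, ← map_mul, ← map_mul, hζ]
  obtain ⟨v, w, σ, hσ, hvw, hwv, hv, hev⟩ := exists_volume (onb_orthonormal N)
  have hvw' : pureTensor S c 1 v * pureTensor S c 1 w = 1 := by
    rw [pureTensor_mul, hvw, one_mul, pureTensor_one]
  have hwv' : pureTensor S c 1 w * pureTensor S c 1 v = 1 := by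
    rw [pureTensor_mul, hwv, one_mul, pureTensor_one]
  have hvD : pureTensor S c 1 v * diracElt S c = σ • (diracElt S c * pureTensor S c 1 v) := by
    rw [diracElt, Finset.mul_sum, Finset.sum_mul, Finset.smul_sum]
    refine Finset.sum_congr rfl fun i _ => ?_
    rw [pureTensor_mul, pureTensor_mul, hv, map_smul, one_mul, mul_one]
  have hev' : parity S c (pureTensor S c 1 v) = -(σ • pureTensor S c 1 v) := by
    rw [parity_tmul, hev, map_neg, map_smul]
  have hσσ : σ * σ = 1 := by rcases hσ with rfl | rfl <;> norm_num
  have hvρ : ∃ β : Bool, ∀ u, pureTensor S c 1 v * X.rho u = X.tw β (X.rho u) *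
      pureTensor S c 1 v := by
    rcases hσ with rfl | rfl
    · refine ⟨false, fun u => ?_⟩
      change pureTensor S c 1 v * spinHom S c u = spinHom S c u * pureTensor S c 1 v
      rw [spinHom_apply, pureTensor_mul, pureTensor_mul, one_mul, mul_one,
        volume_mul fun x => by rw [hv, one_smul]]
    · refine ⟨true, fun u => ?_⟩
      change pureTensor S c 1 v * spinHom S c u =
        parity S c (spinHom S c u) * pureTensor S c 1 v
      rw [spinHom_apply, parity_tmul, pureTensor_mul, pureTensor_mul, one_mul, mul_one,
        volume_mul' fun x => by rw [hv, neg_one_smul]]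
  obtain ⟨β, hβ⟩ := hvρ
  exact X.eq_zero_of_eq_add hspan hinvζ h (fun x hx => eq_zero_of_mul_dirac hinv hc hx)
    hσσ hvw' hwv' hvD hev' hβ

/-- The image under the diagonal map of the central element attached to `z` is unique. -/
theorem diagHom_eq_of_center (hinv : ∀ (i : ι) (x y : N),
      inner ℝ (P.coreflection i x) (P.coreflection i y) = inner ℝ x y)
    (hc : ∀ i j : ι, c (P.reflectionPerm i j) = c j)
    {ζ ζ' : SpinAlg P} (hζ : ζ ∈ Subalgebra.center ℂ (SpinAlg P))
    (hζ' : ζ' ∈ Subalgebra.center ℂ (SpinAlg P)) {t a b a' b' : HeckeCliff S c}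
    (h : t = diagHom S c ζ + diracElt S c * a + b * diracElt S c)
    (h' : t = diagHom S c ζ' + diracElt S c * a' + b' * diracElt S c) :
    diagHom S c ζ' = diagHom S c ζ := by
  have h1 : diagHom S c (ζ' - ζ) = 0 := by
    refine diagHom_eq_zero_of_center hinv hc (sub_mem hζ' hζ) (a := a - a') (b := b - b') ?_
    have h3 := eq_sub_of_add_eq (eq_sub_of_add_eq h'.symm)
    rw [map_sub, h3, h]
    noncomm_ring
  rwa [map_sub, sub_eq_zero] at h1

end Main

end HeckeDirac

end

theorem theorem4p7 {ι V N : Type*} [Fintype ι] [AddCommGroup V] [Module ℝ V]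
    [NormedAddCommGroup N] [InnerProductSpace ℝ N]
    (P : RootPairing ι ℝ V N) [P.IsRootSystem] [P.IsReduced]
    (hinv : ∀ (i : ι) (x y : N),
      inner ℝ (P.coreflection i x) (P.coreflection i y) = inner ℝ x y)
    (S : HeckeDirac.SimpleSystem P)
    (c : ι → ℝ) (hc : ∀ i j : ι, c (P.reflectionPerm i j) = c j)
    {κ : Type*} [Fintype κ] [DecidableEq κ] (b b' : Module.Basis κ ℂ (ℂ ⊗[ℝ] N))
    (hb : ∀ i j : κ, HeckeDirac.complexForm N (b i) (b' j) = if i = j then 1 else 0)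
    (z : HeckeDirac.Hecke P S c)
    (hz : z ∈ Subalgebra.center ℂ (HeckeDirac.Hecke P S c)) :
    ∃ ζ ∈ Subalgebra.center ℂ (HeckeDirac.SpinAlg P),
      HeckeDirac.IsGenuine P ζ ∧
      (∃ a : HeckeDirac.Hecke P S c ⊗[ℂ] HeckeDirac.Cliff N,
        z ⊗ₜ[ℂ] 1 = HeckeDirac.rho P S c ζ
          + HeckeDirac.dirac P S c b b' * a + a * HeckeDirac.dirac P S c b b') ∧
      ∀ ζ' ∈ Subalgebra.center ℂ (HeckeDirac.SpinAlg P),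
        (∃ a' b'' : HeckeDirac.Hecke P S c ⊗[ℂ] HeckeDirac.Cliff N,
          z ⊗ₜ[ℂ] 1 = HeckeDirac.rho P S c ζ'
            + HeckeDirac.dirac P S c b b' * a' + b'' * HeckeDirac.dirac P S c b b') →
        HeckeDirac.rho P S c ζ' = HeckeDirac.rho P S c ζ ∧
          (HeckeDirac.IsGenuine P ζ' → ζ' = ζ) := by
  have := HeckeDirac.finiteDimensional_of_isRootSystem P
  rw [HeckeDirac.dirac_eq b b' hb]
  obtain ⟨ζ, hζ, hgen, a, ha⟩ := HeckeDirac.exists_genuine_of_center (S := S) hinv hc hz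
  refine ⟨ζ, hζ, hgen, ⟨a, ha⟩, fun ζ' hζ' h => ?_⟩
  obtain ⟨a', b'', h'⟩ := h
  have h1 : HeckeDirac.diagHom S c ζ' = HeckeDirac.diagHom S c ζ :=
    HeckeDirac.diagHom_eq_of_center hinv hc hζ hζ' ha h'
  exact ⟨h1, fun hgen' => HeckeDirac.eq_of_isGenuine hinv hc hgen hgen' h1⟩
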